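/- Let $k$ be a field, $\otimes=\otimes_k$. $CoCoalg_k$ is the monoidal category of cocommutative $k$-coalgebras. Sweedler notation is used with the sum suppressed. **Commutative Hopf algebroids.** A commutative Hopf algebroid $\mathcal U=(U,A,s,t,\Delta,\epsilon,S)$ over $k$ consists of commutative $k$-algebras $A,U$; $k$-algebra maps $s,t:A\to U$, which make $U$ an $(A,A)$-bimodule by $a\cdot u\cdot b=s(a)t(b)u$; a unital $k$-algebra map $\Delta:U\to U\otimes_AU$, $\Delta(u)=u_{(1)}\otimes u_{(2)}$, and a $k$-linear map $\epsilon:U\to A$ that make $U$ a (coassociative, counital) coalgebra in $(A,A)$-bimodules, with $\epsilon(u\,s(\epsilon(v)))=\epsilon(uv)=\epsilon(u\,t(\epsilon(v)))$; and a $k$-algebra map $S:U\to U$ with $S^2=\mathrm{id}$, $S\circ t=s$ and, in $U\otimes_AU$, $$S(u_{(1)})_{(1)}u_{(2)}\otimes S(u_{(1)})_{(2)}=1\otimes S(u),\qquad S(u_{(2)})_{(1)}\otimes S(u_{(2)})_{(2)}u_{(1)}=S(u)\otimes1 .$$ **Measurings.** Let $C$ be a cocommutative $k$-coalgebra. A $C$-measuring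 from a $k$-algebra $R$ to a $k$-algebra $R'$ is a $k$-linear map $C\to \mathrm{Hom}_k(R,R')$, written $x\mapsto(x:R\to R')$, with $x(ab)=x_{(1)}(a)x_{(2)}(b)$ and $x(1)=\epsilon_C(x)1$. A $C$-measuring $(\Psi,\psi)$ from $\mathcal U$ to $\mathcal U'$ is a pair of $C$-measurings $\Psi$ from $U$ to $U'$ and $\psi$ from $A$ to $A'$ such that every $x\in C$ satisfies $xs=s'x$, $xt=t'x$, $xS=S'x$, $x\epsilon=\epsilon'x$ and $\Delta'(x(u))=x_{(1)}(u_{(1)})\otimes x_{(2)}(u_{(2)})$. Write $\varphi_c:\mathcal M_c(R,R')\to\mathrm{Hom}_k(R,R')$ and $(\Phi,\phi)$ on $\mathcal M_c(\mathcal U,\mathcal U')$ for the universal (that is, final) measurings by cocommutative coalgebras, of algebras and of commutative Hopf algebroids respectively. **The first enriched category.** $cHALG_k$ has the commutative Hopf algebroids as objects and $\mathcal M_c(\mathcal U,\mathcal U')$ as hom-objects. Composition $\mathcal M_c(\mathcal U,\mathcal U')\otimes\mathcal M_c(\mathcal U',\mathcal U'')\to\mathcal M_c(\mathcal U,\mathcal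 U'')$ and unit $k\to\mathcal M_c(\mathcal U,\mathcal U)$ are the coalgebra maps induced, by the universal property, by the measurings $x\otimes y\mapsto y\circ x$ and $\lambda\mapsto\lambda\cdot\mathrm{id}$. **Hochschild homology and shuffles.** Let $\epsilon_R=\epsilon\circ S$. Put $C_0(\mathcal U)=A$ and, for $n\ge1$, let $C_n(\mathcal U)$ be the $n$-fold tensor product $U\otimes_A\cdots\otimes_AU$ for the $A$-module structure on $U$ given by $t$. The faces $d_i:C_n(\mathcal U)\to C_{n-1}(\mathcal U)$ are $$d_i(u^1\otimes\dots\otimes u^n)=\begin{cases}t(\epsilon_R(u^1))u^2\otimes\dots\otimes u^n&i=0\\u^1\otimes\dots\otimes u^iu^{i+1}\otimes\dots\otimes u^n&1\le i\le n-1\\u^1\otimes\dots\otimes u^{n-1}t(\epsilon(u^n))&i=n\end{cases}$$ (for $n=1$: $d_0=\epsilon_R$, $d_1=\epsilon$), and $HH_\bullet(\mathcal U)=\bigoplus_nHH_n(\mathcal U)$ is the homology of $C_\bullet(\mathcal U)$ with differential $d=\sum_i(-1)^id_i$. It is a $k$-algebra $(HH_\bullet(\mathcal U),sh)$ under the product induced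 by the shuffle product $$(u^1\otimes\dots\otimes u^p)\cdot(u^{p+1}\otimes\dots\otimes u^{p+q})=\sum_{\sigma}\mathrm{sgn}(\sigma)\,u^{\sigma^{-1}(1)}\otimes\dots\otimes u^{\sigma^{-1}(p+q)},$$ the sum being over all $\sigma\in S_{p+q}$ with $\sigma(1)<\dots<\sigma(p)$ and $\sigma(p+1)<\dots<\sigma(p+q)$; for $p=0$ or $q=0$ the product is the $A$-module structure. **The second enriched category.** $\widetilde{cHALG}_k$ has the same objects as $cHALG_k$ and the hom-objects $\mathcal M_c((HH_\bullet(\mathcal U),sh),(HH_\bullet(\mathcal U'),sh))$, with composition and units again induced by $x\otimes y\mapsto y\circ x$ and $\lambda\mapsto\lambda\cdot\mathrm{id}$. **Theorem.** For all commutative Hopf algebroids $\mathcal U,\mathcal U'$ over $k$ and all $x\in\mathcal M_c(\mathcal U,\mathcal U')$, the maps $\underline\Phi_n(x):C_n(\mathcal U)\to C_n(\mathcal U')$ given by $$\underline\Phi_n(x)(u^1\otimes\dots\otimes u^n)=x_{(1)}(u^1)\otimes\dots\otimes x_{(n)}(u^n)\quad(n\ge1),\qquad \underline\Phi_0(x)=\phi(x)$$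 form a chain map, and there is a $CoCoalg_k$-enriched functor $\tau:cHALG_k\to\widetilde{cHALG}_k$ that is the identity on objects and whose map on hom-objects $$\tau(\mathcal U,\mathcal U'):\mathcal M_c(\mathcal U,\mathcal U')\longrightarrow\mathcal M_c\big((HH_\bullet(\mathcal U),sh),(HH_\bullet(\mathcal U'),sh)\big)$$ is the one induced by the action of $\mathcal M_c(\mathcal U,\mathcal U')$ on Hochschild homology: $\varphi_c(\tau(\mathcal U,\mathcal U')(x))([z])=[\underline\Phi_\bullet(x)(z)]$ for every cycle $z$ of $C_\bullet(\mathcal U)$. -/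

import Mathlib

universe u v w

set_option linter.unusedVariables false
set_option linter.unusedSectionVars false

noncomputable section

open TensorProduct

namespace BarComplex

section Generic
variable (A : Type u) (U : Type v) [CommRing A] [CommRing U] [Algebra A U]

/-- The total space `⨁ₙ U ⊗_A ⋯ ⊗_A U` (`n` factors in degree `n`, so that degree `0` is `A`). -/
def Chains : Type (max u v) := DirectSum ℕ fun n => ⨂[A]^n U

instance : AddCommGroup (Chains A U) :=
  inferInstanceAs (AddCommGroup (DirectSum ℕ fun n => ⨂[A]^n U))

instance {S : Type*} [CommRing S] [Algebra S A] : Module S (Chains A U) :=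
  inferInstanceAs (Module S (DirectSum ℕ fun n => ⨂[A]^n U))

instance {S : Type*} [CommRing S] [Algebra S A] : IsScalarTower S A (Chains A U) :=
  inferInstanceAs (IsScalarTower S A (DirectSum ℕ fun n => ⨂[A]^n U))

instance : IsScalarTower ℕ A (Chains A U) := inferInstance

/-- The inclusion of the degree `n` part. -/
def Chains.of (n : ℕ) : (⨂[A]^n U) →ₗ[A] Chains A U := DirectSum.lof A ℕ (fun n => ⨂[A]^n U) n

variable {A U}

/-- The linear map on the total space with given restriction to each degree. -/
def Chains.lift {M : Type*} [AddCommGroup M] [Module A M] (f : ∀ n, (⨂[A]^n U) →ₗ[A] M) :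
    Chains A U →ₗ[A] M := DirectSum.toModule A ℕ M f

@[simp] lemma Chains.lift_of {M : Type*} [AddCommGroup M] [Module A M]
    (f : ∀ n, (⨂[A]^n U) →ₗ[A] M) (n : ℕ) (x) : Chains.lift f (Chains.of A U n x) = f n x := by
  unfold Chains.lift Chains.of
  exact DirectSum.toModule_lof (R := A) (ι := ℕ) (M := fun n => ⨂[A]^n U) (φ := f) n x

/-- The tuple `(u¹, …, uⁱ uⁱ⁺¹, …, uⁿ⁺¹)` for `1 ≤ i ≤ n`. -/
def contract (n : ℕ) (i : Fin (n + 2)) (u : Fin (n + 1) → U) : Fin n → U := fun j =>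
  if (j : ℕ) + 1 < i then u j.castSucc
  else if (j : ℕ) + 1 = i then u j.castSucc * u j.succ
  else u j.succ

lemma contract_update (n : ℕ) (i : Fin (n + 2)) (h0 : i ≠ 0) (h1 : i ≠ Fin.last (n + 1))
    (u : Fin (n + 1) → U) (m : Fin (n + 1)) :
    ∃ (j : Fin n) (c : U), ∀ x, contract n i (Function.update u m x) =
      Function.update (contract n i u) j (c * x) := by
  have h0' : (i : ℕ) ≠ 0 := fun h => h0 (Fin.ext h)
  have h1' : (i : ℕ) ≠ n + 1 := fun h => h1 (Fin.ext h)
  have hm := m.2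
  have hi := i.2
  by_cases hlt : (m : ℕ) < i
  · refine ⟨⟨m, by omega⟩, if (m : ℕ) + 1 = i then u ⟨m + 1, by omega⟩ else 1, fun x => ?_⟩
    funext j
    simp only [contract, Function.update_apply, Fin.ext_iff, Fin.val_castSucc, Fin.val_succ]
    split_ifs <;> first | omega | skip
    all_goals try simp
    rw [mul_comm]
    congr 2
    ext; simp; omega
  · refine ⟨⟨m - 1, by omega⟩, if (m : ℕ) = i then u ⟨m - 1, by omega⟩ else 1, fun x => ?_⟩
    funext j
    simp only [contract, Function.update_apply, Fin.ext_iff, Fin.val_castSucc, Fin.val_succ]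
    split_ifs <;> first | omega | skip
    all_goals try simp
    congr 2
    ext; simp; omega

variable (εr εl : U →ₗ[A] A)

/-- The `i`-th face of `u¹ ⊗ ⋯ ⊗ uⁿ⁺¹`: `εr(u¹) • u² ⊗ ⋯ ⊗ uⁿ⁺¹` for `i = 0`,
`εl(uⁿ⁺¹) • u¹ ⊗ ⋯ ⊗ uⁿ` for `i = n + 1`, and `u¹ ⊗ ⋯ ⊗ uⁱ uⁱ⁺¹ ⊗ ⋯ ⊗ uⁿ⁺¹` otherwise. -/
def face (n : ℕ) (i : Fin (n + 2)) : (⨂[A]^(n + 1) U) →ₗ[A] ⨂[A]^n U :=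
  PiTensorProduct.lift
    { toFun := fun u =>
        if i = 0 then εr (u 0) • PiTensorProduct.tprod A (fun j : Fin n => u j.succ)
        else if i = Fin.last (n + 1) then
          εl (u (Fin.last n)) • PiTensorProduct.tprod A (fun j : Fin n => u j.castSucc)
        else PiTensorProduct.tprod A (contract n i u)
      map_update_add' := by
        intro inst u m x y
        obtain rfl : inst = instDecidableEqFin (n + 1) := Subsingleton.elim _ _
        split_ifs with h0 h1
        · cases m using Fin.cases with
          | zero => simp [add_smul]
          | succ m =>
            have : ∀ x, (fun j : Fin n => Function.update u m.succ x j.succ) =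
              Function.update (fun j => u j.succ) m x := by
              intro x; funext j; simp [Function.update_apply]
            simp [this, (Fin.succ_ne_zero m).symm]
        · cases m using Fin.lastCases with
          | last => simp [add_smul, Fin.castSucc_ne_last]
          | cast m =>
            have : ∀ x, (fun j : Fin n => Function.update u m.castSucc x j.castSucc) =
              Function.update (fun j => u j.castSucc) m x := by
              intro x; funext j; simp [Function.update_apply]
            simp [this, (Fin.castSucc_ne_last m).symm]
        · obtain ⟨j, c, h⟩ := contract_update n i h0 h1 u m
          simp [h, mul_add]
      map_update_smul' := by
        intro inst u m c x
        obtain rfl : inst = instDecidableEqFin (n + 1) := Subsingleton.elim _ _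
        split_ifs with h0 h1
        · cases m using Fin.cases with
          | zero => simp [mul_smul]
          | succ m =>
            have : ∀ x, (fun j : Fin n => Function.update u m.succ x j.succ) =
              Function.update (fun j => u j.succ) m x := by
              intro x; funext j; simp [Function.update_apply]
            simp [this, (Fin.succ_ne_zero m).symm, smul_comm c]
        · cases m using Fin.lastCases with
          | last => simp [mul_smul, Fin.castSucc_ne_last]
          | cast m =>
            have : ∀ x, (fun j : Fin n => Function.update u m.castSucc x j.castSucc) =
              Function.update (fun j => u j.castSucc) m x := by
              intro x; funext j; simp [Function.update_apply]
            simp [this, (Fin.castSucc_ne_last m).symm, smul_comm c]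
        · obtain ⟨j, d, h⟩ := contract_update n i h0 h1 u m
          simp [h] }

/-- The Hochschild boundary `∑ᵢ (-1)ⁱ dᵢ` on the total space. -/
def boundary : Chains A U →ₗ[A] Chains A U := Chains.lift fun n =>
  match n with
  | 0 => 0
  | n + 1 => Chains.of A U n ∘ₗ ∑ i : Fin (n + 2), (-1 : A) ^ (i : ℕ) • face εr εl n i

/-- The `(p,q)`-shuffles: permutations increasing on the first `p` and on the last `q` places. -/
def Sh (p q : ℕ) : Finset (Equiv.Perm (Fin (p + q))) := by
  classical exact
  Finset.univ.filter fun σ =>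
    (StrictMono fun i : Fin p => σ (Fin.castAdd q i)) ∧
      StrictMono fun j : Fin q => σ (Fin.natAdd p j)

variable (A U) in
/-- The sum `∑ sgn(σ) w(σ⁻¹(1)) ⊗ ⋯ ⊗ w(σ⁻¹(p+q))` over `(p,q)`-shuffles `σ`. -/
def shSum (p q : ℕ) : MultilinearMap A (fun _ : Fin (p + q) => U) (⨂[A]^(p + q) U) :=
  ∑ σ ∈ Sh p q, ((Equiv.Perm.sign σ : ℤ) : A) •
    (PiTensorProduct.tprod A : MultilinearMap A (fun _ : Fin (p + q) => U) _).domDomCongr σ⁻¹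

lemma shSum_apply (p q : ℕ) (w : Fin (p + q) → U) :
    shSum A U p q w = ∑ σ ∈ Sh p q, ((Equiv.Perm.sign σ : ℤ) : A) •
        PiTensorProduct.tprod A fun j => w (σ⁻¹ j) := by
  rw [shSum, sum_apply]
  rfl

variable (A U) in
/-- The `(p,q)`-shuffle product `C_p × C_q → C_{p+q}`. If `p = 0` or `q = 0` it is the
`A`-module structure. -/
def shPQ (p q : ℕ) : (⨂[A]^p U) →ₗ[A] (⨂[A]^q U) →ₗ[A] ⨂[A]^(p + q) U :=
  PiTensorProduct.lift
    ((PiTensorProduct.lift (R := A) (s := fun _ : Fin q => U)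
        (E := ⨂[A]^(p + q) U)).toLinearMap.compMultilinearMap
      ((shSum A U p q).domDomCongr finSumFinEquiv.symm).currySum)

lemma shPQ_tprod (p q : ℕ) (x : Fin p → U) (y : Fin q → U) :
    shPQ A U p q (PiTensorProduct.tprod A x) (PiTensorProduct.tprod A y) =
      shSum A U p q (Fin.append x y) := by
  simp only [shPQ, PiTensorProduct.lift.tprod, LinearMap.compMultilinearMap_apply,
    LinearEquiv.coe_coe, MultilinearMap.currySum_apply, MultilinearMap.domDomCongr_apply]
  congr 1
  funext i
  cases i using Fin.addCases <;> simp

variable (A U) in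
/-- The shuffle product on the total space. -/
def shuffle : Chains A U →ₗ[A] Chains A U →ₗ[A] Chains A U :=
  Chains.lift fun p => LinearMap.flip (Chains.lift fun q =>
    (LinearMap.flip (shPQ A U p q)).compr₂ (Chains.of A U (p + q)))

lemma shuffle_of (p q : ℕ) (x : ⨂[A]^p U) (y : ⨂[A]^q U) :
    shuffle A U (Chains.of A U p x) (Chains.of A U q y) =
      Chains.of A U (p + q) (shPQ A U p q x y) := by
  simp [shuffle]

/-- The map `u¹ ⊗ ⋯ ⊗ uⁿ ↦ u ⊗ u¹ ⊗ ⋯ ⊗ uⁿ`. -/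
def consC (n : ℕ) (u : U) : (⨂[A]^n U) →ₗ[A] ⨂[A]^(n + 1) U :=
  PiTensorProduct.lift ((PiTensorProduct.tprod A : MultilinearMap A (fun _ : Fin (n + 1) => U) _).curryLeft u)

lemma consC_tprod (n : ℕ) (u : U) (x : Fin n → U) :
    consC n u (PiTensorProduct.tprod A x) = PiTensorProduct.tprod A (Fin.cons u x : Fin (n + 1) → U) := by
  simp [consC]

/-- The map `u¹ ⊗ ⋯ ⊗ uⁿ ↦ u ⊗ u¹ ⊗ ⋯ ⊗ uⁿ` on the total space. -/
def prepend (u : U) : Chains A U →ₗ[A] Chains A U :=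
  Chains.lift fun n => Chains.of A U (n + 1) ∘ₗ consC n u

/-- The involution that is `(-1)ⁿ` in degree `n`. -/
def signMap : Chains A U →ₗ[A] Chains A U :=
  Chains.lift fun n => (-1 : A) ^ n • Chains.of A U n

variable (A) in
/-- The pure tensor of a list. -/
def word (l : List U) : Chains A U := Chains.of A U l.length (PiTensorProduct.tprod A l.get)

lemma word_cons (u : U) (l : List U) : word A (u :: l) = prepend u (word A l) := by
  simp only [word, prepend, Chains.lift_of, LinearMap.comp_apply, consC_tprod]
  refine congrArg (Chains.of A U (l.length + 1)) (congrArg (PiTensorProduct.tprod A) ?_)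
  funext i
  cases i using Fin.cases <;> rfl

lemma word_ofFn {n : ℕ} (x : Fin n → U) :
    word A (List.ofFn x) = Chains.of A U n (PiTensorProduct.tprod A x) := by
  induction n with
  | zero =>
    rw [List.ofFn_zero]
    refine congrArg (Chains.of A U 0) (congrArg (PiTensorProduct.tprod A) ?_)
    exact Subsingleton.elim (α := Fin 0 → U) _ _
  | succ n ih =>
    rw [List.ofFn_succ, word_cons, ih]
    simp only [prepend, Chains.lift_of, LinearMap.comp_apply, consC_tprod]
    refine congrArg (Chains.of A U (n + 1)) (congrArg (PiTensorProduct.tprod A) ?_)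
    exact Fin.cons_self_tail x

lemma chains_induction {P : Chains A U → Prop} (h0 : P 0) (hadd : ∀ x y, P x → P y → P (x + y))
    (hs : ∀ (a : A) x, P x → P (a • x)) (hw : ∀ l, P (word A l)) (x) : P x := by
  have : ∀ n (z : ⨂[A]^n U), P (Chains.of A U n z) := by
    intro n z
    induction z using PiTensorProduct.induction_on with
    | smul_tprod r f => rw [map_smul]; exact hs _ _ (word_ofFn (A := A) f ▸ hw _)
    | add x y hx hy => rw [map_add]; exact hadd _ _ hx hy
  induction x using DirectSum.induction_on with
  | zero => exact h0
  | of n z => exact this n z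
  | add x y hx hy => exact hadd _ _ hx hy

lemma hom_ext {M : Type*} [AddCommGroup M] [Module A M] {f g : Chains A U →ₗ[A] M}
    (h : ∀ l, f (word A l) = g (word A l)) : f = g := by
  refine LinearMap.ext fun x => ?_
  induction x using chains_induction with
  | h0 => simp
  | hadd x y hx hy => simp [hx, hy]
  | hs a x hx => simp [hx]
  | hw l => exact h l

lemma signMap_word (l : List U) : signMap (word A l) = (-1 : A) ^ l.length • word A l := by
  simp [signMap, word]

@[simp] lemma signMap_prepend (u : U) (x : Chains A U) : signMap (prepend u x) = - prepend u (signMap x) := by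
  suffices h : signMap ∘ₗ prepend u = -(prepend u ∘ₗ (signMap : Chains A U →ₗ[A] _)) from LinearMap.congr_fun h x
  refine hom_ext fun l => ?_
  simp only [LinearMap.comp_apply, LinearMap.neg_apply, ← word_cons, signMap_word, map_smul]
  simp [pow_succ]

@[simp] lemma signMap_signMap (x : Chains A U) : signMap (signMap x) = x := by
  suffices h : signMap ∘ₗ signMap = (LinearMap.id : Chains A U →ₗ[A] _) from LinearMap.congr_fun h x
  refine hom_ext fun l => ?_
  simp only [LinearMap.comp_apply, signMap_word, map_smul, smul_smul, ← mul_pow]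
  simp

@[simp] lemma signMap_nil : signMap (word A ([] : List U)) = word A [] := by simp [signMap_word]

/-- The signed sum over permutations that are increasing along `a` and along `b`. -/
def shuffleSum {p q : ℕ} (n : ℕ) (a : Fin p → Fin n) (b : Fin q → Fin n) (w : Fin n → U) : Chains A U := by
  classical exact
  ∑ σ : Equiv.Perm (Fin n), if (StrictMono (σ ∘ a) ∧ StrictMono (σ ∘ b)) then
    ((Equiv.Perm.sign σ : ℤ) : A) • Chains.of A U n (PiTensorProduct.tprod A (w ∘ σ.symm)) else 0

/-- The extension of a permutation of `n` elements that sends `j` to `0`. -/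
def insertPerm {n : ℕ} (j : Fin (n + 1)) (σ : Equiv.Perm (Fin n)) : Equiv.Perm (Fin (n + 1)) :=
  Equiv.Perm.decomposeFin.symm (0, σ) * j.cycleRange

lemma insertPerm_self {n : ℕ} (j : Fin (n + 1)) (σ : Equiv.Perm (Fin n)) : insertPerm j σ j = 0 := by
  simp [insertPerm]

lemma insertPerm_succAbove {n : ℕ} (j : Fin (n + 1)) (σ : Equiv.Perm (Fin n)) (i : Fin n) :
    insertPerm j σ (j.succAbove i) = (σ i).succ := by
  simp [insertPerm]

lemma insertPerm_symm_zero {n : ℕ} (j : Fin (n + 1)) (σ : Equiv.Perm (Fin n)) :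
    (insertPerm j σ).symm 0 = j := by
  rw [Equiv.symm_apply_eq, insertPerm_self]

lemma insertPerm_symm_succ {n : ℕ} (j : Fin (n + 1)) (σ : Equiv.Perm (Fin n)) (i : Fin n) :
    (insertPerm j σ).symm i.succ = j.succAbove (σ.symm i) := by
  rw [Equiv.symm_apply_eq, insertPerm_succAbove, Equiv.apply_symm_apply]

lemma insertPerm_sign {n : ℕ} (j : Fin (n + 1)) (σ : Equiv.Perm (Fin n)) :
    Equiv.Perm.sign (insertPerm j σ) = (-1) ^ (j : ℕ) * Equiv.Perm.sign σ := by
  simp [insertPerm, mul_comm, Equiv.Perm.decomposeFin.symm_sign]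

lemma insertPerm_bijective (n : ℕ) : Function.Bijective
    fun x : Fin (n + 1) × Equiv.Perm (Fin n) => insertPerm x.1 x.2 := by
  rw [Fintype.bijective_iff_injective_and_card]
  refine ⟨?_, by simp [Fintype.card_perm, Nat.factorial_succ]⟩
  rintro ⟨j, σ⟩ ⟨j', σ'⟩ h
  simp only at h
  have hj : j = j' := by rw [← insertPerm_symm_zero j σ, h, insertPerm_symm_zero]
  subst hj
  refine Prod.ext rfl (Equiv.ext fun i => ?_)
  have := insertPerm_succAbove j σ i
  rw [h, insertPerm_succAbove] at this
  exact (Fin.succ_injective _ this).symm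

lemma strictMono_insertPerm_head {p n : ℕ} (σ : Equiv.Perm (Fin n)) (a : Fin (p + 1) → Fin (n + 1))
    (a' : Fin p → Fin n) (h : ∀ i, a i.succ = (a 0).succAbove (a' i)) :
    StrictMono (insertPerm (a 0) σ ∘ a) ↔ StrictMono (σ ∘ a') := by
  constructor
  · intro H i i' hi
    have := H (Fin.succ_lt_succ_iff.2 hi)
    simp only [Function.comp, h, insertPerm_succAbove] at this
    exact Fin.succ_lt_succ_iff.1 this
  · intro H i i' hi
    simp only [Function.comp]
    cases i' using Fin.cases with
    | zero => exact absurd hi (Fin.not_lt_zero _)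
    | succ i' =>
      rw [h, insertPerm_succAbove]
      cases i using Fin.cases with
      | zero => rw [insertPerm_self]; exact Fin.succ_pos _
      | succ i =>
        rw [h, insertPerm_succAbove]
        exact Fin.succ_lt_succ_iff.2 (H (Fin.succ_lt_succ_iff.1 hi))

lemma strictMono_insertPerm_tail {p n : ℕ} (j : Fin (n + 1)) (σ : Equiv.Perm (Fin n))
    (a : Fin p → Fin (n + 1)) (a' : Fin p → Fin n) (h : ∀ i, a i = j.succAbove (a' i)) :
    StrictMono (insertPerm j σ ∘ a) ↔ StrictMono (σ ∘ a') := by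
  have : insertPerm j σ ∘ a = Fin.succ ∘ (σ ∘ a') := by
    funext i; simp [h, insertPerm_succAbove]
  rw [this]
  exact ⟨fun H i i' hi => Fin.succ_lt_succ_iff.1 (H hi),
    fun H i i' hi => Fin.succ_lt_succ_iff.2 (H hi)⟩

lemma of_insertPerm {n : ℕ} (j : Fin (n + 1)) (σ : Equiv.Perm (Fin n)) (w : Fin (n + 1) → U) :
    ((Equiv.Perm.sign (insertPerm j σ) : ℤ) : A) • Chains.of A U (n + 1)
      (PiTensorProduct.tprod A (w ∘ (insertPerm j σ).symm)) =
    (-1 : A) ^ (j : ℕ) • prepend (w j) (((Equiv.Perm.sign σ : ℤ) : A) • Chains.of A U n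
      (PiTensorProduct.tprod A ((w ∘ j.succAbove) ∘ σ.symm))) := by
  have : (w ∘ (insertPerm j σ).symm) = (Fin.cons (w j) ((w ∘ j.succAbove) ∘ σ.symm) : Fin (n + 1) → U) := by
    funext i
    cases i using Fin.cases with
    | zero => simp [insertPerm_symm_zero]
    | succ i => simp [insertPerm_symm_succ]
  rw [this, insertPerm_sign, map_smul, smul_smul]
  simp only [prepend, Chains.lift_of, LinearMap.comp_apply, consC_tprod]
  push_cast
  rfl

lemma shuffleSum_succ {p q n : ℕ} (a : Fin (p + 1) → Fin (n + 1)) (b : Fin (q + 1) → Fin (n + 1))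
    (w : Fin (n + 1) → U) (hab : a 0 ≠ b 0) (hcov : ∀ j, (∃ i, a i = j) ∨ ∃ i, b i = j)
    (a₁ : Fin p → Fin n) (b₁ : Fin (q + 1) → Fin n) (a₂ : Fin (p + 1) → Fin n) (b₂ : Fin q → Fin n)
    (ha₁ : ∀ i, a i.succ = (a 0).succAbove (a₁ i)) (hb₁ : ∀ i, b i = (a 0).succAbove (b₁ i))
    (ha₂ : ∀ i, a i = (b 0).succAbove (a₂ i)) (hb₂ : ∀ i, b i.succ = (b 0).succAbove (b₂ i)) :
    shuffleSum (A := A) (n + 1) a b w =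
      (-1 : A) ^ (a 0 : ℕ) • prepend (w (a 0)) (shuffleSum n a₁ b₁ (w ∘ (a 0).succAbove)) +
      (-1 : A) ^ (b 0 : ℕ) • prepend (w (b 0)) (shuffleSum n a₂ b₂ (w ∘ (b 0).succAbove)) := by
  classical
  rw [shuffleSum, ← (insertPerm_bijective n).sum_comp, Fintype.sum_prod_type]
  have hz : ∀ j : Fin (n + 1), j ∉ ({a 0, b 0} : Finset _) →
      (∑ σ : Equiv.Perm (Fin n), if (StrictMono (insertPerm j σ ∘ a) ∧ StrictMono (insertPerm j σ ∘ b)) then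
        ((Equiv.Perm.sign (insertPerm j σ) : ℤ) : A) • Chains.of A U (n + 1)
          (PiTensorProduct.tprod A (w ∘ (insertPerm j σ).symm)) else 0) = 0 := by
    intro j hj
    refine Finset.sum_eq_zero fun σ _ => if_neg ?_
    simp only [Finset.mem_insert, Finset.mem_singleton, not_or] at hj
    rintro ⟨hA, hB⟩
    rcases hcov j with ⟨i, rfl⟩ | ⟨i, rfl⟩
    · have hi : 0 < i := Fin.pos_of_ne_zero (fun h => hj.1 (by rw [h]))
      have := hA hi
      simp [insertPerm_self] at this
    · have hi : 0 < i := Fin.pos_of_ne_zero (fun h => hj.2 (by rw [h]))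
      have := hB hi
      simp [insertPerm_self] at this
  rw [← Finset.sum_subset (Finset.subset_univ {a 0, b 0}) fun j _ hj => hz j hj,
    Finset.sum_pair hab]
  congr 1
  · rw [shuffleSum, map_sum, Finset.smul_sum]
    refine Finset.sum_congr rfl fun σ _ => ?_
    simp only [strictMono_insertPerm_head σ a a₁ ha₁, strictMono_insertPerm_tail (a 0) σ b b₁ hb₁, of_insertPerm]
    split_ifs <;> simp
  · rw [shuffleSum, map_sum, Finset.smul_sum]
    refine Finset.sum_congr rfl fun σ _ => ?_
    simp only [strictMono_insertPerm_head σ b b₂ hb₂, strictMono_insertPerm_tail (b 0) σ a a₂ ha₂, of_insertPerm]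
    split_ifs <;> simp

lemma shuffleSum_congr {p q n n' : ℕ} (h : n = n') (a : Fin p → Fin n) (b : Fin q → Fin n) (w : Fin n → U)
    (a' : Fin p → Fin n') (b' : Fin q → Fin n') (w' : Fin n' → U)
    (ha : ∀ i, (a i : ℕ) = a' i) (hb : ∀ i, (b i : ℕ) = b' i)
    (hw : ∀ i, w i = w' (Fin.cast h i)) : shuffleSum (A := A) n a b w = shuffleSum n' a' b' w' := by
  subst h
  obtain rfl : a = a' := funext fun i => Fin.ext (ha i)
  obtain rfl : b = b' := funext fun i => Fin.ext (hb i)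
  obtain rfl : w = w' := funext hw
  rfl

/-- The shuffle product of two pure tensors. -/
lemma shuffle_eq_shuffleSum {p q : ℕ} (x : Fin p → U) (y : Fin q → U) :
    shuffle A U (Chains.of A U p (PiTensorProduct.tprod A x))
      (Chains.of A U q (PiTensorProduct.tprod A y)) =
      shuffleSum (p + q) (Fin.castAdd q) (Fin.natAdd p) (Fin.append x y) := by
  classical
  rw [shuffle_of, shPQ_tprod, shSum_apply, shuffleSum, map_sum, Sh, Finset.sum_filter]
  refine Finset.sum_congr (by congr) fun σ _ => ?_
  simp only [map_smul]
  rfl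

variable (A) in
/-- The shuffle product of the pure tensors of two lists. -/
def wordShuffle (l m : List U) : Chains A U :=
  shuffleSum (p := l.length) (q := m.length) (l ++ m).length
    (fun i => ⟨i, by have := i.2; simp; omega⟩) (fun i => ⟨l.length + i, by simp⟩) (l ++ m).get

lemma shuffle_word (l m : List U) : shuffle A U (word A l) (word A m) = wordShuffle A l m := by
  rw [word, word, shuffle_eq_shuffleSum, wordShuffle]
  refine shuffleSum_congr (by simp) _ _ _ _ _ _ (by simp) (by simp) fun i => ?_
  cases i using Fin.addCases <;> simp

lemma succAbove_val {n : ℕ} (j : Fin (n + 1)) (i : Fin n) :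
    ((j.succAbove i : Fin (n + 1)) : ℕ) = if (i : ℕ) < j then (i : ℕ) else i + 1 := by
  rw [Fin.succAbove]
  simp only [Fin.lt_def, Fin.val_castSucc]
  split_ifs <;> rfl

lemma wordShuffle_cons (u v : U) (l m : List U) : wordShuffle A (u :: l) (v :: m) =
    prepend u (wordShuffle A l (v :: m)) + (-1 : A) ^ (l.length + 1) • prepend v (wordShuffle A (u :: l) m) := by
  have hlen : (l ++ v :: m).length = (u :: l ++ m).length := by simp; omega
  have := shuffleSum_succ (A := A) (p := l.length) (q := m.length) (n := (l ++ v :: m).length)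
    (fun i => ⟨i, by have := i.2; simp; omega⟩) (fun i => ⟨l.length + 1 + i, by simp; omega⟩)
    (u :: l ++ v :: m).get (by simp [Fin.ext_iff]) (by
      intro j
      have hj := j.2
      simp at hj
      by_cases h : (j : ℕ) < l.length + 1
      · exact Or.inl ⟨⟨j, h⟩, rfl⟩
      · exact Or.inr ⟨⟨j - (l.length + 1), by omega⟩, by ext; simp; omega⟩)
    (fun i => ⟨i, by have := i.2; simp; omega⟩)
    (fun i => ⟨l.length + i, by have := i.2; simp; omega⟩)
    (fun i => ⟨i, by have := i.2; simp; omega⟩) (fun i => ⟨l.length + 1 + i, by simp; omega⟩)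
    (by intro i; rw [Fin.ext_iff, succAbove_val]; simp)
    (by intro i; rw [Fin.ext_iff, succAbove_val]; simp; omega)
    (by
      intro i; have := i.2; rw [Fin.ext_iff, succAbove_val]
      exact (if_pos (by simp only [Fin.val_zero]; omega)).symm)
    (by
      intro i; have := i.2; rw [Fin.ext_iff, succAbove_val]
      rw [if_neg (by simp only [Fin.val_zero]; omega)]; simp only [Fin.val_succ]; omega)
  refine this.trans ?_
  congr 1
  · simp only [Fin.val_zero, pow_zero, one_smul]
    exact congrArg _ (shuffleSum_congr rfl _ _ _ _ _ _ (fun _ => rfl) (fun _ => rfl) fun i => rfl)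
  · have h1 : (u :: l ++ v :: m).get ⟨l.length + 1 + ((0 : Fin (m.length + 1)) : ℕ), by simp⟩ = v := by
      simp [List.getElem_append_right]
    rw [h1]
    refine congrArg₂ _ (by simp) (congrArg _ ?_)
    refine shuffleSum_congr hlen _ _ _ _ _ _ (fun _ => rfl) (fun _ => rfl) fun i => ?_
    simp only [Function.comp, List.get_eq_getElem, succAbove_val, Fin.val_cast, Fin.val_zero]
    have := i.2
    split_ifs with h
    · rw [List.getElem_append_left (by simpa using h), List.getElem_append_left (by simpa using h)]
    · rw [List.getElem_append_right (by simp; omega), List.getElem_append_right (by simp; omega)]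
      have h2 : (i : ℕ) + 1 - (u :: l).length = (i : ℕ) - (u :: l).length + 1 := by
        simp only [List.length_cons]; omega
      simp only [h2, List.getElem_cons_succ]

lemma perm_eq_one {n : ℕ} {σ : Equiv.Perm (Fin n)} (h : StrictMono σ) : σ = 1 :=
  Equiv.ext fun i => congrFun ((StrictMono.range_inj (g := id) h strictMono_id).1
    (by simp [σ.surjective.range_eq])) i

lemma shuffleSum_nil_left {p n : ℕ} (a : Fin p → Fin n) (b : Fin n → Fin n) (w : Fin n → U) (hp : p = 0)
    (hb : b = id) : shuffleSum (A := A) n a b w = Chains.of A U n (PiTensorProduct.tprod A w) := by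
  subst hp hb
  rw [shuffleSum, Finset.sum_eq_single 1]
  · rw [if_pos]
    · simp
      rfl
    · exact ⟨fun i => i.elim0, strictMono_id⟩
  · intro σ _ hσ
    exact if_neg fun h => hσ (perm_eq_one h.2)
  · simp

lemma shuffleSum_nil_right {p m n : ℕ} (a : Fin m → Fin n) (b : Fin p → Fin n) (w : Fin n → U)
    (hp : p = 0) (hmn : m = n) (ha : ∀ i, (a i : ℕ) = i) :
    shuffleSum (A := A) n a b w = Chains.of A U n (PiTensorProduct.tprod A w) := by
  subst hp hmn
  obtain rfl : a = id := funext fun i => Fin.ext (ha i)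
  rw [shuffleSum, Finset.sum_eq_single 1]
  · rw [if_pos]
    · simp
      rfl
    · exact ⟨strictMono_id, fun i => i.elim0⟩
  · intro σ _ hσ
    exact if_neg fun h => hσ (perm_eq_one h.1)
  · simp

@[simp] lemma shuffle_nil_left (y : Chains A U) : shuffle A U (word A []) y = y := by
  suffices h : shuffle A U (word A []) = LinearMap.id from LinearMap.congr_fun h y
  refine hom_ext fun l => ?_
  rw [shuffle_word, wordShuffle, LinearMap.id_apply]
  exact shuffleSum_nil_left _ _ _ rfl (by funext i; ext; simp)

@[simp] lemma shuffle_nil_right (x : Chains A U) : shuffle A U x (word A []) = x := by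
  suffices h : (shuffle A U).flip (word A []) = LinearMap.id from LinearMap.congr_fun h x
  refine hom_ext fun l => ?_
  rw [LinearMap.flip_apply, shuffle_word, wordShuffle, LinearMap.id_apply]
  refine (shuffleSum_nil_right (A := A) (p := 0) (m := l.length) (n := (l ++ ([] : List U)).length)
    _ _ _ rfl (by simp) fun _ => rfl).trans ?_
  change word A (l ++ []) = word A l
  rw [List.append_nil]

instance : One (Chains A U) := ⟨Chains.of A U 0 (PiTensorProduct.tprod A Fin.elim0)⟩

instance : Mul (Chains A U) := ⟨fun x y => shuffle A U x y⟩

lemma word_nil : word A ([] : List U) = 1 :=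
  congrArg (Chains.of A U 0) (congrArg (PiTensorProduct.tprod A)
    (Subsingleton.elim (α := Fin 0 → U) _ _))

lemma mul_def (x y : Chains A U) : x * y = shuffle A U x y := rfl

instance : NonAssocRing (Chains A U) where
  left_distrib x y z := map_add _ _ _
  right_distrib x y z := by simp only [mul_def, map_add, LinearMap.add_apply]
  zero_mul x := by simp only [mul_def, map_zero, LinearMap.zero_apply]
  mul_zero x := map_zero _
  one_mul x := by rw [mul_def, ← word_nil, shuffle_nil_left]
  mul_one x := by rw [mul_def, ← word_nil, shuffle_nil_right]

instance : IsScalarTower A (Chains A U) (Chains A U) where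
  smul_assoc a x y := by simp only [smul_eq_mul, mul_def, map_smul, LinearMap.smul_apply]

instance : SMulCommClass A (Chains A U) (Chains A U) where
  smul_comm a x y := by simp only [smul_eq_mul, mul_def, map_smul]

lemma prepend_mul_prepend (u v : U) (x y : Chains A U) : prepend u x * prepend v y =
    prepend u (x * prepend v y) - prepend v (prepend u (signMap x) * y) := by
  induction x using chains_induction with
  | h0 => simp
  | hadd x x' hx hx' => simp only [map_add, add_mul, hx, hx']; abel
  | hs a x hx => simp only [map_smul, smul_mul_assoc, hx, smul_sub]
  | hw l =>
  induction y using chains_induction with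
  | h0 => simp
  | hadd x x' hx hx' => simp only [map_add, mul_add, hx, hx']; abel
  | hs a x hx => simp only [map_smul, mul_smul_comm, hx, smul_sub]
  | hw m =>
  simp only [signMap_word, map_smul, smul_mul_assoc, ← word_cons]
  simp only [mul_def, shuffle_word]
  rw [wordShuffle_cons, pow_succ]
  simp [sub_eq_add_neg]

@[simp] lemma signMap_one : signMap (1 : Chains A U) = 1 := by rw [← word_nil, signMap_nil]

lemma signMap_mul (x y : Chains A U) : signMap (x * y) = signMap x * signMap y := by
  suffices h : (shuffle A U).compr₂ signMap = (shuffle A U).compl₁₂ signMap signMap from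
    LinearMap.congr_fun₂ h x y
  refine hom_ext fun l => hom_ext fun m => ?_
  simp only [LinearMap.compr₂_apply, LinearMap.compl₁₂_apply]
  simp only [signMap_word, map_smul, LinearMap.smul_apply, smul_smul, ← pow_add]
  simp [word, shuffle_of, signMap, add_comm]

lemma word_cases {P : Chains A U → Prop} (h0 : P 0) (hadd : ∀ x y, P x → P y → P (x + y))
    (hs : ∀ (a : A) x, P x → P (a • x)) (h1 : P 1) (hprepend : ∀ u x, P (prepend u x)) (x) : P x := by
  refine chains_induction h0 hadd hs (fun l => ?_) x
  cases l with
  | nil => rw [word_nil]; exact h1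
  | cons u l => rw [word_cons]; exact hprepend _ _

lemma chains_mul_assoc (x y z : Chains A U) : x * y * z = x * (y * z) := by
  suffices h : ∀ l m n : List U, word A l * word A m * word A n = word A l * (word A m * word A n) by
    induction x using chains_induction with
    | h0 => simp
    | hadd x x' hx hx' => simp only [add_mul, hx, hx']
    | hs a x hx => simp only [smul_mul_assoc, hx]
    | hw l =>
    induction y using chains_induction with
    | h0 => simp
    | hadd x x' hx hx' => simp only [add_mul, mul_add, hx, hx']
    | hs a x hx => simp only [smul_mul_assoc, mul_smul_comm, hx]
    | hw m =>
    induction z using chains_induction with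
    | h0 => simp
    | hadd x x' hx hx' => simp only [mul_add, hx, hx']
    | hs a x hx => simp only [mul_smul_comm, hx]
    | hw n => exact h l m n
  intro l
  induction l with
  | nil => intro m n; simp [word_nil]
  | cons u l ihl =>
    intro m
    induction m with
    | nil => intro n; simp [word_nil]
    | cons v m ihm =>
      intro n
      induction n with
      | nil => simp [word_nil]
      | cons w n ihn =>
        have e1 := ihl (v :: m) (w :: n)
        have e2 : prepend u (signMap (word A l)) * word A m * word A (w :: n) =
            prepend u (signMap (word A l)) * (word A m * word A (w :: n)) := by
          simp only [signMap_word, map_smul, ← word_cons, smul_mul_assoc, ihm (w :: n)]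
        have e3 : prepend u (signMap (word A l)) * prepend v (signMap (word A m)) * word A n =
            prepend u (signMap (word A l)) * (prepend v (signMap (word A m)) * word A n) := by
          simp only [signMap_word, map_smul, ← word_cons, smul_mul_assoc, mul_smul_comm, ihn]
        simp only [word_cons] at e1 e2 ⊢
        generalize word A l = x at *
        generalize word A m = y at *
        generalize word A n = z at *
        rw [prepend_mul_prepend u v (signMap x) (signMap y), sub_mul, signMap_signMap] at e3
        rw [prepend_mul_prepend u v x y, sub_mul, prepend_mul_prepend u w, prepend_mul_prepend v w, e1, e2, prepend_mul_prepend v w y z, mul_sub (prepend u x),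
          prepend_mul_prepend u v, prepend_mul_prepend u w, ← e3, signMap_mul, signMap_mul, signMap_prepend, signMap_prepend, signMap_signMap]
        simp only [map_sub, mul_sub, mul_neg, neg_mul, map_neg]
        abel

instance : Ring (Chains A U) where
  mul_assoc := chains_mul_assoc

lemma face_tprod (n : ℕ) (i : Fin (n + 2)) (x : Fin (n + 1) → U) :
    face εr εl n i (PiTensorProduct.tprod A x) =
      if i = 0 then εr (x 0) • PiTensorProduct.tprod A (fun j : Fin n => x j.succ)
      else if i = Fin.last (n + 1) then
        εl (x (Fin.last n)) • PiTensorProduct.tprod A (fun j : Fin n => x j.castSucc)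
      else PiTensorProduct.tprod A (contract n i x) := by
  simp only [face, PiTensorProduct.lift.tprod, MultilinearMap.coe_mk]

lemma face_succ_succ (n : ℕ) (i : Fin (n + 1)) (u : U) (x : Fin (n + 1) → U) :
    face εr εl (n + 1) i.succ.succ (PiTensorProduct.tprod A (Fin.cons u x : Fin (n + 2) → U)) =
      consC n u (face 0 εl n i.succ (PiTensorProduct.tprod A x)) := by
  rw [face_tprod, face_tprod, if_neg (Fin.succ_ne_zero _), if_neg (Fin.succ_ne_zero _)]
  by_cases h : i = Fin.last n
  · subst h
    rw [if_pos (by simp), if_pos (by simp), map_smul, consC_tprod]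
    congr 2
    funext j
    cases j using Fin.cases with
    | zero => rfl
    | succ j => simp
  · rw [if_neg (by simpa [Fin.ext_iff] using h), if_neg (by simpa [Fin.ext_iff] using h),
      consC_tprod]
    congr 1
    funext j
    cases j using Fin.cases with
    | zero => simp [contract]
    | succ j => simp [contract]

lemma boundary_of (n : ℕ) (z : ⨂[A]^(n + 1) U) : boundary εr εl (Chains.of A U (n + 1) z) =
    Chains.of A U n (∑ i : Fin (n + 2), (-1 : A) ^ (i : ℕ) • face εr εl n i z) := by
  simp [boundary]

lemma boundary_one : boundary εr εl (1 : Chains A U) = 0 := by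
  show boundary εr εl (Chains.of A U 0 _) = 0
  simp [boundary]

lemma of_tprod_zero (x : Fin 0 → U) : Chains.of A U 0 (PiTensorProduct.tprod A x) = 1 :=
  congrArg (Chains.of A U 0) (congrArg (PiTensorProduct.tprod A)
    (Subsingleton.elim (α := Fin 0 → U) _ _))

lemma prepend_one (u : U) : prepend u (1 : Chains A U) =
    Chains.of A U 1 (PiTensorProduct.tprod A fun _ => u) := by
  rw [← word_nil, ← word_cons]
  refine congrArg (Chains.of A U 1) (congrArg (PiTensorProduct.tprod A) ?_)
  funext i
  have h : i = (0 : Fin 1) := Subsingleton.elim (α := Fin 1) _ _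
  rw [h]
  rfl

lemma boundary_prepend_one (u : U) :
    boundary εr εl (prepend u (1 : Chains A U)) = εr u • (1 : Chains A U) - εl u • (1 : Chains A U) := by
  rw [prepend_one, boundary_of, Fin.sum_univ_two, face_tprod, face_tprod]
  simp [of_tprod_zero, sub_eq_add_neg]

lemma boundary_word_cons (u v : U) (l : List U) :
    boundary εr εl (word A (u :: v :: l)) =
      εr u • word A (v :: l) - word A (u * v :: l) - prepend u (boundary 0 εl (word A (v :: l))) := by
  have e1 : word A (u :: v :: l) = Chains.of A U (l.length + 2)
    (PiTensorProduct.tprod A (Fin.cons u (v :: l).get : Fin (l.length + 2) → U)) := by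
    refine congrArg (Chains.of A U (l.length + 2)) (congrArg (PiTensorProduct.tprod A) ?_)
    funext i
    cases i using Fin.cases <;> rfl
  have e2 : word A (v :: l) = Chains.of A U (l.length + 1) (PiTensorProduct.tprod A (v :: l).get) := rfl
  have e3 : word A (u * v :: l) = Chains.of A U (l.length + 1)
    (PiTensorProduct.tprod A (u * v :: l).get) := rfl
  have f0 : face (0 : U →ₗ[A] A) εl l.length 0 (PiTensorProduct.tprod A (v :: l).get) = 0 := by
    rw [face_tprod, if_pos rfl]; simp
  have f1 : face εr εl (l.length + 1) 0
      (PiTensorProduct.tprod A (Fin.cons u (v :: l).get : Fin (l.length + 2) → U)) =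
      εr u • PiTensorProduct.tprod A (v :: l).get := by
    rw [face_tprod, if_pos rfl]; rfl
  have f2 : face εr εl (l.length + 1) (Fin.succ 0)
      (PiTensorProduct.tprod A (Fin.cons u (v :: l).get : Fin (l.length + 2) → U)) =
      PiTensorProduct.tprod A (u * v :: l).get := by
    rw [face_tprod, if_neg (Fin.succ_ne_zero _), if_neg (by simp [Fin.ext_iff])]
    congr 1
    funext i
    cases i using Fin.cases with
    | zero => simp [contract]
    | succ i => simp [contract]
  rw [e1, e2, e3, boundary_of, boundary_of, Fin.sum_univ_succ, Fin.sum_univ_succ, f1, f2,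
    Fin.sum_univ_succ (n := l.length + 1), f0]
  simp only [face_succ_succ, prepend, Chains.lift_of, LinearMap.comp_apply, map_sum, map_add, map_smul,
    Fin.val_succ, pow_succ, Fin.val_zero, pow_zero, smul_zero, zero_add, mul_one, one_smul,
    mul_neg, neg_smul, Finset.sum_neg_distrib, neg_neg, map_neg]
  abel

lemma boundary_prepend (u : U) (x : Chains A U) :
    boundary εr εl (prepend u x) = εr u • x + boundary 0 εl (prepend u x) := by
  suffices h : boundary εr εl ∘ₗ prepend u = εr u • LinearMap.id + boundary 0 εl ∘ₗ prepend u from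
    LinearMap.congr_fun h x
  refine hom_ext fun l => ?_
  simp only [LinearMap.comp_apply, LinearMap.add_apply, LinearMap.smul_apply, LinearMap.id_apply]
  cases l with
  | nil => rw [word_nil, boundary_prepend_one, boundary_prepend_one]; simp [sub_eq_add_neg]
  | cons v l => rw [← word_cons, boundary_word_cons, boundary_word_cons]; simp; abel

/-- contraction of `u` into first entry. -/
def mulFirst (u : U) : Chains A U →ₗ[A] Chains A U := -(boundary 0 εl ∘ₗ prepend u) - prepend u ∘ₗ boundary 0 εl

lemma boundary_prepend_zero (u : U) (x : Chains A U) :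
    boundary 0 εl (prepend u x) = - mulFirst εl u x - prepend u (boundary 0 εl x) := by
  simp [mulFirst]

@[simp] lemma mulFirst_one (u : U) : mulFirst εl u (1 : Chains A U) = εl u • 1 := by
  simp [mulFirst, boundary_one, boundary_prepend_one]

@[simp] lemma mulFirst_prepend (u v : U) (x : Chains A U) : mulFirst εl u (prepend v x) = prepend (u * v) x := by
  suffices h : mulFirst εl u ∘ₗ prepend v = prepend (A := A) (u * v) from LinearMap.congr_fun h x
  refine hom_ext fun l => ?_
  simp only [mulFirst, LinearMap.comp_apply, LinearMap.sub_apply, LinearMap.neg_apply, ← word_cons,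
    boundary_word_cons]
  simp

lemma mulFirst_mul_left (u v : U) (x y : Chains A U) : mulFirst εl u (x * prepend v y) =
    mulFirst εl u x * prepend v y - prepend v (signMap (mulFirst εl u x) * y) + prepend (u * v) (signMap x * y) := by
  induction x using word_cases with
  | h0 => simp
  | hadd x x' hx hx' => simp only [map_add, add_mul, hx, hx']; abel
  | hs a x hx => simp only [map_smul, smul_mul_assoc, hx, smul_sub, smul_add]
  | h1 => simp
  | hprepend p x => simp only [prepend_mul_prepend, map_sub, mulFirst_prepend, signMap_prepend, map_neg, neg_mul]; abel

lemma mulFirst_mul_right (u v : U) (x y : Chains A U) : mulFirst εl v (prepend u x * y) =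
    prepend (u * v) (x * y) + prepend u x * mulFirst εl v y - prepend u (x * mulFirst εl v y) := by
  induction y using word_cases with
  | h0 => simp
  | hadd x x' hx hx' => simp only [map_add, mul_add, hx, hx']; abel
  | hs a x hx => simp only [map_smul, mul_smul_comm, hx, smul_sub, smul_add]
  | h1 => simp [mul_comm]
  | hprepend q y => simp only [prepend_mul_prepend, map_sub, mulFirst_prepend, mul_comm v]; abel

lemma signMap_boundary (x : Chains A U) : signMap (boundary εr εl x) = - boundary εr εl (signMap x) := by
  suffices h : signMap ∘ₗ boundary εr εl = - (boundary εr εl ∘ₗ (signMap : Chains A U →ₗ[A] _)) from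
    LinearMap.congr_fun h x
  refine hom_ext fun l => ?_
  simp only [LinearMap.comp_apply, LinearMap.neg_apply]
  cases l with
  | nil => simp [word_nil, boundary_one]
  | cons u l =>
    simp only [word]
    change signMap (boundary εr εl (Chains.of A U (l.length + 1) _)) =
      - boundary εr εl (signMap (Chains.of A U (l.length + 1) _))
    simp [boundary_of, signMap, pow_succ, smul_smul, Finset.smul_sum, mul_comm]

lemma signMap_mulFirst (u : U) (x : Chains A U) : signMap (mulFirst εl u x) = mulFirst εl u (signMap x) := by
  simp only [mulFirst, LinearMap.sub_apply, LinearMap.neg_apply, LinearMap.comp_apply, map_sub, map_neg,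
    signMap_prepend, signMap_boundary, neg_neg]

lemma boundary_mul_zero (x y : Chains A U) : boundary 0 εl (x * y) =
    boundary 0 εl x * y + signMap x * boundary 0 εl y := by
  suffices h : ∀ l m : List U, boundary 0 εl (word A l * word A m) =
      boundary 0 εl (word A l) * word A m + signMap (word A l) * boundary 0 εl (word A m) by
    induction x using chains_induction with
    | h0 => simp
    | hadd x x' hx hx' => simp only [add_mul, map_add, hx, hx']; abel
    | hs a x hx => simp only [smul_mul_assoc, map_smul, hx, smul_add]
    | hw l =>
    induction y using chains_induction with
    | h0 => simp
    | hadd x x' hx hx' => simp only [mul_add, map_add, hx, hx']; abel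
    | hs a x hx => simp only [mul_smul_comm, map_smul, hx, smul_add]
    | hw m => exact h l m
  intro l
  induction l with
  | nil => intro m; simp [word_nil, boundary_one]
  | cons u l ihl =>
    intro m
    induction m with
    | nil => simp [word_nil, boundary_one]
    | cons v m ihm =>
      have e1 := ihl (v :: m)
      have e2 : boundary 0 εl (prepend u (signMap (word A l)) * word A m) =
          boundary 0 εl (prepend u (signMap (word A l))) * word A m + signMap (prepend u (signMap (word A l))) * boundary 0 εl (word A m) := by
        simp only [signMap_word, map_smul, ← word_cons, smul_mul_assoc, ihm, smul_add]
      simp only [word_cons] at e1 e2 ⊢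
      generalize word A l = x at *
      generalize word A m = y at *
      rw [prepend_mul_prepend, map_sub, boundary_prepend_zero, boundary_prepend_zero, e1, e2, mulFirst_mul_left, mulFirst_mul_right,
        boundary_prepend_zero εl u, boundary_prepend_zero εl v, boundary_prepend_zero εl u]
      simp only [map_add, map_sub, map_neg, signMap_prepend, signMap_signMap, sub_mul, neg_mul, mul_sub, mul_neg,
        prepend_mul_prepend, signMap_boundary, signMap_mulFirst]
      abel

lemma boundary_mul (x y : Chains A U) : boundary εr εl (x * y) =
    boundary εr εl x * y + signMap x * boundary εr εl y := by
  induction x using word_cases with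
  | h0 => simp
  | hadd x x' hx hx' => simp only [add_mul, map_add, hx, hx']; abel
  | hs a x hx => simp only [smul_mul_assoc, map_smul, hx, smul_add]
  | h1 => simp [boundary_one]
  | hprepend u x =>
  induction y using word_cases with
  | h0 => simp
  | hadd x x' hx hx' => simp only [mul_add, map_add, hx, hx']; abel
  | hs a x hx => simp only [mul_smul_comm, map_smul, hx, smul_add]
  | h1 => simp [boundary_one]
  | hprepend v y =>
    have h := boundary_mul_zero εl (prepend u x) (prepend v y)
    rw [prepend_mul_prepend, map_sub] at h ⊢
    rw [boundary_prepend εr εl u (x * _), boundary_prepend εr εl v (_ * y), boundary_prepend εr εl u x, boundary_prepend εr εl v y, add_sub_add_comm, h]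
    simp only [add_mul, mul_add, smul_mul_assoc, mul_smul_comm, signMap_prepend, neg_mul]
    module

end Generic
end BarComplex
end

noncomputable section

open TensorProduct
namespace BarComplex
section Homology
variable (k : Type w) (A : Type u) (U : Type v) [CommRing k] [CommRing A] [CommRing U]
  [Algebra k A] [Algebra A U]

instance : IsScalarTower k (Chains A U) (Chains A U) where
  smul_assoc c x y := by
    rw [← one_smul A x, ← smul_assoc c (1 : A) x, smul_assoc (c • (1 : A)) x y, smul_assoc c,
      one_smul, one_smul]

instance : SMulCommClass k (Chains A U) (Chains A U) where
  smul_comm c x y := by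
    have h : ∀ z : Chains A U, c • z = (c • (1 : A)) • z := fun z => by rw [smul_assoc, one_smul]
    rw [h, h, smul_comm (c • (1 : A)) x y]

/-- The total space of chains with the shuffle product is a `k`-algebra. -/
instance : Algebra k (Chains A U) := Algebra.ofModule (fun c x y => smul_mul_assoc c x y)
  (fun c x y => mul_smul_comm c x y)

variable {A U} (εr εl : U →ₗ[A] A)

lemma boundary_smul_base (c : k) (x : Chains A U) :
    boundary εr εl (c • x) = c • boundary εr εl x := by
  rw [← one_smul A x, ← smul_assoc c (1 : A) x, map_smul, smul_assoc, one_smul, one_smul]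

/-- The cycles of the Hochschild complex, a subalgebra for the shuffle product. -/
def cycles : Subalgebra k (Chains A U) where
  carrier := {z | boundary εr εl z = 0}
  mul_mem' {x y} hx hy := by
    simp only [Set.mem_ofPred_eq] at *
    rw [boundary_mul, hx, hy]; simp
  add_mem' {x y} hx hy := by
    simp only [Set.mem_ofPred_eq] at *
    rw [map_add, hx, hy, add_zero]
  algebraMap_mem' c := by
    simp only [Set.mem_ofPred_eq, Algebra.algebraMap_eq_smul_one, boundary_smul_base, boundary_one,
      smul_zero]

lemma mem_cycles {z : Chains A U} : z ∈ cycles k εr εl ↔ boundary εr εl z = 0 := Iff.rfl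

/-- The boundaries of the Hochschild complex, an ideal of the algebra of cycles. -/
def boundaries : Ideal (cycles k εr εl) where
  carrier := {z | ∃ w, boundary εr εl w = z}
  add_mem' := by
    rintro x y ⟨v, hv⟩ ⟨w, hw⟩
    exact ⟨v + w, by rw [map_add, hv, hw]; rfl⟩
  zero_mem' := ⟨0, map_zero _⟩
  smul_mem' := by
    rintro ⟨z, hz⟩ x ⟨w, hw⟩
    rw [mem_cycles] at hz
    refine ⟨signMap z * w, ?_⟩
    rw [boundary_mul, ← neg_eq_iff_eq_neg.2 (signMap_boundary εr εl z), hz, hw]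
    simp

instance : (boundaries k εr εl).IsTwoSided where
  mul_mem_of_left := by
    rintro x ⟨z, hz⟩ ⟨w, hw⟩
    rw [mem_cycles] at hz
    exact ⟨w * z, by rw [boundary_mul, hz, hw]; simp⟩

/-- The Hochschild homology algebra: the homology of the total complex with the product
induced by the shuffle product. -/
def Homology : Type (max u v) := cycles k εr εl ⧸ boundaries k εr εl

instance : Ring (Homology k εr εl) :=
  inferInstanceAs (Ring (cycles k εr εl ⧸ boundaries k εr εl))

instance : Algebra k (Homology k εr εl) :=
  inferInstanceAs (Algebra k (cycles k εr εl ⧸ boundaries k εr εl))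

/-- The homology class of a cycle. -/
def Homology.mk : cycles k εr εl →ₐ[k] Homology k εr εl :=
  Ideal.Quotient.mkₐ k (boundaries k εr εl)

end Homology
end BarComplex
end

noncomputable section

open TensorProduct
namespace MeasuringCoalgebra

open Coalgebra LinearMap

section Retract
variable {k C E : Type*} [CommRing k] [AddCommGroup C] [Module k C] [Coalgebra k C]
  [AddCommGroup E] [Module k E]

/-- The coalgebra structure on a retract of the underlying module that is stable under the
comultiplication. -/
abbrev ofRetract (i : E →ₗ[k] C) (p : C →ₗ[k] E) (hpi : p ∘ₗ i = LinearMap.id)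
    (h : TensorProduct.map (i ∘ₗ p) (i ∘ₗ p) ∘ₗ comul ∘ₗ i = comul ∘ₗ i) : Coalgebra k E :=
  have e : TensorProduct.map i i ∘ₗ (TensorProduct.map p p ∘ₗ comul ∘ₗ i) = comul ∘ₗ i := by
    rw [← LinearMap.comp_assoc, ← TensorProduct.map_comp, h]
  { comul := TensorProduct.map p p ∘ₗ comul ∘ₗ i
    counit := counit ∘ₗ i
    coassoc := by
      have hinj : ∀ f g : E →ₗ[k] E ⊗[k] (E ⊗[k] E),
          TensorProduct.map i (TensorProduct.map i i) ∘ₗ f =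
          TensorProduct.map i (TensorProduct.map i i) ∘ₗ g → f = g := by
        intro f g hfg
        have := congrArg (fun z => TensorProduct.map p (TensorProduct.map p p) ∘ₗ z) hfg
        simpa only [← LinearMap.comp_assoc, ← TensorProduct.map_comp, hpi, TensorProduct.map_id,
          LinearMap.id_comp] using this
      apply hinj
      generalize TensorProduct.map p p ∘ₗ comul ∘ₗ i = d at e
      have e1 : TensorProduct.map i (TensorProduct.map i i) ∘ₗ
          (TensorProduct.assoc k E E E).toLinearMap =
          (TensorProduct.assoc k C C C).toLinearMap ∘ₗ TensorProduct.map (TensorProduct.map i i) i := by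
        ext; rfl
      have e2 : TensorProduct.map (TensorProduct.map i i) i ∘ₗ d.rTensor E =
          (comul (R := k) (A := C)).rTensor C ∘ₗ TensorProduct.map i i := by
        rw [LinearMap.rTensor, LinearMap.rTensor, ← TensorProduct.map_comp, ← TensorProduct.map_comp,
          e, LinearMap.comp_id, LinearMap.id_comp]
      have e3 : TensorProduct.map i (TensorProduct.map i i) ∘ₗ d.lTensor E =
          (comul (R := k) (A := C)).lTensor C ∘ₗ TensorProduct.map i i := by
        rw [LinearMap.lTensor, LinearMap.lTensor, ← TensorProduct.map_comp, ← TensorProduct.map_comp,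
          e, LinearMap.comp_id, LinearMap.id_comp]
      rw [← LinearMap.comp_assoc d (d.lTensor E), e3, LinearMap.comp_assoc, e,
        ← LinearMap.comp_assoc, e1, LinearMap.comp_assoc, ← LinearMap.comp_assoc d, e2,
        LinearMap.comp_assoc, e]
      exact congrArg (· ∘ₗ i) Coalgebra.coassoc
    rTensor_counit_comp_comul := by
      generalize TensorProduct.map p p ∘ₗ comul ∘ₗ i = d at e
      have hinj : ∀ f g : E →ₗ[k] k ⊗[k] E, i.lTensor k ∘ₗ f = i.lTensor k ∘ₗ g → f = g := by
        intro f g hfg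
        have := congrArg (fun z => p.lTensor k ∘ₗ z) hfg
        simpa only [← LinearMap.comp_assoc, ← LinearMap.lTensor_comp, hpi, LinearMap.lTensor_id,
          LinearMap.id_comp] using this
      apply hinj
      rw [← LinearMap.comp_assoc, LinearMap.lTensor_comp_rTensor]
      have e1 : TensorProduct.map (counit (R := k) (A := C) ∘ₗ i) i =
          (counit (R := k) (A := C)).rTensor C ∘ₗ TensorProduct.map i i := by
        rw [LinearMap.rTensor, ← TensorProduct.map_comp, LinearMap.id_comp]
      rw [e1, LinearMap.comp_assoc, e, ← LinearMap.comp_assoc, Coalgebra.rTensor_counit_comp_comul]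
      rfl
    lTensor_counit_comp_comul := by
      generalize TensorProduct.map p p ∘ₗ comul ∘ₗ i = d at e
      have hinj : ∀ f g : E →ₗ[k] E ⊗[k] k, i.rTensor k ∘ₗ f = i.rTensor k ∘ₗ g → f = g := by
        intro f g hfg
        have := congrArg (fun z => p.rTensor k ∘ₗ z) hfg
        simpa only [← LinearMap.comp_assoc, ← LinearMap.rTensor_comp, hpi, LinearMap.rTensor_id,
          LinearMap.id_comp] using this
      apply hinj
      rw [← LinearMap.comp_assoc, LinearMap.rTensor_comp_lTensor]
      have e1 : TensorProduct.map i (counit (R := k) (A := C) ∘ₗ i) =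
          (counit (R := k) (A := C)).lTensor C ∘ₗ TensorProduct.map i i := by
        rw [LinearMap.lTensor, ← TensorProduct.map_comp, LinearMap.id_comp]
      rw [e1, LinearMap.comp_assoc, e, ← LinearMap.comp_assoc, Coalgebra.lTensor_counit_comp_comul]
      rfl }

lemma ofRetract_isCocomm (i : E →ₗ[k] C) (p : C →ₗ[k] E) (hpi : p ∘ₗ i = LinearMap.id)
    (h : TensorProduct.map (i ∘ₗ p) (i ∘ₗ p) ∘ₗ comul ∘ₗ i = comul ∘ₗ i) [IsCocomm k C] :
    @IsCocomm k E _ _ _ (ofRetract i p hpi h) := by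
  let _ := ofRetract i p hpi h
  refine ⟨?_⟩
  change (TensorProduct.comm k E E).toLinearMap ∘ₗ (TensorProduct.map p p ∘ₗ comul ∘ₗ i) =
    TensorProduct.map p p ∘ₗ comul ∘ₗ i
  have e1 : (TensorProduct.comm k E E).toLinearMap ∘ₗ TensorProduct.map p p =
      TensorProduct.map p p ∘ₗ (TensorProduct.comm k C C).toLinearMap := by ext; rfl
  have e2 : (TensorProduct.comm k C C).toLinearMap ∘ₗ comul (R := k) (A := C) = comul :=
    comm_comp_comul k C
  rw [← LinearMap.comp_assoc, e1, LinearMap.comp_assoc, ← LinearMap.comp_assoc i, e2]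

end Retract

variable (k : Type u) [Field k]

/-- A finite-dimensional cocommutative coalgebra with a chosen basis. -/
structure FinCoalg where
  dim : ℕ
  coalg : Coalgebra k (Fin dim → k)
  cocomm : @IsCocomm k (Fin dim → k) _ _ _ coalg

variable {k}

/-- The underlying space of a finite-dimensional coalgebra with basis. -/
def FinCoalg.Carrier (D : FinCoalg k) : Type u := Fin D.dim → k

instance (D : FinCoalg k) : AddCommGroup D.Carrier := inferInstanceAs (AddCommGroup (Fin D.dim → k))
instance (D : FinCoalg k) : Module k D.Carrier := inferInstanceAs (Module k (Fin D.dim → k))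
instance (D : FinCoalg k) : Coalgebra k D.Carrier := D.coalg
instance (D : FinCoalg k) : IsCocomm k D.Carrier := D.cocomm

section Fundamental
variable {C : Type*} [AddCommGroup C] [Module k C]

lemma eq_zero_of_dual (z : C ⊗[k] C)
    (h : ∀ g : C →ₗ[k] k, TensorProduct.rid k C (g.lTensor C z) = 0) : z = 0 := by
  classical
  let b := Module.Basis.ofVectorSpace k C
  apply (TensorProduct.equivFinsuppOfBasisRight (M := C) b).injective
  rw [map_zero]
  ext j
  rw [Finsupp.zero_apply, ← h (b.coord j)]
  clear h
  induction z using TensorProduct.induction_on with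
  | zero => simp
  | tmul x y => simp [TensorProduct.equivFinsuppOfBasisRight_apply_tmul]
  | add x y hx hy => simp only [map_add, Finsupp.add_apply, hx, hy]

lemma exists_finite_of_tensor (t : C ⊗[k] C) : ∃ V : Submodule k C, Module.Finite k V ∧
    ∀ f : C →ₗ[k] k, TensorProduct.lid k C (f.rTensor C t) ∈ V := by
  induction t using TensorProduct.induction_on with
  | zero => exact ⟨⊥, inferInstance, fun f => by simp⟩
  | tmul x y =>
    refine ⟨k ∙ y, inferInstance, fun f => ?_⟩
    simp only [LinearMap.rTensor_tmul, TensorProduct.lid_tmul]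
    exact Submodule.smul_mem _ _ (Submodule.mem_span_singleton_self y)
  | add x y hx hy =>
    obtain ⟨V, hV, h⟩ := hx
    obtain ⟨V', hV', h'⟩ := hy
    refine ⟨V ⊔ V', inferInstance, fun f => ?_⟩
    rw [map_add, map_add]
    exact Submodule.add_mem_sup (h f) (h' f)

variable [Coalgebra k C]

/-- The action of a functional on a coalgebra. -/
def act (f : C →ₗ[k] k) : C →ₗ[k] C := (TensorProduct.lid k C).toLinearMap ∘ₗ f.rTensor C ∘ₗ comul

lemma act_act (f g : C →ₗ[k] k) (c : C) : act g (act f c) =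
    act (LinearMap.mul' k k ∘ₗ TensorProduct.map f g ∘ₗ comul) c := by
  let T : C ⊗[k] (C ⊗[k] C) →ₗ[k] C := (TensorProduct.lid k C).toLinearMap ∘ₗ
    TensorProduct.map f ((TensorProduct.lid k C).toLinearMap ∘ₗ g.rTensor C)
  have h1 : ∀ z : C ⊗[k] C, act g (TensorProduct.lid k C (f.rTensor C z)) =
      T (comul.lTensor C z) := by
    intro z
    induction z using TensorProduct.induction_on with
    | zero => simp
    | tmul x y => simp [T, act]
    | add x y hx hy => simp only [map_add, hx, hy]
  have h3 : ∀ (z : C ⊗[k] C) (y : C), TensorProduct.lid k C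
      (LinearMap.mul' k k (TensorProduct.map f g z) ⊗ₜ y) =
      T (TensorProduct.assoc k C C C (z ⊗ₜ y)) := by
    intro z y
    induction z using TensorProduct.induction_on with
    | zero => simp
    | tmul x x' => simp [T, mul_smul, smul_comm (f x)]
    | add x x' hx hx' =>
      simp only [map_add, TensorProduct.add_tmul] at hx hx' ⊢
      rw [hx, hx']
  have h2 : ∀ z : C ⊗[k] C, TensorProduct.lid k C
      ((LinearMap.mul' k k ∘ₗ TensorProduct.map f g ∘ₗ comul).rTensor C z) =
      T (TensorProduct.assoc k C C C (comul.rTensor C z)) := by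
    intro z
    induction z using TensorProduct.induction_on with
    | zero => simp
    | tmul x y =>
      rw [LinearMap.rTensor_tmul, LinearMap.rTensor_tmul, ← h3]; rfl
    | add x y hx hy => simp only [map_add, hx, hy]
  change act g (TensorProduct.lid k C (f.rTensor C (comul c))) = TensorProduct.lid k C
      ((LinearMap.mul' k k ∘ₗ TensorProduct.map f g ∘ₗ comul).rTensor C (comul c))
  rw [h1, h2, Coalgebra.coassoc_apply]

lemma act_eq [IsCocomm k C] (g : C →ₗ[k] k) (c : C) :
    TensorProduct.rid k C (g.lTensor C (comul c)) = act g c := by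
  have h : ∀ z : C ⊗[k] C, TensorProduct.rid k C (g.lTensor C (TensorProduct.comm k C C z)) =
      TensorProduct.lid k C (g.rTensor C z) := by
    intro z
    induction z using TensorProduct.induction_on with
    | zero => simp
    | tmul x y => simp
    | add x y hx hy => simp only [map_add, hx, hy]
  rw [← comm_comul k c, h]
  rfl

lemma act_counit (c : C) : act (counit (R := k)) c = c := by
  simp [act]

/-- Every element of a cocommutative coalgebra lies in a finite-dimensional subcoalgebra. -/
lemma exists_finCoalg [IsCocomm k C] (c : C) :
    ∃ (D : FinCoalg k) (q : D.Carrier →ₗc[k] C), c ∈ LinearMap.range q.toLinearMap := by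
  let F : (C →ₗ[k] k) →ₗ[k] C :=
    { toFun := fun f => act f c
      map_add' := fun f g => by simp [act, LinearMap.rTensor_add]
      map_smul' := fun a f => by simp [act, LinearMap.rTensor_smul] }
  let V := LinearMap.range F
  have hfin : Module.Finite k V := by
    obtain ⟨V', h, h'⟩ := exists_finite_of_tensor (comul (R := k) c)
    refine Submodule.finiteDimensional_of_le (S₂ := V') ?_
    rintro _ ⟨f, rfl⟩
    exact h' f
  obtain ⟨r, hr⟩ := LinearMap.exists_leftInverse_of_injective V.subtype
    (LinearMap.ker_eq_bot.2 V.injective_subtype)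
  let e := Module.finBasis k V
  let i : (Fin (Module.finrank k V) → k) →ₗ[k] C := V.subtype ∘ₗ e.equivFun.symm.toLinearMap
  let p : C →ₗ[k] (Fin (Module.finrank k V) → k) := e.equivFun.toLinearMap ∘ₗ r
  have hpi : p ∘ₗ i = LinearMap.id := by
    refine LinearMap.ext fun x => ?_
    have : r (V.subtype (e.equivFun.symm x)) = e.equivFun.symm x := LinearMap.congr_fun hr _
    change e.equivFun (r (V.subtype (e.equivFun.symm x))) = x
    rw [this, LinearEquiv.apply_symm_apply]
  have hV : ∀ y ∈ V, i (p y) = y := by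
    intro y hy
    have : r y = ⟨y, hy⟩ := LinearMap.congr_fun hr ⟨y, hy⟩
    change (e.equivFun.symm (e.equivFun (r y)) : C) = y
    rw [this, LinearEquiv.symm_apply_apply]
  have hact : ∀ y ∈ V, ∀ g : C →ₗ[k] k, act g y ∈ V := by
    rintro _ ⟨f, rfl⟩ g
    exact ⟨_, (act_act f g c).symm⟩
  have key : ∀ y ∈ V, (i ∘ₗ p).rTensor C (comul (R := k) y) = comul (R := k) y := by
    intro y hy
    rw [← sub_eq_zero]
    refine eq_zero_of_dual _ fun g => ?_
    have : ∀ z : C ⊗[k] C, TensorProduct.rid k C (g.lTensor C ((i ∘ₗ p).rTensor C z)) =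
        i (p (TensorProduct.rid k C (g.lTensor C z))) := by
      intro z
      induction z using TensorProduct.induction_on with
      | zero => simp
      | tmul x y => simp
      | add x y hx hy => simp only [map_add, hx, hy]
    rw [map_sub, map_sub, this, act_eq, hV _ (hact y hy g), sub_self]
  have key' : ∀ y ∈ V, (i ∘ₗ p).lTensor C (comul (R := k) y) = comul (R := k) y := by
    intro y hy
    rw [← comm_comul k y]
    conv_rhs => rw [← key y hy]
    generalize comul (R := k) y = z
    induction z using TensorProduct.induction_on with
    | zero => simp
    | tmul x y => simp
    | add x y hx hy => simp only [map_add, hx, hy]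
  have h : TensorProduct.map (i ∘ₗ p) (i ∘ₗ p) ∘ₗ comul ∘ₗ i = comul ∘ₗ i := by
    refine LinearMap.ext fun x => ?_
    have hx : i x ∈ V := (e.equivFun.symm x).2
    rw [← LinearMap.rTensor_comp_lTensor]
    simp only [LinearMap.comp_apply] at key key' ⊢
    rw [key' _ hx, key _ hx]
  let D : FinCoalg k := ⟨_, ofRetract i p hpi h, ofRetract_isCocomm i p hpi h⟩
  refine ⟨D, ⟨i, rfl, ?_⟩, ?_⟩
  · change TensorProduct.map i i ∘ₗ (TensorProduct.map p p ∘ₗ comul ∘ₗ i) = comul ∘ₗ i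
    rw [← LinearMap.comp_assoc, ← TensorProduct.map_comp, h]
  · refine ⟨p c, ?_⟩
    exact hV c ⟨counit, act_counit c⟩

end Fundamental
end MeasuringCoalgebra
end

noncomputable section

open TensorProduct
namespace MeasuringCoalgebra
open Coalgebra LinearMap

/-- A condition on linear maps `C → W` out of coalgebras that can be checked element by element and
is natural in `C`: the elements where it holds form a subspace, compatible with pulling back along
morphisms of coalgebras. -/
structure Condition (k : Type u) [Field k] (W : Type u) [AddCommGroup W] [Module k W] where
  locus : ∀ (C : Type u) [AddCommGroup C] [Module k C] [Coalgebra k C], (C →ₗ[k] W) → Submodule k C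
  locus_comp : ∀ {C D : Type u} [AddCommGroup C] [Module k C] [Coalgebra k C]
    [AddCommGroup D] [Module k D] [Coalgebra k D] (g : D →ₗc[k] C) (f : C →ₗ[k] W),
    locus D (f ∘ₗ g.toLinearMap) = (locus C f).comap g.toLinearMap

variable {k : Type u} [Field k] {W : Type u} [AddCommGroup W] [Module k W]

/-- The condition holds on the whole coalgebra. -/
def Condition.Holds (Q : Condition k W) {C : Type u} [AddCommGroup C] [Module k C] [Coalgebra k C]
    (f : C →ₗ[k] W) : Prop := Q.locus C f = ⊤

/-- A cocommutative coalgebra with a linear map to `W` that satisfies the condition and is final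
among all such. -/
structure Universal (Q : Condition k W) where
  carrier : Type u
  [addCommGroup : AddCommGroup carrier]
  [module : Module k carrier]
  [coalgebra : Coalgebra k carrier]
  [isCocomm : IsCocomm k carrier]
  map : carrier →ₗ[k] W
  holds : Q.Holds map
  existsUnique : ∀ {C : Type u} [AddCommGroup C] [Module k C] [Coalgebra k C] [IsCocomm k C]
    (f : C →ₗ[k] W), Q.Holds f → ∃! g : C →ₗc[k] carrier, map ∘ₗ g.toLinearMap = f

attribute [instance] Universal.addCommGroup Universal.module Universal.coalgebra Universal.isCocomm

section Coideals
variable {C D : Type u} [AddCommGroup C] [Module k C] [Coalgebra k C]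
  [AddCommGroup D] [Module k D] [Coalgebra k D]

lemma coalgHom_comul (g : C →ₗc[k] D) (x : C) :
    TensorProduct.map g.toLinearMap g.toLinearMap (comul x) = comul (g.toLinearMap x) :=
  LinearMap.congr_fun g.map_comp_comul x

lemma coalgHom_counit (g : C →ₗc[k] D) (x : C) :
    counit (R := k) (g.toLinearMap x) = counit (R := k) x :=
  LinearMap.congr_fun g.counit_comp x

lemma isCocomm_of_surjective (g : C →ₗc[k] D) (hg : Function.Surjective g.toLinearMap)
    [IsCocomm k C] : IsCocomm k D := by
  refine ⟨LinearMap.ext fun y => ?_⟩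
  obtain ⟨x, rfl⟩ := hg y
  change TensorProduct.comm k D D (comul _) = comul _
  rw [← coalgHom_comul, ← TensorProduct.map_comm, comm_comul]

lemma isCoideal_sSup (s : Set (Submodule k C)) (hs : ∀ I ∈ s, I.IsCoideal) :
    (sSup s).IsCoideal := by
  have h1 : sSup s ≤ LinearMap.ker (counit (R := k) (A := C)) :=
    sSup_le fun I hI x hx => (hs I hI).counit_eq_zero hx
  have h2 : sSup s ≤ LinearMap.ker (TensorProduct.map (sSup s).mkQ (sSup s).mkQ ∘ₗ comul) := by
    refine sSup_le fun I hI x hx => ?_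
    have h := (hs I hI).map_mkQ_comul_eq_zero hx
    have hle : I ≤ LinearMap.ker (sSup s).mkQ := by rw [Submodule.ker_mkQ]; exact le_sSup hI
    have e : (sSup s).mkQ = I.liftQ (sSup s).mkQ hle ∘ₗ I.mkQ := (I.liftQ_mkQ _ _).symm
    rw [LinearMap.mem_ker, e, TensorProduct.map_comp, LinearMap.comp_apply, LinearMap.comp_apply, h,
      map_zero]
  exact ⟨fun x hx => h1 hx, fun x hx => h2 hx⟩

lemma isCoideal_ker (g : C →ₗc[k] D) : (LinearMap.ker g.toLinearMap).IsCoideal := by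
  refine ⟨fun x hx => ?_, fun x hx => ?_⟩
  · rw [← coalgHom_counit g, LinearMap.mem_ker.1 hx, map_zero]
  · set K := LinearMap.ker g.toLinearMap
    let j := K.liftQ g.toLinearMap le_rfl
    have hj : LinearMap.ker j = ⊥ := Submodule.ker_liftQ_eq_bot _ _ _ le_rfl
    obtain ⟨r, hr⟩ := LinearMap.exists_leftInverse_of_injective j hj
    have e : K.mkQ = r ∘ₗ g.toLinearMap := by
      conv_rhs => rw [← K.liftQ_mkQ g.toLinearMap le_rfl]
      rw [← LinearMap.comp_assoc, hr, LinearMap.id_comp]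
    rw [e, TensorProduct.map_comp, LinearMap.comp_apply, coalgHom_comul, LinearMap.mem_ker.1 hx,
      map_zero, map_zero]

lemma isCoideal_map (g : C →ₗc[k] D) (K : Submodule k C) (hK : K.IsCoideal) :
    (K.map g.toLinearMap).IsCoideal := by
  refine ⟨?_, ?_⟩
  · rintro _ ⟨x, hx, rfl⟩
    rw [coalgHom_counit]
    exact hK.counit_eq_zero hx
  · rintro _ ⟨x, hx, rfl⟩
    rw [← coalgHom_comul, ← LinearMap.comp_apply, ← TensorProduct.map_comp]
    have hle : K ≤ LinearMap.ker ((K.map g.toLinearMap).mkQ ∘ₗ g.toLinearMap) := by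
      intro y hy
      rw [LinearMap.mem_ker, LinearMap.comp_apply, Submodule.mkQ_apply,
        Submodule.Quotient.mk_eq_zero]
      exact Submodule.mem_map_of_mem hy
    rw [← K.liftQ_mkQ _ hle, TensorProduct.map_comp, LinearMap.comp_apply,
      hK.map_mkQ_comul_eq_zero hx, map_zero]

lemma isCoideal_range_sub (f g : C →ₗc[k] D) :
    (LinearMap.range (f.toLinearMap - g.toLinearMap)).IsCoideal := by
  refine ⟨?_, ?_⟩
  · rintro _ ⟨x, rfl⟩
    rw [LinearMap.sub_apply, map_sub, coalgHom_counit, coalgHom_counit, sub_self]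
  · rintro _ ⟨x, rfl⟩
    set K := LinearMap.range (f.toLinearMap - g.toLinearMap)
    have e : K.mkQ ∘ₗ f.toLinearMap = K.mkQ ∘ₗ g.toLinearMap := by
      refine LinearMap.ext fun y => ?_
      rw [← sub_eq_zero, LinearMap.comp_apply, LinearMap.comp_apply, ← map_sub,
        Submodule.mkQ_apply, Submodule.Quotient.mk_eq_zero]
      exact ⟨y, rfl⟩
    rw [LinearMap.sub_apply, map_sub, map_sub, ← coalgHom_comul, ← coalgHom_comul,
      ← LinearMap.comp_apply, ← TensorProduct.map_comp, e, ← LinearMap.comp_apply (TensorProduct.map K.mkQ K.mkQ),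
      ← TensorProduct.map_comp, sub_self]

lemma isCoideal_comap (g : C →ₗc[k] D) (K : Submodule k D) (hK : K.IsCoideal) :
    (K.comap g.toLinearMap).IsCoideal := by
  have : K.comap g.toLinearMap = LinearMap.ker ((Coalgebra.Quotient.mkQCoalgHom K).comp g).toLinearMap := by
    ext x
    change g.toLinearMap x ∈ K ↔ K.mkQ (g.toLinearMap x) = 0
    rw [Submodule.mkQ_apply, Submodule.Quotient.mk_eq_zero]
  rw [this]
  exact isCoideal_ker _

/-- The inclusion of a summand into a direct sum of coalgebras. -/
def singleHom {ι : Type u} [DecidableEq ι] (A : ι → Type u) [∀ i, AddCommGroup (A i)]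
    [∀ i, Module k (A i)] [∀ i, Coalgebra k (A i)] (i : ι) : A i →ₗc[k] Π₀ i, A i where
  __ := DFinsupp.lsingle (R := k) (M := A) i
  counit_comp := DFinsupp.counit_comp_lsingle k ι A i
  map_comp_comul := (DFinsupp.comul_comp_lsingle k ι A i).symm

lemma singleHom_apply {ι : Type u} [DecidableEq ι] (A : ι → Type u) [∀ i, AddCommGroup (A i)]
    [∀ i, Module k (A i)] [∀ i, Coalgebra k (A i)] (i : ι) (x : A i) :
    (singleHom (k := k) A i).toLinearMap x = DFinsupp.single i x := rfl

lemma lsum_apply_single {ι : Type u} [DecidableEq ι] (A : ι → Type u) [∀ i, AddCommGroup (A i)]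
    [∀ i, Module k (A i)] {V : Type u} [AddCommGroup V] [Module k V] (f : ∀ i, A i →ₗ[k] V)
    (i : ι) (x : A i) : DFinsupp.lsum k f (DFinsupp.single i x) = f i x :=
  DFinsupp.lsum_single _ _ _ _

/-- The coalgebra map out of a direct sum of coalgebras with given components. -/
def sumHom {ι : Type u} [DecidableEq ι] (A : ι → Type u) [∀ i, AddCommGroup (A i)]
    [∀ i, Module k (A i)] [∀ i, Coalgebra k (A i)] (q : ∀ i, A i →ₗc[k] D) :
    (Π₀ i, A i) →ₗc[k] D where
  __ := DFinsupp.lsum k fun i => (q i).toLinearMap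
  counit_comp := by
    refine DFinsupp.lhom_ext' fun i => LinearMap.ext fun x => ?_
    simp only [LinearMap.comp_apply, DFinsupp.lsingle_apply]
    rw [lsum_apply_single, coalgHom_counit, DFinsupp.counit_single]
  map_comp_comul := by
    refine DFinsupp.lhom_ext' fun i => LinearMap.ext fun x => ?_
    simp only [LinearMap.comp_apply, DFinsupp.lsingle_apply]
    rw [lsum_apply_single, ← coalgHom_comul, DFinsupp.comul_single, ← LinearMap.comp_apply,
      ← TensorProduct.map_comp]
    congr 2 <;> exact LinearMap.ext fun y =>
      lsum_apply_single A (fun i => (q i).toLinearMap) i y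

lemma sumHom_single {ι : Type u} [DecidableEq ι] (A : ι → Type u) [∀ i, AddCommGroup (A i)]
    [∀ i, Module k (A i)] [∀ i, Coalgebra k (A i)] (q : ∀ i, A i →ₗc[k] D) (i : ι) (x : A i) :
    (sumHom A q).toLinearMap (DFinsupp.single i x) = (q i).toLinearMap x :=
  lsum_apply_single A _ i x

end Coideals

/-- A finite-dimensional coalgebra with a map to `W` that satisfies the condition. -/
structure FinTest (Q : Condition k W) where
  base : FinCoalg k
  map : base.Carrier →ₗ[k] W
  holds : Q.Holds map

open Classical in
theorem exists_universal (Q : Condition k W) : Nonempty (Universal Q) := by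
  let M₀ := Π₀ i : FinTest Q, i.base.Carrier
  let φ₀ : M₀ →ₗ[k] W := DFinsupp.lsum k fun i => i.map
  let inc : ∀ i : FinTest Q, i.base.Carrier →ₗc[k] M₀ := fun i =>
    singleHom (fun i : FinTest Q => i.base.Carrier) i
  have hinc : ∀ i, φ₀ ∘ₗ (inc i).toLinearMap = i.map := by
    intro i
    refine LinearMap.ext fun x => ?_
    rw [LinearMap.comp_apply, singleHom_apply]
    exact lsum_apply_single (fun i : FinTest Q => i.base.Carrier) (fun i => i.map) i x
  have hφ₀ : Q.Holds φ₀ := by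
    rw [Condition.Holds, eq_top_iff, ← DFinsupp.iSup_range_lsingle]
    refine iSup_le fun i => ?_
    rintro _ ⟨x, rfl⟩
    have := i.holds
    rw [← hinc, Condition.Holds, Q.locus_comp] at this
    have hx : x ∈ (Q.locus M₀ φ₀).comap (inc i).toLinearMap := by rw [this]; trivial
    exact hx
  let J : Submodule k M₀ := sSup {I | I.IsCoideal ∧ I ≤ LinearMap.ker φ₀}
  have hJ : J.IsCoideal := isCoideal_sSup _ fun I hI => hI.1
  have hJφ : J ≤ LinearMap.ker φ₀ := sSup_le fun I hI => hI.2
  let π : M₀ →ₗc[k] M₀ ⧸ J := Coalgebra.Quotient.mkQCoalgHom J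
  have hπ : Function.Surjective π.toLinearMap := J.mkQ_surjective
  have : IsCocomm k (M₀ ⧸ J) := isCocomm_of_surjective π hπ
  let φ : (M₀ ⧸ J) →ₗ[k] W := J.liftQ φ₀ hJφ
  have hφπ : φ ∘ₗ π.toLinearMap = φ₀ := J.liftQ_mkQ _ _
  have hφ : Q.Holds φ := by
    rw [Condition.Holds, eq_top_iff]
    intro y _
    obtain ⟨x, rfl⟩ := hπ y
    have : Q.locus _ φ₀ = ⊤ := hφ₀
    rw [← hφπ, Q.locus_comp] at this
    exact (Submodule.eq_top_iff'.1 this) x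
  have hmin : ∀ K : Submodule k (M₀ ⧸ J), K.IsCoideal → K ≤ LinearMap.ker φ → K = ⊥ := by
    intro K hK hKφ
    have h1 : K.comap π.toLinearMap ≤ J := by
      refine le_sSup ⟨isCoideal_comap π K hK, fun x hx => ?_⟩
      rw [LinearMap.mem_ker, ← hφπ]
      exact hKφ hx
    rw [eq_bot_iff]
    intro y hy
    obtain ⟨x, rfl⟩ := hπ y
    rw [Submodule.mem_bot]
    exact (Submodule.Quotient.mk_eq_zero J).2 (h1 hy)
  have huniq : ∀ {C : Type u} [AddCommGroup C] [Module k C] [Coalgebra k C] (g h : C →ₗc[k] M₀ ⧸ J),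
      φ ∘ₗ g.toLinearMap = φ ∘ₗ h.toLinearMap → g = h := by
    intro C _ _ _ g h hgh
    have := hmin _ (isCoideal_range_sub g h) (by
      rintro _ ⟨x, rfl⟩
      rw [LinearMap.mem_ker, ← LinearMap.comp_apply, LinearMap.comp_sub, hgh, sub_self,
        LinearMap.zero_apply])
    rw [LinearMap.range_eq_bot, sub_eq_zero] at this
    ext x
    exact LinearMap.congr_fun this x
  refine ⟨⟨M₀ ⧸ J, φ, hφ, fun {C} _ _ _ _ f hf => ?_⟩⟩
  refine existsUnique_of_exists_of_unique ?_ fun g h hg hh => huniq g h (hg.trans hh.symm)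
  let N := Π₀ i : (Σ D : FinCoalg k, D.Carrier →ₗc[k] C), i.1.Carrier
  have htest : ∀ i : (Σ D : FinCoalg k, D.Carrier →ₗc[k] C), Q.Holds (f ∘ₗ i.2.toLinearMap) := by
    intro i
    rw [Condition.Holds, Q.locus_comp, show Q.locus C f = ⊤ from hf, Submodule.comap_top]
  let t : (Σ D : FinCoalg k, D.Carrier →ₗc[k] C) → FinTest Q := fun i =>
    ⟨i.1, f ∘ₗ i.2.toLinearMap, htest i⟩
  let A : (Σ D : FinCoalg k, D.Carrier →ₗc[k] C) → Type u := fun i => i.1.Carrier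
  let p : N →ₗc[k] C := sumHom A fun i => i.2
  let h : N →ₗc[k] (M₀ ⧸ J) := sumHom A fun i => π.comp (inc (t i))
  have hp_surj : Function.Surjective p.toLinearMap := by
    intro c
    obtain ⟨D, q, x, hx⟩ := exists_finCoalg (k := k) c
    refine ⟨DFinsupp.single ⟨D, q⟩ x, ?_⟩
    exact (sumHom_single A (fun i => i.2) ⟨D, q⟩ x).trans hx
  have hhf : φ ∘ₗ h.toLinearMap = f ∘ₗ p.toLinearMap := by
    refine DFinsupp.lhom_ext' fun i => LinearMap.ext fun x => ?_
    simp only [LinearMap.comp_apply, DFinsupp.lsingle_apply]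
    rw [sumHom_single A _ i x, sumHom_single A _ i x]
    have h1 := LinearMap.congr_fun hφπ ((inc (t i)).toLinearMap x)
    have h2 := LinearMap.congr_fun (hinc (t i)) x
    exact h1.trans h2
  have hker : LinearMap.ker p.toLinearMap ≤ LinearMap.ker h.toLinearMap := by
    have := hmin _ (isCoideal_map h _ (isCoideal_ker p)) (by
      rintro _ ⟨x, hx, rfl⟩
      rw [LinearMap.mem_ker, ← LinearMap.comp_apply, hhf, LinearMap.comp_apply,
        LinearMap.mem_ker.1 hx, map_zero])
    intro x hx
    have hx' := Submodule.mem_map_of_mem (f := h.toLinearMap) hx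
    rw [this] at hx'
    exact hx'
  let e := p.toLinearMap.quotKerEquivOfSurjective hp_surj
  let g : C →ₗ[k] (M₀ ⧸ J) := (LinearMap.ker p.toLinearMap).liftQ h.toLinearMap hker ∘ₗ e.symm.toLinearMap
  have hg : ∀ x, g (p.toLinearMap x) = h.toLinearMap x := by
    intro x
    have : e.symm (p.toLinearMap x) = Submodule.Quotient.mk x := by
      rw [LinearEquiv.symm_apply_eq]; rfl
    change (LinearMap.ker p.toLinearMap).liftQ h.toLinearMap hker (e.symm (p.toLinearMap x)) = _
    rw [this]; rfl
  have hg' : g ∘ₗ p.toLinearMap = h.toLinearMap := LinearMap.ext hg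
  refine ⟨⟨g, ?_, ?_⟩, ?_⟩
  · refine LinearMap.ext fun c => ?_
    obtain ⟨x, rfl⟩ := hp_surj c
    rw [LinearMap.comp_apply, hg, coalgHom_counit, coalgHom_counit]
  · refine LinearMap.ext fun c => ?_
    obtain ⟨x, rfl⟩ := hp_surj c
    rw [LinearMap.comp_apply, LinearMap.comp_apply, hg, ← coalgHom_comul p, ← coalgHom_comul h,
      ← LinearMap.comp_apply, ← TensorProduct.map_comp, hg']
  · refine LinearMap.ext fun c => ?_
    obtain ⟨x, rfl⟩ := hp_surj c
    change φ (g (p.toLinearMap x)) = _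
    rw [hg]
    exact LinearMap.congr_fun hhf x

end MeasuringCoalgebra
end

noncomputable section

open TensorProduct

open CategoryTheory MonoidalCategory

/-- The property of a coalgebra of being cocommutative. -/
def isCocommCoalg (k : Type u) [Field k] : ObjectProperty (CoalgCat.{u} k) :=
  fun C => Coalgebra.IsCocomm k C

instance (k : Type u) [Field k] : (isCocommCoalg k).IsMonoidal where
  prop_unit := inferInstanceAs (Coalgebra.IsCocomm k k)
  prop_tensor X Y hX hY := by
    have : Coalgebra.IsCocomm k X := hX
    have : Coalgebra.IsCocomm k Y := hY
    exact inferInstanceAs (Coalgebra.IsCocomm k (X ⊗[k] Y))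

/-- The monoidal category of cocommutative `k`-coalgebras. -/
abbrev CoCoalg (k : Type u) [Field k] := (isCocommCoalg k).FullSubcategory

namespace MeasuringCoalgebra
open Coalgebra LinearMap

variable {k : Type u} [Field k]

namespace Universal
variable {W : Type u} [AddCommGroup W] [Module k W] {Q : Condition k W} (M : Universal Q)

/-- The final coalgebra as an object of the category of cocommutative coalgebras. -/
def toCoCoalg : CoCoalg k := ⟨CoalgCat.of k M.carrier, M.isCocomm⟩

/-- The underlying linear map of a morphism of cocommutative coalgebras. -/
def linMap {C D : CoCoalg k} (f : C ⟶ D) : C.obj →ₗ[k] D.obj := f.hom.toCoalgHom'.toLinearMap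

/-- The linear map from the final coalgebra to `W`. -/
def proj : M.toCoCoalg.obj →ₗ[k] W := M.map

/-- The morphism into the final coalgebra induced by a map satisfying the condition. -/
def desc (C : CoCoalg k) (f : C.obj →ₗ[k] W) (hf : Q.Holds f) : C ⟶ M.toCoCoalg :=
  have : IsCocomm k C.obj := C.property
  ObjectProperty.homMk ⟨(M.existsUnique f hf).choose⟩

lemma desc_proj (C : CoCoalg k) (f : C.obj →ₗ[k] W) (hf : Q.Holds f) :
    M.proj ∘ₗ linMap (M.desc C f hf) = f :=
  have : IsCocomm k C.obj := C.property
  (M.existsUnique f hf).choose_spec.1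

lemma holds_comp {C : CoCoalg k} (f : C ⟶ M.toCoCoalg) : Q.Holds (M.proj ∘ₗ linMap f) := by
  have h : Q.locus _ M.map = ⊤ := M.holds
  have h' := Q.locus_comp f.hom.toCoalgHom' M.map
  exact h'.trans ((congrArg (Submodule.comap f.hom.toCoalgHom'.toLinearMap) h).trans
    (Submodule.comap_top _))

lemma hom_ext {C : CoCoalg k} (f g : C ⟶ M.toCoCoalg)
    (h : M.proj ∘ₗ linMap f = M.proj ∘ₗ linMap g) : f = g := by
  have : IsCocomm k C.obj := C.property
  have e := (M.existsUnique _ (M.holds_comp g)).unique (y₁ := f.hom.toCoalgHom')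
    (y₂ := g.hom.toCoalgHom') h rfl
  exact ObjectProperty.hom_ext _ (CoalgCat.hom_ext _ _ e)

end Universal

open Universal

/-- A family of spaces of maps with units and an associative composition, together with a natural
condition on coalgebras of such maps that is stable under composition and holds for the units. -/
structure Enrichment (k : Type u) [Field k] (X : Type v) where
  maps : X → X → Type u
  [addCommGroup : ∀ x y, AddCommGroup (maps x y)]
  [module : ∀ x y, Module k (maps x y)]
  one : ∀ x, maps x x
  comp : ∀ x y z, maps x y →ₗ[k] maps y z →ₗ[k] maps x z
  one_comp : ∀ x y (f : maps x y), comp x x y (one x) f = f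
  comp_one : ∀ x y (f : maps x y), comp x y y f (one y) = f
  comp_assoc : ∀ w x y z (f : maps w x) (g : maps x y) (h : maps y z),
    comp w y z (comp w x y f g) h = comp w x z f (comp x y z g h)
  cond : ∀ x y, Condition k (maps x y)
  holds_one : ∀ x, (cond x x).Holds (LinearMap.toSpanSingleton k (maps x x) (one x))
  holds_comp : ∀ x y z {C D : Type u} [AddCommGroup C] [Module k C] [Coalgebra k C]
    [AddCommGroup D] [Module k D] [Coalgebra k D] (f : C →ₗ[k] maps x y) (g : D →ₗ[k] maps y z),
    (cond x y).Holds f → (cond y z).Holds g →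
      (cond x z).Holds (TensorProduct.lift ((comp x y z).compl₁₂ f g))

namespace Enrichment
variable {X : Type v} (E : Enrichment k X)

attribute [instance] Enrichment.addCommGroup Enrichment.module

/-- The universal cocommutative measuring coalgebra between two objects. -/
def universal (x y : X) : Universal (E.cond x y) := Classical.choice (exists_universal _)

/-- The hom-object: the universal cocommutative measuring coalgebra. -/
def hom (x y : X) : CoCoalg k := (E.universal x y).toCoCoalg

/-- The action of the universal measuring coalgebra. -/
def eval (x y : X) : (E.hom x y).obj →ₗ[k] E.maps x y := (E.universal x y).proj

/-- The unit of the enrichment, induced by `t ↦ t • id`. -/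
def unit (x : X) : 𝟙_ (CoCoalg k) ⟶ E.hom x x :=
  (E.universal x x).desc (𝟙_ (CoCoalg k)) (LinearMap.toSpanSingleton k (E.maps x x) (E.one x))
    (E.holds_one x)

/-- The map `C ⊗ D → maps`, `a ⊗ b ↦ b ∘ a`. -/
def compMaps (x y z : X) {C D : CoCoalg k} (f : C.obj →ₗ[k] E.maps x y) (g : D.obj →ₗ[k] E.maps y z) :
    (C ⊗ D).obj →ₗ[k] E.maps x z := TensorProduct.lift ((E.comp x y z).compl₁₂ f g)

lemma holds_eval (x y : X) : (E.cond x y).Holds (E.eval x y) := (E.universal x y).holds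

/-- The composition of the enrichment, induced by `a ⊗ b ↦ b ∘ a`. -/
def comp' (x y z : X) : E.hom x y ⊗ E.hom y z ⟶ E.hom x z :=
  (E.universal x z).desc (E.hom x y ⊗ E.hom y z) (E.compMaps x y z (E.eval x y) (E.eval y z))
    (E.holds_comp x y z _ _ (E.holds_eval x y) (E.holds_eval y z))

lemma eval_unit (x : X) (t : k) : E.eval x x (linMap (E.unit x) t) = t • E.one x :=
  LinearMap.congr_fun ((E.universal x x).desc_proj (𝟙_ (CoCoalg k)) _ (E.holds_one x)) t

lemma eval_comp (x y z : X) (a : (E.hom x y).obj) (b : (E.hom y z).obj) :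
    E.eval x z (linMap (E.comp' x y z) (a ⊗ₜ[k] b)) = E.comp x y z (E.eval x y a) (E.eval y z b) :=
  LinearMap.congr_fun ((E.universal x z).desc_proj (E.hom x y ⊗ E.hom y z) _
    (E.holds_comp x y z _ _ (E.holds_eval x y) (E.holds_eval y z))) (a ⊗ₜ[k] b)

lemma hom_ext {x y : X} {C : CoCoalg k} (f g : C ⟶ E.hom x y)
    (h : ∀ c, E.eval x y (linMap f c) = E.eval x y (linMap g c)) : f = g :=
  (E.universal x y).hom_ext f g (LinearMap.ext h)

/-- The category enriched in cocommutative coalgebras whose hom-objects are the universal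
cocommutative measuring coalgebras. -/
abbrev enrichedCategory : EnrichedCategory (CoCoalg k) X where
  Hom := E.hom
  id := E.unit
  comp := E.comp'
  id_comp x y := by
    refine E.hom_ext _ _ fun a => ?_
    change E.eval x y (linMap (E.comp' x x y) (linMap (E.unit x) 1 ⊗ₜ[k] a)) = E.eval x y a
    rw [eval_comp, eval_unit, one_smul, E.one_comp]
  comp_id x y := by
    refine E.hom_ext _ _ fun a => ?_
    change E.eval x y (linMap (E.comp' x y y) (a ⊗ₜ[k] linMap (E.unit y) 1)) = E.eval x y a
    rw [eval_comp, eval_unit, one_smul, E.comp_one]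
  assoc w x y z := by
    refine (E.universal w z).hom_ext _ _ ?_
    refine TensorProduct.ext (LinearMap.ext fun a => TensorProduct.ext (LinearMap.ext fun b =>
      LinearMap.ext fun c => ?_))
    change E.eval w z (linMap (E.comp' w y z) (linMap (E.comp' w x y) (a ⊗ₜ[k] b) ⊗ₜ[k] c)) =
      E.eval w z (linMap (E.comp' w x z) (a ⊗ₜ[k] linMap (E.comp' x y z) (b ⊗ₜ[k] c)))
    rw [eval_comp, eval_comp, eval_comp, eval_comp, E.comp_assoc]

end Enrichment
end MeasuringCoalgebra
end

noncomputable section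

open TensorProduct

section TensorOver
variable {k A U : Type u} [Field k] [CommRing A] [CommRing U] [Algebra k A] [Algebra k U]

/-- The ideal of `U ⊗ U` generated by the elements `t(a) ⊗ 1 - 1 ⊗ s(a)`. -/
def balance₂ (s t : A →ₐ[k] U) : Ideal (U ⊗[k] U) :=
  Ideal.span (Set.range fun a => t a ⊗ₜ[k] (1 : U) - (1 : U) ⊗ₜ[k] s a)

/-- `U ⊗_A U` for the bimodule structure `a · u · b = s(a) t(b) u`: the quotient of `U ⊗ U` by
the relations `t(a) u ⊗ v = u ⊗ s(a) v`. -/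
def TensorTwo (s t : A →ₐ[k] U) : Type u := (U ⊗[k] U) ⧸ balance₂ s t

instance (s t : A →ₐ[k] U) : CommRing (TensorTwo s t) :=
  inferInstanceAs (CommRing ((U ⊗[k] U) ⧸ balance₂ s t))
instance (s t : A →ₐ[k] U) : Algebra k (TensorTwo s t) :=
  inferInstanceAs (Algebra k ((U ⊗[k] U) ⧸ balance₂ s t))

/-- The projection `U ⊗ U → U ⊗_A U`. -/
def proj₂ (s t : A →ₐ[k] U) : U ⊗[k] U →ₐ[k] TensorTwo s t :=
  Ideal.Quotient.mkₐ k (balance₂ s t)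

/-- The ideal of `U ⊗ U ⊗ U` generated by the elements `t(a) ⊗ 1 ⊗ 1 - 1 ⊗ s(a) ⊗ 1` and
`1 ⊗ t(a) ⊗ 1 - 1 ⊗ 1 ⊗ s(a)`. -/
def balance₃ (s t : A →ₐ[k] U) : Ideal (U ⊗[k] (U ⊗[k] U)) :=
  Ideal.span
    ((Set.range fun a => t a ⊗ₜ[k] ((1 : U) ⊗ₜ[k] (1 : U)) - (1 : U) ⊗ₜ[k] (s a ⊗ₜ[k] (1 : U))) ∪
      Set.range fun a => (1 : U) ⊗ₜ[k] (t a ⊗ₜ[k] (1 : U)) - (1 : U) ⊗ₜ[k] ((1 : U) ⊗ₜ[k] s a))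

/-- `U ⊗_A U ⊗_A U`, a quotient of `U ⊗ U ⊗ U`. -/
def TensorThree (s t : A →ₐ[k] U) : Type u := (U ⊗[k] (U ⊗[k] U)) ⧸ balance₃ s t

instance (s t : A →ₐ[k] U) : CommRing (TensorThree s t) :=
  inferInstanceAs (CommRing ((U ⊗[k] (U ⊗[k] U)) ⧸ balance₃ s t))
instance (s t : A →ₐ[k] U) : Algebra k (TensorThree s t) :=
  inferInstanceAs (Algebra k ((U ⊗[k] (U ⊗[k] U)) ⧸ balance₃ s t))

/-- The projection `U ⊗ U ⊗ U → U ⊗_A U ⊗_A U`. -/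
def proj₃ (s t : A →ₐ[k] U) : U ⊗[k] (U ⊗[k] U) →ₐ[k] TensorThree s t :=
  Ideal.Quotient.mkₐ k (balance₃ s t)

/-- An algebra map out of `U ⊗ U` that is balanced over `A` factors through `U ⊗_A U`. -/
def liftTwo (s t : A →ₐ[k] U) {R : Type u} [CommRing R] [Algebra k R] (f : U ⊗[k] U →ₐ[k] R)
    (hf : ∀ a, f (t a ⊗ₜ[k] 1) = f (1 ⊗ₜ[k] s a)) : TensorTwo s t →ₐ[k] R :=
  Ideal.Quotient.liftₐ (balance₂ s t) f (by
    suffices h : balance₂ s t ≤ RingHom.ker f from fun x hx => h hx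
    refine Ideal.span_le.2 ?_
    rintro _ ⟨a, rfl⟩
    refine RingHom.mem_ker.2 ?_
    rw [map_sub, hf, sub_self])

lemma liftTwo_proj₂ (s t : A →ₐ[k] U) {R : Type u} [CommRing R] [Algebra k R]
    (f : U ⊗[k] U →ₐ[k] R) (hf : ∀ a, f (t a ⊗ₜ[k] 1) = f (1 ⊗ₜ[k] s a)) (z : U ⊗[k] U) :
    liftTwo s t f hf (proj₂ s t z) = f z := rfl

/-- The map `U ⊗_A U → U ⊗_A U ⊗_A U`, `u ⊗ v ↦ u ⊗ v ⊗ 1`. -/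
def incl₁₂ (s t : A →ₐ[k] U) : TensorTwo s t →ₐ[k] TensorThree s t :=
  liftTwo s t ((proj₃ s t).comp (Algebra.TensorProduct.map (AlgHom.id k U)
    (Algebra.TensorProduct.includeLeft : U →ₐ[k] U ⊗[k] U)))
    fun a => (Ideal.Quotient.eq (I := balance₃ s t)).2
      (Ideal.subset_span (Or.inl ⟨a, rfl⟩))

/-- The map `U ⊗_A U → U ⊗_A U ⊗_A U`, `u ⊗ v ↦ 1 ⊗ u ⊗ v`. -/
def incl₂₃ (s t : A →ₐ[k] U) : TensorTwo s t →ₐ[k] TensorThree s t :=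
  liftTwo s t ((proj₃ s t).comp
    (Algebra.TensorProduct.includeRight : U ⊗[k] U →ₐ[k] U ⊗[k] (U ⊗[k] U)))
    fun a => (Ideal.Quotient.eq (I := balance₃ s t)).2
      (Ideal.subset_span (Or.inr ⟨a, rfl⟩))

/-- The map `U → U ⊗_A U ⊗_A U`, `u ↦ u ⊗ 1 ⊗ 1`. -/
def incl₁ (s t : A →ₐ[k] U) : U →ₐ[k] TensorThree s t :=
  (proj₃ s t).comp Algebra.TensorProduct.includeLeft

/-- The map `U → U ⊗_A U ⊗_A U`, `u ↦ 1 ⊗ 1 ⊗ u`. -/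
def incl₃ (s t : A →ₐ[k] U) : U →ₐ[k] TensorThree s t :=
  (proj₃ s t).comp ((Algebra.TensorProduct.includeRight : U ⊗[k] U →ₐ[k] U ⊗[k] (U ⊗[k] U)).comp
    Algebra.TensorProduct.includeRight)

/-- The map `U → U ⊗_A U`, `u ↦ u ⊗ 1`. -/
def inclLeft (s t : A →ₐ[k] U) : U →ₐ[k] TensorTwo s t :=
  (proj₂ s t).comp Algebra.TensorProduct.includeLeft

/-- The map `U → U ⊗_A U`, `u ↦ 1 ⊗ u`. -/
def inclRight (s t : A →ₐ[k] U) : U →ₐ[k] TensorTwo s t :=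
  (proj₂ s t).comp Algebra.TensorProduct.includeRight

end TensorOver

/-- A commutative Hopf algebroid `(U, A, s, t, Δ, ε, S)` over `k` with involutive antipode. In each
axiom on the coproduct, `z = ∑ u₁ ⊗ u₂ ∈ U ⊗ U` is an arbitrary representative of
`Δ(u) ∈ U ⊗_A U`. -/
structure CommHopfAlgebroid (k : Type u) [Field k] where
  A : Type u
  U : Type u
  [commRingA : CommRing A]
  [commRingU : CommRing U]
  [algebraA : Algebra k A]
  [algebraU : Algebra k U]
  s : A →ₐ[k] U
  t : A →ₐ[k] U
  Δ : U →ₐ[k] TensorTwo s t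
  ε : U →ₗ[k] A
  S : U →ₐ[k] U
  /-- `Δ` is a map of `(A, A)`-bimodules. -/
  Δ_bimodule : ∀ a b u, Δ (s a * t b * u) = proj₂ s t (s a ⊗ₜ[k] t b) * Δ u
  /-- `ε` is a map of `(A, A)`-bimodules. -/
  ε_bimodule : ∀ a b u, ε (s a * t b * u) = a * ε u * b
  /-- Coassociativity: `Δ(u₁) ⊗ u₂ = u₁ ⊗ Δ(u₂)` in `U ⊗_A U ⊗_A U`. -/
  coassoc : ∀ u z, proj₂ s t z = Δ u →
    Algebra.TensorProduct.productMap ((incl₁₂ s t).comp Δ) (incl₃ s t) z =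
      Algebra.TensorProduct.productMap (incl₁ s t) ((incl₂₃ s t).comp Δ) z
  /-- `s(ε(u₁)) u₂ = u`. -/
  counit_left : ∀ u z, proj₂ s t z = Δ u →
    LinearMap.mul' k U (TensorProduct.map (s.toLinearMap ∘ₗ ε) LinearMap.id z) = u
  /-- `t(ε(u₂)) u₁ = u`. -/
  counit_right : ∀ u z, proj₂ s t z = Δ u →
    LinearMap.mul' k U (TensorProduct.map LinearMap.id (t.toLinearMap ∘ₗ ε) z) = u
  ε_mul_s : ∀ u v, ε (u * s (ε v)) = ε (u * v)
  ε_mul_t : ∀ u v, ε (u * t (ε v)) = ε (u * v)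
  S_S : ∀ u, S (S u) = u
  S_t : ∀ a, S (t a) = s a
  /-- `S(u₁)₁ u₂ ⊗ S(u₁)₂ = 1 ⊗ S(u)` in `U ⊗_A U`. -/
  antipode_left : ∀ u z, proj₂ s t z = Δ u →
    Algebra.TensorProduct.productMap (Δ.comp S) (inclLeft s t) z = inclRight s t (S u)
  /-- `S(u₂)₁ ⊗ S(u₂)₂ u₁ = S(u) ⊗ 1` in `U ⊗_A U`. -/
  antipode_right : ∀ u z, proj₂ s t z = Δ u →
    Algebra.TensorProduct.productMap (inclRight s t) (Δ.comp S) z = inclLeft s t (S u)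

namespace CommHopfAlgebroid

attribute [instance] commRingA commRingU algebraA algebraU

variable {k : Type u} [Field k] (H : CommHopfAlgebroid k)

/-- `U` as an `A`-algebra through `t`. -/
instance : Algebra H.A H.U := H.t.toRingHom.toAlgebra

instance : IsScalarTower k H.A H.U :=
  IsScalarTower.of_algebraMap_eq fun c => (H.t.commutes c).symm

lemma smul_def (a : H.A) (u : H.U) : a • u = H.t a * u := rfl

/-- The map `ε_L = ε`, which is `A`-linear. -/
def epsL : H.U →ₗ[H.A] H.A where
  toFun := H.ε
  map_add' := map_add _
  map_smul' a u := by
    have := H.ε_bimodule 1 a u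
    rw [map_one, one_mul, one_mul] at this
    exact this.trans (mul_comm _ _)

/-- The map `ε_R = ε ∘ S`, which is `A`-linear. -/
def epsR : H.U →ₗ[H.A] H.A where
  toFun u := H.ε (H.S u)
  map_add' u v := by rw [map_add, map_add]
  map_smul' a u := by
    have := H.ε_bimodule a 1 (H.S u)
    rw [map_one, mul_one, mul_one] at this
    rw [smul_def, map_mul, H.S_t]
    exact this

/-- The graded space `⨁ₙ C_n` of Hochschild chains. -/
abbrev Chains : Type u := BarComplex.Chains H.A H.U

/-- The subalgebra of Hochschild cycles. -/
abbrev cycles : Subalgebra k H.Chains := BarComplex.cycles k H.epsR H.epsL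

/-- The Hochschild homology algebra with the shuffle product. -/
abbrev HH : Type u := BarComplex.Homology k H.epsR H.epsL

end CommHopfAlgebroid
end

noncomputable section

open TensorProduct

namespace MeasuringCoalgebra
open Coalgebra LinearMap

section Convolution
variable {k : Type u} [Field k] {V V' V'' : Type u} [AddCommGroup V] [Module k V]
  [AddCommGroup V'] [Module k V'] [AddCommGroup V''] [Module k V'']
  {C D : Type u} [AddCommGroup C] [Module k C] [Coalgebra k C]
  [AddCommGroup D] [Module k D] [Coalgebra k D]

/-- The map `V ⊗ V → V' ⊗ V'`, `u ⊗ v ↦ x₁(u) ⊗ x₂(v)` defined by an element `x` of a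
coalgebra acting from `V` to `V'`. -/
def actTwo (Ψ : C →ₗ[k] V →ₗ[k] V') : C →ₗ[k] (V ⊗[k] V →ₗ[k] V' ⊗[k] V') :=
  TensorProduct.homTensorHomMap (RingHom.id k) V V V' V' ∘ₗ TensorProduct.map Ψ Ψ ∘ₗ comul

lemma actTwo_comp (Ψ : C →ₗ[k] V →ₗ[k] V') (g : D →ₗc[k] C) (x : D) :
    actTwo (Ψ ∘ₗ g.toLinearMap) x = actTwo Ψ (g.toLinearMap x) := by
  simp only [actTwo, LinearMap.comp_apply]
  rw [← coalgHom_comul, ← LinearMap.comp_apply (TensorProduct.map Ψ Ψ), ← TensorProduct.map_comp]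

/-- The composite action of `C ⊗ D`, `x ⊗ y ↦ y ∘ x`. -/
def actComp (Ψ : C →ₗ[k] V →ₗ[k] V') (Ψ' : D →ₗ[k] V' →ₗ[k] V'') :
    C ⊗[k] D →ₗ[k] V →ₗ[k] V'' :=
  TensorProduct.lift ((LinearMap.llcomp k V V' V'').flip.compl₁₂ Ψ Ψ')

lemma actComp_tmul (Ψ : C →ₗ[k] V →ₗ[k] V') (Ψ' : D →ₗ[k] V' →ₗ[k] V'') (x : C) (y : D) (v : V) :
    actComp Ψ Ψ' (x ⊗ₜ[k] y) v = Ψ' y (Ψ x v) := rfl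

lemma comul_tmul (x : C) (y : D) : comul (R := k) (x ⊗ₜ[k] y) =
    TensorProduct.tensorTensorTensorComm k C C D D (comul x ⊗ₜ[k] comul y) := by
  rw [TensorProduct.comul_tmul]; rfl

lemma actTwo_actComp (Ψ : C →ₗ[k] V →ₗ[k] V') (Ψ' : D →ₗ[k] V' →ₗ[k] V'') (x : C) (y : D)
    (z : V ⊗[k] V) : actTwo (actComp Ψ Ψ') (x ⊗ₜ[k] y) z = actTwo Ψ' y (actTwo Ψ x z) := by
  simp only [actTwo, LinearMap.comp_apply]
  rw [comul_tmul]
  generalize comul (R := k) x = p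
  generalize comul (R := k) y = q
  induction p using TensorProduct.induction_on with
  | zero => simp
  | add p p' hp hp' => simp only [TensorProduct.add_tmul, map_add, LinearMap.add_apply, hp, hp']
  | tmul a b =>
  induction q using TensorProduct.induction_on with
  | zero => simp
  | add p p' hp hp' => simp only [TensorProduct.tmul_add, map_add, LinearMap.add_apply, hp, hp']
  | tmul c d =>
  rw [TensorProduct.tensorTensorTensorComm_tmul]
  simp only [TensorProduct.map_tmul, TensorProduct.homTensorHomMap_apply]
  rw [← LinearMap.comp_apply, ← TensorProduct.map_comp]
  rfl

end Convolution

section Algebra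
variable {k : Type u} [Field k] {R R' R'' : Type u} [Ring R] [Algebra k R] [Ring R'] [Algebra k R']
  [Ring R''] [Algebra k R'']
  {C D : Type u} [AddCommGroup C] [Module k C] [Coalgebra k C]
  [AddCommGroup D] [Module k D] [Coalgebra k D]

/-- The conditions `x(ab) = x₁(a) x₂(b)` and `x(1) = ε(x) 1` on an element `x` of a coalgebra
acting from an algebra `R` to an algebra `R'`. -/
structure AlgMeasuringAt (Ψ : C →ₗ[k] R →ₗ[k] R') (x : C) : Prop where
  map_mul : ∀ a b, Ψ x (a * b) = LinearMap.mul' k R' (actTwo Ψ x (a ⊗ₜ[k] b))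
  map_one : Ψ x 1 = counit (R := k) x • 1

/-- A measuring of algebras. -/
def IsAlgMeasuring (Ψ : C →ₗ[k] R →ₗ[k] R') : Prop := ∀ x, AlgMeasuringAt Ψ x

lemma AlgMeasuringAt.map_mul' {Ψ : C →ₗ[k] R →ₗ[k] R'} {x : C} (h : AlgMeasuringAt Ψ x)
    (z : R ⊗[k] R) : Ψ x (LinearMap.mul' k R z) = LinearMap.mul' k R' (actTwo Ψ x z) := by
  induction z using TensorProduct.induction_on with
  | zero => simp
  | add p p' hp hp' => simp only [map_add, hp, hp']
  | tmul c d => exact h.map_mul c d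

lemma AlgMeasuringAt.comp {Ψ : C →ₗ[k] R →ₗ[k] R'} {Ψ' : D →ₗ[k] R' →ₗ[k] R''} {x : C} {y : D}
    (h : AlgMeasuringAt Ψ x) (h' : AlgMeasuringAt Ψ' y) :
    AlgMeasuringAt (actComp Ψ Ψ') (x ⊗ₜ[k] y) where
  map_mul a b := by
    rw [actTwo_actComp, actComp_tmul, h.map_mul, h'.map_mul']
  map_one := by
    rw [actComp_tmul, h.map_one, map_smul, h'.map_one, smul_smul, TensorProduct.counit_tmul, smul_eq_mul, mul_comm]

lemma algMeasuringAt_id (c : k) :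
    AlgMeasuringAt (LinearMap.toSpanSingleton k (R →ₗ[k] R) LinearMap.id) c where
  map_mul a b := by
    simp [actTwo, LinearMap.toSpanSingleton_apply]
  map_one := by simp [LinearMap.toSpanSingleton_apply]

lemma algMeasuringAt_comp_iff {Ψ : C →ₗ[k] R →ₗ[k] R'} {g : D →ₗc[k] C} {x : D} :
    AlgMeasuringAt (Ψ ∘ₗ g.toLinearMap) x ↔ AlgMeasuringAt Ψ (g.toLinearMap x) := by
  refine ⟨fun h => ⟨fun a b => ?_, ?_⟩, fun h => ⟨fun a b => ?_, ?_⟩⟩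
  · rw [← actTwo_comp]; exact h.map_mul a b
  · rw [coalgHom_counit]; exact h.map_one
  · rw [actTwo_comp]; exact h.map_mul a b
  · rw [← coalgHom_counit g]; exact h.map_one

/-- The elements at which a linear map satisfies the measuring conditions. -/
def algLocus (Ψ : C →ₗ[k] R →ₗ[k] R') : Submodule k C where
  carrier := {x | AlgMeasuringAt Ψ x}
  add_mem' {x y} hx hy := ⟨fun a b => by
    simp only [map_add, LinearMap.add_apply, hx.map_mul, hy.map_mul], by
    simp only [map_add, LinearMap.add_apply, hx.map_one, hy.map_one, add_smul]⟩
  zero_mem' := ⟨fun a b => by simp, by simp⟩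
  smul_mem' c x hx := ⟨fun a b => by
    simp only [map_smul, LinearMap.smul_apply, hx.map_mul], by
    simp only [map_smul, LinearMap.smul_apply, hx.map_one, smul_assoc]⟩

variable (k R R') in
/-- The condition of being a measuring of algebras. -/
def algCondition : Condition k (R →ₗ[k] R') where
  locus C _ _ _ Ψ := algLocus Ψ
  locus_comp g Ψ := Submodule.ext fun x => algMeasuringAt_comp_iff

lemma algCondition_holds (Ψ : C →ₗ[k] R →ₗ[k] R') :
    (algCondition k R R').Holds Ψ ↔ IsAlgMeasuring Ψ := Submodule.eq_top_iff'

end Algebra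

section Tensor
variable {k : Type u} [Field k] {C : Type u} [AddCommGroup C] [Module k C]

lemma eq_top_of_tmul {C D : Type u} [AddCommGroup C] [Module k C] [AddCommGroup D] [Module k D]
    (N : Submodule k (C ⊗[k] D)) (h : ∀ x y, x ⊗ₜ[k] y ∈ N) : N = ⊤ := by
  rw [Submodule.eq_top_iff']
  intro z
  induction z using TensorProduct.induction_on with
  | zero => exact N.zero_mem
  | add p p' hp hp' => exact N.add_mem hp hp'
  | tmul c d => exact h c d

end Tensor

/-- The enrichment of a family of algebras in cocommutative coalgebras, by universal
cocommutative measuring coalgebras. -/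
def algEnrichment (k : Type u) [Field k] {X : Type v} (R : X → Type u) [∀ x, Ring (R x)]
    [∀ x, Algebra k (R x)] : Enrichment k X where
  maps x y := R x →ₗ[k] R y
  one x := LinearMap.id
  comp x y z := (LinearMap.llcomp k (R x) (R y) (R z)).flip
  one_comp x y f := rfl
  comp_one x y f := rfl
  comp_assoc w x y z f g h := rfl
  cond x y := algCondition k (R x) (R y)
  holds_one x := (algCondition_holds _).2 algMeasuringAt_id
  holds_comp x y z C D _ _ _ _ _ _ f g hf hg :=
    eq_top_of_tmul _ fun a b =>
      ((algCondition_holds f).1 hf a).comp ((algCondition_holds g).1 hg b)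

section Hopf
variable {k : Type u} [Field k] {H H' H'' : CommHopfAlgebroid k}
  {C D : Type u} [AddCommGroup C] [Module k C] [Coalgebra k C]
  [AddCommGroup D] [Module k D] [Coalgebra k D]

/-- The conditions for an element `x` of a coalgebra acting on a commutative Hopf algebroid
through a pair `(Ψ, ψ)`: it measures both algebras and commutes with the structure maps. In the
last condition, `z = ∑ u₁ ⊗ u₂` is an arbitrary representative of `Δ(u)`, so that it reads
`Δ'(x(u)) = x₁(u₁) ⊗ x₂(u₂)`. -/
structure HopfMeasuringAt (Ψ : C →ₗ[k] H.U →ₗ[k] H'.U) (ψ : C →ₗ[k] H.A →ₗ[k] H'.A) (x : C) :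
    Prop where
  alg_U : AlgMeasuringAt Ψ x
  alg_A : AlgMeasuringAt ψ x
  map_s : ∀ a, Ψ x (H.s a) = H'.s (ψ x a)
  map_t : ∀ a, Ψ x (H.t a) = H'.t (ψ x a)
  map_S : ∀ u, Ψ x (H.S u) = H'.S (Ψ x u)
  map_ε : ∀ u, ψ x (H.ε u) = H'.ε (Ψ x u)
  map_Δ : ∀ u z, proj₂ H.s H.t z = H.Δ u → H'.Δ (Ψ x u) = proj₂ H'.s H'.t (actTwo Ψ x z)

/-- A measuring of commutative Hopf algebroids. -/
def IsHopfMeasuring (Ψ : C →ₗ[k] H.U →ₗ[k] H'.U) (ψ : C →ₗ[k] H.A →ₗ[k] H'.A) : Prop :=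
  ∀ x, HopfMeasuringAt Ψ ψ x

lemma HopfMeasuringAt.comp {Ψ : C →ₗ[k] H.U →ₗ[k] H'.U} {ψ : C →ₗ[k] H.A →ₗ[k] H'.A}
    {Ψ' : D →ₗ[k] H'.U →ₗ[k] H''.U} {ψ' : D →ₗ[k] H'.A →ₗ[k] H''.A} {x : C} {y : D}
    (h : HopfMeasuringAt Ψ ψ x) (h' : HopfMeasuringAt Ψ' ψ' y) :
    HopfMeasuringAt (actComp Ψ Ψ') (actComp ψ ψ') (x ⊗ₜ[k] y) where
  alg_U := h.alg_U.comp h'.alg_U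
  alg_A := h.alg_A.comp h'.alg_A
  map_s a := by rw [actComp_tmul, actComp_tmul, h.map_s, h'.map_s]
  map_t a := by rw [actComp_tmul, actComp_tmul, h.map_t, h'.map_t]
  map_S u := by rw [actComp_tmul, actComp_tmul, h.map_S, h'.map_S]
  map_ε u := by rw [actComp_tmul, actComp_tmul, h.map_ε, h'.map_ε]
  map_Δ u z hz := by
    rw [actComp_tmul, actTwo_actComp]
    exact h'.map_Δ _ _ (h.map_Δ u z hz).symm

lemma hopfMeasuringAt_id (c : k) :
    HopfMeasuringAt (H := H) (LinearMap.toSpanSingleton k (H.U →ₗ[k] H.U) LinearMap.id)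
      (LinearMap.toSpanSingleton k (H.A →ₗ[k] H.A) LinearMap.id) c where
  alg_U := algMeasuringAt_id c
  alg_A := algMeasuringAt_id c
  map_s a := by simp [LinearMap.toSpanSingleton_apply]
  map_t a := by simp [LinearMap.toSpanSingleton_apply]
  map_S u := by simp [LinearMap.toSpanSingleton_apply]
  map_ε u := by simp [LinearMap.toSpanSingleton_apply]
  map_Δ u z hz := by
    simp [LinearMap.toSpanSingleton_apply, actTwo, hz]

lemma hopfMeasuringAt_comp_iff {Ψ : C →ₗ[k] H.U →ₗ[k] H'.U} {ψ : C →ₗ[k] H.A →ₗ[k] H'.A}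
    {g : D →ₗc[k] C} {x : D} : HopfMeasuringAt (Ψ ∘ₗ g.toLinearMap) (ψ ∘ₗ g.toLinearMap) x ↔
      HopfMeasuringAt Ψ ψ (g.toLinearMap x) := by
  constructor
  · intro h
    refine ⟨algMeasuringAt_comp_iff.1 h.alg_U, algMeasuringAt_comp_iff.1 h.alg_A, h.map_s, h.map_t,
      h.map_S, h.map_ε, fun u z hz => ?_⟩
    rw [← actTwo_comp]; exact h.map_Δ u z hz
  · intro h
    refine ⟨algMeasuringAt_comp_iff.2 h.alg_U, algMeasuringAt_comp_iff.2 h.alg_A, h.map_s, h.map_t,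
      h.map_S, h.map_ε, fun u z hz => ?_⟩
    rw [actTwo_comp]; exact h.map_Δ u z hz

/-- The elements at which a pair of linear maps satisfies the measuring conditions. -/
def hopfLocus (Ψ : C →ₗ[k] H.U →ₗ[k] H'.U) (ψ : C →ₗ[k] H.A →ₗ[k] H'.A) : Submodule k C where
  carrier := {x | HopfMeasuringAt Ψ ψ x}
  add_mem' {x y} hx hy :=
    { alg_U := (algLocus Ψ).add_mem hx.alg_U hy.alg_U
      alg_A := (algLocus ψ).add_mem hx.alg_A hy.alg_A
      map_s := fun a => by simp only [map_add, LinearMap.add_apply, hx.map_s, hy.map_s]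
      map_t := fun a => by simp only [map_add, LinearMap.add_apply, hx.map_t, hy.map_t]
      map_S := fun a => by simp only [map_add, LinearMap.add_apply, hx.map_S, hy.map_S]
      map_ε := fun a => by simp only [map_add, LinearMap.add_apply, hx.map_ε, hy.map_ε]
      map_Δ := fun u z hz => by
        simp only [map_add, LinearMap.add_apply, hx.map_Δ u z hz, hy.map_Δ u z hz] }
  zero_mem' :=
    { alg_U := (algLocus Ψ).zero_mem
      alg_A := (algLocus ψ).zero_mem
      map_s := fun a => by simp
      map_t := fun a => by simp
      map_S := fun a => by simp
      map_ε := fun a => by simp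
      map_Δ := fun u z hz => by simp }
  smul_mem' c x hx :=
    { alg_U := (algLocus Ψ).smul_mem c hx.alg_U
      alg_A := (algLocus ψ).smul_mem c hx.alg_A
      map_s := fun a => by simp only [map_smul, LinearMap.smul_apply, hx.map_s]
      map_t := fun a => by simp only [map_smul, LinearMap.smul_apply, hx.map_t]
      map_S := fun a => by simp only [map_smul, LinearMap.smul_apply, hx.map_S]
      map_ε := fun a => by simp only [map_smul, LinearMap.smul_apply, hx.map_ε]
      map_Δ := fun u z hz => by
        simp only [map_smul, LinearMap.smul_apply, hx.map_Δ u z hz] }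

variable (H H') in
/-- The condition of being a measuring of commutative Hopf algebroids. -/
def hopfCondition : Condition k ((H.U →ₗ[k] H'.U) × (H.A →ₗ[k] H'.A)) where
  locus C _ _ _ f := hopfLocus (LinearMap.fst k _ _ ∘ₗ f) (LinearMap.snd k _ _ ∘ₗ f)
  locus_comp g f := Submodule.ext fun x =>
    hopfMeasuringAt_comp_iff (Ψ := LinearMap.fst k _ _ ∘ₗ f) (ψ := LinearMap.snd k _ _ ∘ₗ f)

lemma hopfCondition_holds (f : C →ₗ[k] (H.U →ₗ[k] H'.U) × (H.A →ₗ[k] H'.A)) :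
    (hopfCondition H H').Holds f ↔
      IsHopfMeasuring (LinearMap.fst k _ _ ∘ₗ f) (LinearMap.snd k _ _ ∘ₗ f) := Submodule.eq_top_iff'

end Hopf

/-- The enrichment of commutative Hopf algebroids in cocommutative coalgebras, by universal
cocommutative measuring coalgebras. -/
def hopfEnrichment (k : Type u) [Field k] : Enrichment k (CommHopfAlgebroid k) where
  maps H H' := (H.U →ₗ[k] H'.U) × (H.A →ₗ[k] H'.A)
  one H := (LinearMap.id, LinearMap.id)
  comp H H' H'' := LinearMap.mk₂ k (fun f g => (g.1 ∘ₗ f.1, g.2 ∘ₗ f.2))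
    (fun f f' g => by simp [LinearMap.comp_add])
    (fun c f g => by simp [LinearMap.comp_smul])
    (fun f g g' => by simp [LinearMap.add_comp])
    (fun c f g => by simp [LinearMap.smul_comp])
  one_comp H H' f := rfl
  comp_one H H' f := rfl
  comp_assoc H₀ H₁ H₂ H₃ f g h := rfl
  cond H H' := hopfCondition H H'
  holds_one H := (hopfCondition_holds _).2 hopfMeasuringAt_id
  holds_comp H H' H'' C D _ _ _ _ _ _ f g hf hg := by
    refine eq_top_of_tmul _ fun a b => ?_
    have h := ((hopfCondition_holds f).1 hf a).comp ((hopfCondition_holds g).1 hg b)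
    change HopfMeasuringAt _ _ _
    refine Eq.mp (congrArg₂ (fun F G => HopfMeasuringAt F G (a ⊗ₜ[k] b)) ?_ ?_) h <;>
      exact TensorProduct.ext' fun x y => rfl

end MeasuringCoalgebra
end

noncomputable section

open TensorProduct

namespace BarComplex
variable {A : Type u} {U : Type v} [CommRing A] [CommRing U] [Algebra A U]

lemma prepend_add (u v : U) : (prepend (u + v) : Chains A U →ₗ[A] _) = prepend u + prepend v := by
  refine hom_ext fun l => ?_
  simp only [prepend, word, Chains.lift_of, LinearMap.comp_apply, LinearMap.add_apply, consC, map_add]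

lemma prepend_smul (a : A) (u : U) : (prepend (a • u) : Chains A U →ₗ[A] _) = a • prepend u := by
  refine hom_ext fun l => ?_
  simp only [prepend, word, Chains.lift_of, LinearMap.comp_apply, LinearMap.smul_apply, consC, map_smul]

lemma smul_base {k : Type w} [CommRing k] [Algebra k A] (c : k) (x : Chains A U) :
    c • x = algebraMap k A c • x := by
  rw [Algebra.algebraMap_eq_smul_one, smul_assoc, one_smul]

/-- The map `u ⊗ (u¹ ⊗ ⋯ ⊗ uⁿ) ↦ u ⊗ u¹ ⊗ ⋯ ⊗ uⁿ`, as a bilinear map over the base. -/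
def prependLin (k : Type w) [CommRing k] [Algebra k A] [Algebra k U] [IsScalarTower k A U] :
    U →ₗ[k] Chains A U →ₗ[k] Chains A U :=
  LinearMap.mk₂ k (fun u x => prepend u x)
    (fun u v x => by rw [prepend_add, LinearMap.add_apply])
    (fun c u x => by
      rw [← algebraMap_smul A c u, prepend_smul, LinearMap.smul_apply,
        smul_base c (prepend u x)])
    (fun u x y => map_add _ x y)
    (fun c u x => by rw [smul_base c x, map_smul, ← smul_base])

end BarComplex

namespace MeasuringCoalgebra
open Coalgebra LinearMap

section Conv
variable {k : Type u} [Field k] {C : Type u} [AddCommGroup C] [Module k C] [Coalgebra k C]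
  {X Y Z X' Y' Z' : Type u} [AddCommGroup X] [Module k X] [AddCommGroup Y] [Module k Y]
  [AddCommGroup Z] [Module k Z] [AddCommGroup X'] [Module k X'] [AddCommGroup Y'] [Module k Y']
  [AddCommGroup Z'] [Module k Z']

/-- The convolution `x ↦ b(f(x₁), g(x₂))`. -/
def conv (b : X →ₗ[k] Y →ₗ[k] Z) (f : C →ₗ[k] X) (g : C →ₗ[k] Y) : C →ₗ[k] Z :=
  TensorProduct.lift b ∘ₗ TensorProduct.map f g ∘ₗ comul

lemma conv_add_left (b : X →ₗ[k] Y →ₗ[k] Z) (f f' : C →ₗ[k] X) (g : C →ₗ[k] Y) :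
    conv b (f + f') g = conv b f g + conv b f' g := by
  simp only [conv, TensorProduct.map_add_left, LinearMap.add_comp, LinearMap.comp_add]

lemma conv_add_right (b : X →ₗ[k] Y →ₗ[k] Z) (f : C →ₗ[k] X) (g g' : C →ₗ[k] Y) :
    conv b f (g + g') = conv b f g + conv b f g' := by
  simp only [conv, TensorProduct.map_add_right, LinearMap.add_comp, LinearMap.comp_add]

lemma conv_zero_left (b : X →ₗ[k] Y →ₗ[k] Z) (g : C →ₗ[k] Y) : conv b 0 g = 0 := by
  have := conv_add_left b 0 0 g
  rwa [add_zero, left_eq_add] at this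

lemma conv_zero_right (b : X →ₗ[k] Y →ₗ[k] Z) (f : C →ₗ[k] X) : conv b f 0 = 0 := by
  have := conv_add_right b f 0 0
  rwa [add_zero, left_eq_add] at this

lemma conv_comm [IsCocomm k C] (b : X →ₗ[k] Y →ₗ[k] Z) (f : C →ₗ[k] X) (g : C →ₗ[k] Y) :
    conv b f g = conv b.flip g f := by
  refine LinearMap.ext fun x => ?_
  simp only [conv, LinearMap.comp_apply]
  conv_lhs => rw [← comm_comul k x]
  generalize comul (R := k) x = z
  induction z using TensorProduct.induction_on with
  | zero => simp
  | add p p' hp hp' => simp only [map_add, hp, hp']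
  | tmul c d => simp

lemma conv_assoc (b₁ : X →ₗ[k] Y →ₗ[k] X') (b₂ : X' →ₗ[k] Z →ₗ[k] Z') (b₃ : Y →ₗ[k] Z →ₗ[k] Y')
    (b₄ : X →ₗ[k] Y' →ₗ[k] Z') (h : ∀ x y z, b₂ (b₁ x y) z = b₄ x (b₃ y z))
    (f : C →ₗ[k] X) (g : C →ₗ[k] Y) (e : C →ₗ[k] Z) :
    conv b₂ (conv b₁ f g) e = conv b₄ f (conv b₃ g e) := by
  refine LinearMap.ext fun x => ?_
  let T : X ⊗[k] (Y ⊗[k] Z) →ₗ[k] Z' := TensorProduct.lift b₄ ∘ₗ (TensorProduct.lift b₃).lTensor X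
  have h1 : ∀ w : C ⊗[k] C, TensorProduct.lift b₄ (TensorProduct.map f (conv b₃ g e) w) =
      T (TensorProduct.map f (TensorProduct.map g e) (comul.lTensor C w)) := by
    intro w
    induction w using TensorProduct.induction_on with
    | zero => simp
    | add p p' hp hp' => simp only [map_add, hp, hp']
    | tmul c d => simp [T, conv]
  have h2 : ∀ (z : X ⊗[k] Y) (y : Z), TensorProduct.lift b₂ (TensorProduct.lift b₁ z ⊗ₜ y) =
      T (TensorProduct.assoc k X Y Z (z ⊗ₜ y)) := by
    intro z y
    induction z using TensorProduct.induction_on with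
    | zero => simp
    | add p p' hp hp' =>
      simp only [map_add, TensorProduct.add_tmul] at hp hp' ⊢
      rw [hp, hp']
    | tmul c d => simp [T, h]
  have h3 : ∀ w : C ⊗[k] C, TensorProduct.lift b₂ (TensorProduct.map (conv b₁ f g) e w) =
      T (TensorProduct.map f (TensorProduct.map g e)
        (TensorProduct.assoc k C C C (comul.rTensor C w))) := by
    intro w
    induction w using TensorProduct.induction_on with
    | zero => simp
    | add p p' hp hp' => simp only [map_add, hp, hp']
    | tmul c d =>
      rw [TensorProduct.map_tmul, LinearMap.rTensor_tmul]
      simp only [conv, LinearMap.comp_apply]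
      rw [h2, TensorProduct.map_map_assoc]
      rfl
  change TensorProduct.lift b₂ (TensorProduct.map (conv b₁ f g) e (comul x)) =
    TensorProduct.lift b₄ (TensorProduct.map f (conv b₃ g e) (comul x))
  rw [h1, h3, Coalgebra.coassoc_apply]

lemma conv_counit_left (b : k →ₗ[k] Y →ₗ[k] Z) (g : C →ₗ[k] Y) :
    conv b counit g = b 1 ∘ₗ g := by
  refine LinearMap.ext fun x => ?_
  simp only [conv, LinearMap.comp_apply]
  have : TensorProduct.map (counit (R := k)) g (comul x) = (1 : k) ⊗ₜ g x := by
    rw [← LinearMap.lTensor_comp_rTensor, LinearMap.comp_apply, Coalgebra.rTensor_counit_comul]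
    simp
  rw [this, TensorProduct.lift.tmul]

lemma conv_comp_left {X₀ : Type u} [AddCommGroup X₀] [Module k X₀] (b : X →ₗ[k] Y →ₗ[k] Z)
    (j : X₀ →ₗ[k] X) (f : C →ₗ[k] X₀) (g : C →ₗ[k] Y) : conv b (j ∘ₗ f) g = conv (b ∘ₗ j) f g := by
  refine LinearMap.ext fun x => ?_
  simp only [conv, LinearMap.comp_apply]
  generalize comul (R := k) x = z
  induction z using TensorProduct.induction_on with
  | zero => simp
  | add p p' hp hp' => simp only [map_add, hp, hp']
  | tmul c d => simp

end Conv

section ChainMap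
variable {k : Type u} [Field k] {H H' : CommHopfAlgebroid k}
  {C : Type u} [AddCommGroup C] [Module k C] [Coalgebra k C]

variable (H) in
/-- Scalar multiplication of `A` on chains, as a bilinear map over `k`. -/
def smulLin : H.A →ₗ[k] H.Chains →ₗ[k] H.Chains :=
  LinearMap.mk₂ k (fun a x => a • x) add_smul (fun c a x => smul_assoc c a x) smul_add
    (fun c a x => smul_comm a c x)

/-- The linear map `x ↦ x₁(u¹) ⊗ ⋯ ⊗ xₙ(uⁿ)` for given `u¹, …, uⁿ`, by recursion on `n`. For
`n = 0` this is `x ↦ ε(x) 1`. -/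
def actTuple (Ψ : C →ₗ[k] H.U →ₗ[k] H'.U) : ∀ n, (Fin n → H.U) → C →ₗ[k] H'.Chains
  | 0, _ => (counit (R := k)).smulRight (1 : H'.Chains)
  | n + 1, u => conv (BarComplex.prependLin k) (Ψ.flip (u 0)) (actTuple Ψ n (Fin.tail u))

lemma IsHopfMeasuring.alg_A {Ψ : C →ₗ[k] H.U →ₗ[k] H'.U} {ψ : C →ₗ[k] H.A →ₗ[k] H'.A}
    (h : IsHopfMeasuring Ψ ψ) : IsAlgMeasuring ψ := fun x => (h x).alg_A

lemma flip_mul {ψ : C →ₗ[k] H.A →ₗ[k] H'.A} (hψ : IsAlgMeasuring ψ) (a b : H.A) :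
    ψ.flip (a * b) = conv (LinearMap.mul k H'.A) (ψ.flip a) (ψ.flip b) := by
  refine LinearMap.ext fun x => ?_
  rw [LinearMap.flip_apply, (hψ x).map_mul]
  simp only [actTwo, conv, LinearMap.comp_apply]
  generalize comul (R := k) x = z
  induction z using TensorProduct.induction_on with
  | zero => simp
  | add p p' hp hp' => simp only [map_add, LinearMap.add_apply, hp, hp']
  | tmul c d => simp

lemma flip_one {ψ : C →ₗ[k] H.A →ₗ[k] H'.A} (hψ : IsAlgMeasuring ψ) :
    ψ.flip 1 = (LinearMap.toSpanSingleton k H'.A 1) ∘ₗ counit := by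
  refine LinearMap.ext fun x => ?_
  simp [(hψ x).map_one, LinearMap.toSpanSingleton_apply]

lemma conv_flip_one {ψ : C →ₗ[k] H.A →ₗ[k] H'.A} (hψ : IsAlgMeasuring ψ) (c : k)
    (f : C →ₗ[k] H'.Chains) : conv (smulLin H') (ψ.flip (c • 1)) f = c • f := by
  have : ψ.flip (c • 1) = (LinearMap.toSpanSingleton k H'.A (c • 1)) ∘ₗ counit := by
    rw [map_smul, flip_one hψ]
    refine LinearMap.ext fun x => ?_
    simp [LinearMap.toSpanSingleton_apply, smul_comm c]
  rw [this, conv_comp_left, conv_counit_left]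
  refine LinearMap.ext fun x => ?_
  simp [LinearMap.toSpanSingleton_apply, smulLin]

lemma conv_flip_one' {ψ : C →ₗ[k] H.A →ₗ[k] H'.A} (hψ : IsAlgMeasuring ψ)
    (f : C →ₗ[k] H'.Chains) : conv (smulLin H') (ψ.flip 1) f = f := by
  have h := conv_flip_one hψ 1 f
  rwa [one_smul, one_smul] at h

lemma conv_flip_mul {ψ : C →ₗ[k] H.A →ₗ[k] H'.A} (hψ : IsAlgMeasuring ψ) (a b : H.A)
    (f : C →ₗ[k] H'.Chains) : conv (smulLin H') (ψ.flip (a * b)) f =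
      conv (smulLin H') (ψ.flip a) (conv (smulLin H') (ψ.flip b) f) := by
  rw [flip_mul hψ]
  exact conv_assoc _ _ _ _ (fun x y z => mul_smul x y z) _ _ _

/-- The space of linear maps from `C` to the chains of `H'`. -/
def Twisted {ψ : C →ₗ[k] H.A →ₗ[k] H'.A} (hψ : IsAlgMeasuring ψ) : Type u := C →ₗ[k] H'.Chains

instance {ψ : C →ₗ[k] H.A →ₗ[k] H'.A} (hψ : IsAlgMeasuring ψ) : AddCommGroup (Twisted hψ) :=
  inferInstanceAs (AddCommGroup (C →ₗ[k] H'.Chains))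

/-- The underlying linear map. -/
def Twisted.toLin {ψ : C →ₗ[k] H.A →ₗ[k] H'.A} {hψ : IsAlgMeasuring ψ} (f : Twisted hψ) :
    C →ₗ[k] H'.Chains := f

/-- The `A`-module structure `(a • f)(x) = x₁(a) f(x₂)`. -/
instance {ψ : C →ₗ[k] H.A →ₗ[k] H'.A} (hψ : IsAlgMeasuring ψ) : Module H.A (Twisted hψ) where
  smul a f := conv (smulLin H') (ψ.flip a) f
  one_smul f := conv_flip_one' hψ f
  mul_smul a b f := conv_flip_mul hψ a b f
  smul_zero a := conv_zero_right _ _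
  smul_add a f g := conv_add_right _ _ _ _
  add_smul a b f := by
    change conv (smulLin H') (ψ.flip (a + b)) f = _
    rw [map_add]
    exact conv_add_left _ _ _ _
  zero_smul f := by
    change conv (smulLin H') (ψ.flip 0) f = _
    rw [map_zero]
    exact conv_zero_left _ _

lemma twisted_smul {ψ : C →ₗ[k] H.A →ₗ[k] H'.A} (hψ : IsAlgMeasuring ψ) (a : H.A)
    (f : Twisted hψ) : a • f = (conv (smulLin H') (ψ.flip a) f : C →ₗ[k] H'.Chains) := rfl

variable (H) in
/-- The action of `A` on `U`, as a bilinear map over `k`. -/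
def smulU : H.A →ₗ[k] H.U →ₗ[k] H.U :=
  LinearMap.mk₂ k (fun a x => a • x) add_smul (fun c a x => smul_assoc c a x) smul_add
    (fun c a x => smul_comm a c x)

lemma prepend_smulU (a : H.A) (u : H.U) (z : H.Chains) :
    BarComplex.prependLin k (smulU H a u) z = smulLin H a (BarComplex.prependLin k u z) := by
  change BarComplex.prepend (a • u) z = a • BarComplex.prepend u z
  rw [BarComplex.prepend_smul, LinearMap.smul_apply]

lemma prepend_smulU' (a : H.A) (u : H.U) (z : H.Chains) :
    BarComplex.prependLin k (smulU H a u) z = BarComplex.prependLin k u (smulLin H a z) := by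
  rw [prepend_smulU]
  exact (map_smul (BarComplex.prepend u) a z).symm

lemma flip_smul {Ψ : C →ₗ[k] H.U →ₗ[k] H'.U} {ψ : C →ₗ[k] H.A →ₗ[k] H'.A}
    (h : IsHopfMeasuring Ψ ψ) (a : H.A) (u : H.U) :
    Ψ.flip (a • u) = conv (smulU H') (ψ.flip a) (Ψ.flip u) := by
  refine LinearMap.ext fun x => ?_
  rw [LinearMap.flip_apply, H.smul_def, (h x).alg_U.map_mul]
  simp only [actTwo, conv, LinearMap.comp_apply]
  generalize comul (R := k) x = z
  induction z using TensorProduct.induction_on with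
  | zero => simp
  | add p p' hp hp' => simp only [map_add, LinearMap.add_apply, hp, hp']
  | tmul c d =>
    simp only [TensorProduct.map_tmul, TensorProduct.homTensorHomMap_apply, LinearMap.mul'_apply,
      TensorProduct.lift.tmul, LinearMap.flip_apply, (h c).map_t]
    rfl

lemma prepend_flip_smul {Ψ : C →ₗ[k] H.U →ₗ[k] H'.U} {ψ : C →ₗ[k] H.A →ₗ[k] H'.A}
    (h : IsHopfMeasuring Ψ ψ) (a : H.A) (u : H.U) (f : C →ₗ[k] H'.Chains) :
    conv (BarComplex.prependLin k) (Ψ.flip (a • u)) f =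
      conv (smulLin H') (ψ.flip a) (conv (BarComplex.prependLin k) (Ψ.flip u) f) := by
  rw [flip_smul h]
  exact conv_assoc _ _ _ _ (fun x y z => prepend_smulU x y z) _ _ _

lemma prepend_twisted [IsCocomm k C] {Ψ : C →ₗ[k] H.U →ₗ[k] H'.U} {ψ : C →ₗ[k] H.A →ₗ[k] H'.A}
    (h : IsHopfMeasuring Ψ ψ) (a : H.A) (u : H.U) (f : C →ₗ[k] H'.Chains) :
    conv (BarComplex.prependLin k) (Ψ.flip u) (conv (smulLin H') (ψ.flip a) f) =
      conv (smulLin H') (ψ.flip a) (conv (BarComplex.prependLin k) (Ψ.flip u) f) := by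
  have h1 : conv (smulU H') (ψ.flip a) (Ψ.flip u) = conv (smulU H').flip (Ψ.flip u) (ψ.flip a) :=
    conv_comm _ _ _
  have h2 := conv_assoc (smulU H').flip (BarComplex.prependLin k) (smulLin H')
    (BarComplex.prependLin k) (fun x y z => prepend_smulU' y x z) (Ψ.flip u) (ψ.flip a) f
  rw [← prepend_flip_smul h, flip_smul h, h1, h2]

/-- The assignment `(u¹, …, uⁿ) ↦ (x ↦ x₁(u¹) ⊗ ⋯ ⊗ xₙ(uⁿ))` is multilinear over `A`. -/
def actMultilinear [IsCocomm k C] {Ψ : C →ₗ[k] H.U →ₗ[k] H'.U} {ψ : C →ₗ[k] H.A →ₗ[k] H'.A}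
    (h : IsHopfMeasuring Ψ ψ) (n : ℕ) : MultilinearMap H.A (fun _ : Fin n => H.U)
      (Twisted h.alg_A) where
  toFun u := actTuple Ψ n u
  map_update_add' := by
    intro inst u m x y
    obtain rfl : inst = instDecidableEqFin n := Subsingleton.elim _ _
    change actTuple Ψ n _ = actTuple Ψ n _ + actTuple Ψ n _
    induction n with
    | zero => exact m.elim0
    | succ n ih =>
      cases m using Fin.cases with
      | zero =>
        simp only [actTuple, Function.update_self, Fin.tail_update_zero, map_add]
        exact conv_add_left _ _ _ _
      | succ m =>
        simp only [actTuple, Fin.tail_update_succ, ih,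
          Function.update_of_ne (Fin.succ_ne_zero m).symm]
        exact conv_add_right _ _ _ _
  map_update_smul' := by
    intro inst u m a x
    obtain rfl : inst = instDecidableEqFin n := Subsingleton.elim _ _
    change actTuple Ψ n _ = conv (smulLin H') (ψ.flip a) (actTuple Ψ n _)
    induction n with
    | zero => exact m.elim0
    | succ n ih =>
      cases m using Fin.cases with
      | zero =>
        simp only [actTuple, Function.update_self, Fin.tail_update_zero]
        exact prepend_flip_smul h _ _ _
      | succ m =>
        simp only [actTuple, Fin.tail_update_succ, ih,
          Function.update_of_ne (Fin.succ_ne_zero m).symm]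
        exact prepend_twisted h _ _ _

/-- The maps `Ψ_•(x)` on chains, as an `A`-linear map in the chain. -/
def chainAct [IsCocomm k C] {Ψ : C →ₗ[k] H.U →ₗ[k] H'.U} {ψ : C →ₗ[k] H.A →ₗ[k] H'.A}
    (h : IsHopfMeasuring Ψ ψ) : H.Chains →ₗ[H.A] Twisted h.alg_A :=
  BarComplex.Chains.lift fun n => PiTensorProduct.lift (actMultilinear h n)

/-- The map `Ψ_•(x)` on chains induced by an element `x` of a measuring coalgebra. -/
def chainMap [IsCocomm k C] {Ψ : C →ₗ[k] H.U →ₗ[k] H'.U} {ψ : C →ₗ[k] H.A →ₗ[k] H'.A}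
    (h : IsHopfMeasuring Ψ ψ) (x : C) : H.Chains →ₗ[k] H'.Chains where
  toFun z := (chainAct h z).toLin x
  map_add' y z := by
    rw [map_add]; rfl
  map_smul' c z := by
    rw [BarComplex.smul_base, map_smul, Algebra.algebraMap_eq_smul_one]
    exact LinearMap.congr_fun (conv_flip_one h.alg_A c (chainAct h z).toLin) x

/-- In positive degrees, `Ψ_n(x)(u¹ ⊗ ⋯ ⊗ uⁿ) = x₁(u¹) ⊗ ⋯ ⊗ xₙ(uⁿ)`. -/
lemma chainMap_tprod [IsCocomm k C] {Ψ : C →ₗ[k] H.U →ₗ[k] H'.U} {ψ : C →ₗ[k] H.A →ₗ[k] H'.A}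
    (h : IsHopfMeasuring Ψ ψ) (x : C) (n : ℕ) (u : Fin n → H.U) :
    chainMap h x (BarComplex.Chains.of H.A H.U n (PiTensorProduct.tprod H.A u)) =
      actTuple Ψ n u x := by
  change (chainAct h (BarComplex.Chains.of H.A H.U n (PiTensorProduct.tprod H.A u))).toLin x = _
  unfold chainAct
  rw [BarComplex.Chains.lift_of, PiTensorProduct.lift.tprod]
  rfl

/-- In degree zero, `Ψ_0(x) = ψ(x)`. -/
lemma chainMap_zero [IsCocomm k C] {Ψ : C →ₗ[k] H.U →ₗ[k] H'.U} {ψ : C →ₗ[k] H.A →ₗ[k] H'.A}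
    (h : IsHopfMeasuring Ψ ψ) (x : C) (a : H.A) :
    chainMap h x (a • (1 : H.Chains)) = ψ x a • (1 : H'.Chains) := by
  have h0 : chainAct h (1 : H.Chains) =
      ((counit (R := k)).smulRight (1 : H'.Chains) : C →ₗ[k] H'.Chains) := by
    change chainAct h (BarComplex.Chains.of H.A H.U 0 _) = _
    unfold chainAct
    rw [BarComplex.Chains.lift_of, PiTensorProduct.lift.tprod]
    rfl
  change (chainAct h (a • (1 : H.Chains))).toLin x = _
  rw [map_smul, h0]
  change conv (smulLin H') (ψ.flip a) ((counit (R := k)).smulRight (1 : H'.Chains)) x = _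
  rw [conv_comm]
  have : (counit (R := k) (A := C)).smulRight (1 : H'.Chains) =
      LinearMap.toSpanSingleton k H'.Chains 1 ∘ₗ counit := rfl
  rw [this, conv_comp_left, conv_counit_left]
  simp [LinearMap.toSpanSingleton_apply, smulLin]

end ChainMap

end MeasuringCoalgebra
end

noncomputable section

open TensorProduct

open CategoryTheory MeasuringCoalgebra

/-- The category of commutative Hopf algebroids over `k`, to be enriched in cocommutative
coalgebras by the universal cocommutative measuring coalgebras of Hopf algebroids. -/
def CHALG (k : Type u) [Field k] : Type (u + 1) := CommHopfAlgebroid k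

instance (k : Type u) [Field k] : EnrichedCategory (CoCoalg k) (CHALG k) :=
  (hopfEnrichment k).enrichedCategory

/-- The commutative Hopf algebroids over `k`, to be enriched in cocommutative coalgebras by the
universal cocommutative measuring coalgebras between the Hochschild homology algebras. -/
def CHALGTilde (k : Type u) [Field k] : Type (u + 1) := CommHopfAlgebroid k

/-- The enrichment of Hochschild homology algebras by universal measuring coalgebras. -/
abbrev homologyEnrichment (k : Type u) [Field k] : Enrichment k (CommHopfAlgebroid k) :=
  algEnrichment k fun H : CommHopfAlgebroid k => H.HH

instance (k : Type u) [Field k] : EnrichedCategory (CoCoalg k) (CHALGTilde k) :=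
  (homologyEnrichment k).enrichedCategory

variable {k : Type u} [Field k]

/-- A commutative Hopf algebroid as an object of the second enriched category. -/
def CHALG.toTilde (H : CHALG k) : CHALGTilde k := H

/-- The underlying Hopf algebroid of an object. -/
abbrev CHALG.hopf (H : CHALG k) : CommHopfAlgebroid k := H

/-- The universal measuring coalgebra of Hopf algebroids is cocommutative. -/
instance (H H' : CHALG k) : Coalgebra.IsCocomm k (H ⟶[CoCoalg k] H').obj :=
  (H ⟶[CoCoalg k] H').property

/-- The component on total algebras of the universal measuring of Hopf algebroids. -/
def universalU (H H' : CHALG k) : (H ⟶[CoCoalg k] H').obj →ₗ[k] H.hopf.U →ₗ[k] H'.hopf.U :=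
  LinearMap.fst k (H.hopf.U →ₗ[k] H'.hopf.U) (H.hopf.A →ₗ[k] H'.hopf.A) ∘ₗ (hopfEnrichment k).eval H.hopf H'.hopf

/-- The component on base algebras of the universal measuring of Hopf algebroids. -/
def universalA (H H' : CHALG k) : (H ⟶[CoCoalg k] H').obj →ₗ[k] H.hopf.A →ₗ[k] H'.hopf.A :=
  LinearMap.snd k (H.hopf.U →ₗ[k] H'.hopf.U) (H.hopf.A →ₗ[k] H'.hopf.A) ∘ₗ (hopfEnrichment k).eval H.hopf H'.hopf

lemma universal_isHopfMeasuring (H H' : CHALG k) :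
    IsHopfMeasuring (universalU H H') (universalA H H') :=
  (hopfCondition_holds _).1 ((hopfEnrichment k).holds_eval H.hopf H'.hopf)

/-- The map on Hochschild chains induced by an element of the universal measuring coalgebra. -/
def universalChainMap (H H' : CHALG k) (x : (H ⟶[CoCoalg k] H').obj) :
    H.hopf.Chains →ₗ[k] H'.hopf.Chains := chainMap (universal_isHopfMeasuring H H') x

/-- The action of the universal measuring coalgebra between Hochschild homology algebras. -/
def universalHH (H H' : CHALG k) :
    (H.toTilde ⟶[CoCoalg k] H'.toTilde).obj →ₗ[k] H.hopf.HH →ₗ[k] H'.hopf.HH :=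
  (homologyEnrichment k).eval H.hopf H'.hopf

/-- The Hochschild boundary of a commutative Hopf algebroid. -/
def hochschildBoundary (H : CHALG k) : H.hopf.Chains →ₗ[H.hopf.A] H.hopf.Chains :=
  BarComplex.boundary H.hopf.epsR H.hopf.epsL

/-- The class in Hochschild homology of a cycle. -/
def homologyClass (H : CHALG k) : H.hopf.cycles →ₐ[k] H.hopf.HH :=
  BarComplex.Homology.mk k H.hopf.epsR H.hopf.epsL

/-- The underlying linear map of a morphism of cocommutative coalgebras. -/
abbrev coalgLin {C D : CoCoalg k} (f : C ⟶ D) : C.obj →ₗ[k] D.obj := Universal.linMap f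

end

open CategoryTheory

/-! Let `C` be a cocommutative coalgebra measuring one Hopf algebroid into another. Instead of one
chain-level map per element `x`, the proof studies for each chain `z` the function `x ↦ x(z)` on
`C`, which is `(chainsAct h).flip z`. Two rules determine it from its value on the unit chain: `x(a
z) = x₁(a) x₂(z)` for `a` in the base algebra (`chainsAct_flip_smul`), and `x(u ⊗ z) = x₁(u) ⊗
x₂(z)` (`chainsAct_flip_prepend`). Both right-hand sides are convolutions `conv b f g`, that is, `x
↦ b(f(x₁), g(x₂))`.

The boundary `d` and the shuffle product obey recursions in the first tensor factor. Write `d⁰` for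
the boundary with its zeroth face removed and `σ` for the sign involution `(-1)ⁿ`. Then `d(u ⊗ z) =
ε_R(u) z + d⁰(u ⊗ z)` and `d⁰(u ⊗ v ⊗ z) = -(uv ⊗ z) - u ⊗ d⁰(v ⊗ z)`, while `(u ⊗ x)(v ⊗ y) = u ⊗
(x (v ⊗ y)) - v ⊗ ((u ⊗ σx) y)`. Source and target satisfy the same recursions, and a Hopf measuring
respects every operation in them: the product of `U`, the base action through `t`, the counit, and
`ε_R = ε ∘ S`. Induction on words therefore gives a chain map (`chainsAct_flip_boundary`) that is a
measuring for shuffles (`chainsAct_flip_mul`). Cocommutativity is needed when the recursion changes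
the order of the factors: in the shuffle recursion `v` jumps ahead of `u ⊗ x`, and base scalars move
past tensor factors.

Each inductive step is an equality of iterated convolutions. Both sides are written as a fixed
linear map after the same function `x ↦ f(x₁) ⊗ (g(x₂) ⊗ e(x₃))`. It then suffices that the two
fixed maps agree on pure tensors, and this is the recursion in the target.

A multiplicative action by chain maps descends to cycles modulo boundaries, so `C` measures the
homology algebras (`homologyAct_isAlgMeasuring`). For the universal `C`, finality of the target
hom-object turns this into the coalgebra map `homologyHom`. Coalgebra maps into that hom-object are
determined by their action on homology, so functoriality reduces to strict identities between chain
maps. These come from three facts: the chain action is natural for coalgebra maps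
(`chainMap_comp_coalgHom`), `C ⊗ D` acts by composites (`chainMap_actComp`), and `k` acts by scalars
(`chainMap_toSpanSingleton`). -/

noncomputable section

open TensorProduct

namespace MeasuringCoalgebra
open Coalgebra LinearMap

/-! ### Calculus of convolutions and normal forms of iterated convolutions. -/

section ConvolutionCalculus
variable {k : Type u} [Field k] {C D : Type u} [AddCommGroup C] [Module k C] [Coalgebra k C]
  [AddCommGroup D] [Module k D] [Coalgebra k D]
  {X Y Z X' Y' Z' : Type u} [AddCommGroup X] [Module k X] [AddCommGroup Y] [Module k Y]
  [AddCommGroup Z] [Module k Z] [AddCommGroup X'] [Module k X'] [AddCommGroup Y'] [Module k Y']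
  [AddCommGroup Z'] [Module k Z']

/-- Together with `conv_comp_left` and `conv_comp_right`, this collects every map that does not
depend on the coalgebra into the one bilinear map. Two convolutions of the same functions can then
be compared through their bilinear maps alone. -/
lemma comp_conv (L : Z →ₗ[k] Z') (b : X →ₗ[k] Y →ₗ[k] Z) (f : C →ₗ[k] X) (g : C →ₗ[k] Y) :
    L ∘ₗ conv b f g = conv (b.compr₂ L) f g := by
  rw [conv, conv, TensorProduct.lift_compr₂, LinearMap.comp_assoc]

lemma conv_comp_right (b : X →ₗ[k] Y →ₗ[k] Z) (j : Y' →ₗ[k] Y) (f : C →ₗ[k] X)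
    (g : C →ₗ[k] Y') : conv b f (j ∘ₗ g) = conv (b.compl₂ j) f g := by
  refine LinearMap.ext fun x => ?_
  simp only [conv, LinearMap.comp_apply]
  generalize comul (R := k) x = z
  induction z using TensorProduct.induction_on with
  | zero => simp
  | add p p' hp hp' => simp only [map_add, hp, hp']
  | tmul c d => simp

lemma conv_add_bilin (b b' : X →ₗ[k] Y →ₗ[k] Z) (f : C →ₗ[k] X) (g : C →ₗ[k] Y) :
    conv (b + b') f g = conv b f g + conv b' f g := by
  have h : TensorProduct.lift (b + b') = TensorProduct.lift b + TensorProduct.lift b' :=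
    map_add (TensorProduct.uncurry (RingHom.id k) X Y Z) b b'
  simp only [conv, h, LinearMap.add_comp]

lemma conv_neg_bilin (b : X →ₗ[k] Y →ₗ[k] Z) (f : C →ₗ[k] X) (g : C →ₗ[k] Y) :
    conv (-b) f g = - conv b f g := by
  rw [eq_neg_iff_add_eq_zero, ← conv_add_bilin, neg_add_cancel]
  -- Additivity at `0 + 0` forces the convolution along the zero bilinear map to vanish.
  have := conv_add_bilin (0 : X →ₗ[k] Y →ₗ[k] Z) 0 f g
  rwa [add_zero, left_eq_add] at this

/-- A coalgebra map commutes with comultiplication, so it does not matter whether an element is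
split before or after applying it. -/
lemma conv_comp_coalgHom (b : X →ₗ[k] Y →ₗ[k] Z) (f : C →ₗ[k] X) (g : C →ₗ[k] Y)
    (q : D →ₗc[k] C) :
    conv b (f ∘ₗ q.toLinearMap) (g ∘ₗ q.toLinearMap) = conv b f g ∘ₗ q.toLinearMap := by
  refine LinearMap.ext fun x => ?_
  simp only [conv, LinearMap.comp_apply, TensorProduct.map_comp]
  rw [← coalgHom_comul q x]

lemma conv_counit_right (b : X →ₗ[k] k →ₗ[k] Z) (f : C →ₗ[k] X) :
    conv b f counit = b.flip 1 ∘ₗ f := by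
  refine LinearMap.ext fun x => ?_
  simp only [conv, LinearMap.comp_apply]
  have : TensorProduct.map f (counit (R := k)) (comul x) = f x ⊗ₜ (1 : k) := by
    rw [← LinearMap.rTensor_comp_lTensor, LinearMap.comp_apply, Coalgebra.lTensor_counit_comul]
    simp
  rw [this, TensorProduct.lift.tmul, LinearMap.flip_apply]

lemma conv_smul_left (b : X →ₗ[k] Y →ₗ[k] Z) (c : k) (f : C →ₗ[k] X) (g : C →ₗ[k] Y) :
    conv b (c • f) g = c • conv b f g := by
  simp only [conv, TensorProduct.map_smul_left, LinearMap.smul_comp, LinearMap.comp_smul]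

/-- Splits a convolution into a part that sees the coalgebra, `x ↦ f(x₁) ⊗ g(x₂)`, and a fixed
linear map applied afterwards. -/
lemma conv_eq_lift_comp (b : X →ₗ[k] Y →ₗ[k] Z) (f : C →ₗ[k] X) (g : C →ₗ[k] Y) :
    conv b f g = TensorProduct.lift b ∘ₗ conv (TensorProduct.mk k X Y) f g := by
  rw [comp_conv]
  rfl

/-- Normal form of a twofold convolution: a fixed map after `x ↦ f(x₁) ⊗ (g(x₂) ⊗ e(x₃))`. The next
two lemmas bring the other bracketing and the other order of the arguments to the same form, so that
equalities become equalities of fixed maps. -/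
lemma conv_conv_right (b : X →ₗ[k] Y' →ₗ[k] Z') (b' : Y →ₗ[k] Z →ₗ[k] Y') (f : C →ₗ[k] X)
    (g : C →ₗ[k] Y) (e : C →ₗ[k] Z) : conv b f (conv b' g e) =
      (TensorProduct.lift b ∘ₗ (TensorProduct.lift b').lTensor X) ∘ₗ
        conv (TensorProduct.mk k X (Y ⊗[k] Z)) f (conv (TensorProduct.mk k Y Z) g e) := by
  rw [comp_conv, conv_eq_lift_comp b', conv_comp_right]
  rfl

/-- Coassociativity moves the bracketing to the right; the inverse associator records the change in
the fixed map. -/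
lemma conv_conv_left (b : X' →ₗ[k] Z →ₗ[k] Z') (b' : X →ₗ[k] Y →ₗ[k] X') (f : C →ₗ[k] X)
    (g : C →ₗ[k] Y) (e : C →ₗ[k] Z) : conv b (conv b' f g) e =
      (TensorProduct.lift b ∘ₗ (TensorProduct.lift b').rTensor Z ∘ₗ
        (TensorProduct.assoc k X Y Z).symm.toLinearMap) ∘ₗ
        conv (TensorProduct.mk k X (Y ⊗[k] Z)) f (conv (TensorProduct.mk k Y Z) g e) := by
  rw [comp_conv]
  exact conv_assoc _ _ _ _ (fun x y z => rfl) _ _ _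

/-- By cocommutativity `x₁ ⊗ x₂ ⊗ x₃` is symmetric in its first two places, so the order in which
`f` and `g` receive their components can be exchanged; `leftComm` in the fixed map undoes the
exchange. -/
lemma conv_left_comm [IsCocomm k C] (b : Y →ₗ[k] Y' →ₗ[k] Z') (b' : X →ₗ[k] Z →ₗ[k] Y')
    (f : C →ₗ[k] X) (g : C →ₗ[k] Y) (e : C →ₗ[k] Z) : conv b g (conv b' f e) =
      (TensorProduct.lift b ∘ₗ (TensorProduct.lift b').lTensor Y ∘ₗ
        (TensorProduct.leftComm k X Y Z).toLinearMap) ∘ₗ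
        conv (TensorProduct.mk k X (Y ⊗[k] Z)) f (conv (TensorProduct.mk k Y Z) g e) := by
  have h : conv (TensorProduct.mk k Y (X ⊗[k] Z)) g (conv (TensorProduct.mk k X Z) f e) =
      (TensorProduct.leftComm k X Y Z).toLinearMap ∘ₗ
        conv (TensorProduct.mk k X (Y ⊗[k] Z)) f (conv (TensorProduct.mk k Y Z) g e) := by
    -- Bracket the outer pair `g, f` together, swap it by cocommutativity, and bracket back.
    rw [comp_conv, ← conv_assoc (TensorProduct.mk k Y X)
      (TensorProduct.curry (TensorProduct.assoc k Y X Z).toLinearMap) _ _ (fun x y z => rfl),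
      conv_comm (TensorProduct.mk k Y X)]
    exact conv_assoc _ _ _ _ (fun x y z => rfl) _ _ _
  rw [conv_conv_right, h]
  rfl

/-- Convolution over `C ⊗ D` of maps that factor as an action of `D` after an action of `C`. -/
lemma conv_tmul {b : X →ₗ[k] Y →ₗ[k] Z} {b' : X' →ₗ[k] Y' →ₗ[k] Z'} {α : D →ₗ[k] X →ₗ[k] X'}
    {β : D →ₗ[k] Y →ₗ[k] Y'} {γ : D →ₗ[k] Z →ₗ[k] Z'}
    (h : ∀ p q, γ.flip (b p q) = conv b' (α.flip p) (β.flip q))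
    {f : C →ₗ[k] X} {g : C →ₗ[k] Y} {F : C ⊗[k] D →ₗ[k] X'} {G : C ⊗[k] D →ₗ[k] Y'}
    (hF : ∀ x y, F (x ⊗ₜ y) = α y (f x)) (hG : ∀ x y, G (x ⊗ₜ y) = β y (g x)) (x : C) (y : D) :
    conv b' F G (x ⊗ₜ[k] y) = γ y (conv b f g x) := by
  simp only [conv, LinearMap.comp_apply]
  -- `Δ(x ⊗ y) = (x₁ ⊗ y₁) ⊗ (x₂ ⊗ y₂)`, so the left side is `b'(α(y₁) f(x₁), β(y₂) g(x₂))`. The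
  -- hypothesis `h` at `f(x₁)` and `g(x₂)` rewrites it as `γ(y)` applied to `b(f(x₁), g(x₂))`.
  rw [comul_tmul]
  generalize comul (R := k) x = w
  induction w using TensorProduct.induction_on with
  | zero => simp
  | add p p' hp hp' => simp only [TensorProduct.add_tmul, map_add, hp, hp']
  | tmul c c' =>
  have := LinearMap.congr_fun (h (f c) (g c')) y
  rw [LinearMap.flip_apply] at this
  rw [TensorProduct.map_tmul, TensorProduct.lift.tmul, this]
  simp only [conv, LinearMap.comp_apply]
  generalize comul (R := k) y = v
  induction v using TensorProduct.induction_on with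
  | zero => simp
  | add p p' hp hp' => simp only [TensorProduct.tmul_add, map_add, hp, hp']
  | tmul d d' => simp [TensorProduct.tensorTensorTensorComm_tmul, hF, hG]

/-- Translates the multiplicativity clause of `AlgMeasuringAt` into the language of convolutions. -/
lemma mul'_actTwo {R R' : Type u} [Ring R] [Algebra k R] [Ring R'] [Algebra k R']
    (f : C →ₗ[k] R →ₗ[k] R') (a b : R) (x : C) :
    LinearMap.mul' k R' (actTwo f x (a ⊗ₜ[k] b)) =
      conv (LinearMap.mul k R') (f.flip a) (f.flip b) x := by
  simp only [actTwo, conv, LinearMap.comp_apply]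
  generalize comul (R := k) x = z
  induction z using TensorProduct.induction_on with
  | zero => simp
  | add p p' hp hp' => simp only [map_add, LinearMap.add_apply, hp, hp']
  | tmul c d => simp

end ConvolutionCalculus

/-! ### The action on Hochschild chains and its recursive rules. -/

section ChainAction
variable {k : Type u} [Field k] {H H' : CommHopfAlgebroid k}
  {C : Type u} [AddCommGroup C] [Module k C] [Coalgebra k C] [IsCocomm k C]
  {Ψ : C →ₗ[k] H.U →ₗ[k] H'.U} {ψ : C →ₗ[k] H.A →ₗ[k] H'.A}

/-- The action of a measuring coalgebra on Hochschild chains. -/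
def chainsAct (h : IsHopfMeasuring Ψ ψ) : C →ₗ[k] H.Chains →ₗ[k] H'.Chains where
  toFun := chainMap h
  map_add' x y := LinearMap.ext fun z => map_add (chainAct h z).toLin x y
  map_smul' c x := LinearMap.ext fun z => map_smul (chainAct h z).toLin c x

variable (h : IsHopfMeasuring Ψ ψ)

/-- Holds by construction: `chainAct` is linear over the base into the module `Twisted`, whose
scalar action is this convolution. -/
lemma chainsAct_flip_smul (a : H.A) (z : H.Chains) : (chainsAct h).flip (a • z) =
    conv (smulLin H') (ψ.flip a) ((chainsAct h).flip z) :=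
  map_smul (chainAct h) a z

lemma chainsAct_flip_of_tprod (n : ℕ) (u : Fin n → H.U) :
    (chainsAct h).flip (BarComplex.Chains.of H.A H.U n (PiTensorProduct.tprod H.A u)) =
      actTuple Ψ n u :=
  LinearMap.ext fun x => chainMap_tprod h x n u

lemma chainsAct_flip_one :
    (chainsAct h).flip 1 = (counit (R := k)).smulRight (1 : H'.Chains) :=
  chainsAct_flip_of_tprod h 0 _

lemma chainsAct_flip_word_cons (u : H.U) (l : List H.U) :
    (chainsAct h).flip (BarComplex.word H.A (u :: l)) =
      conv (BarComplex.prependLin k) (Ψ.flip u) ((chainsAct h).flip (BarComplex.word H.A l)) := by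
  rw [BarComplex.word, BarComplex.word, chainsAct_flip_of_tprod, chainsAct_flip_of_tprod]
  rfl

/-- On words this is the recursion that defines `actTuple`. For multiples `a z` the scalar `x₂(a)`
has to move in front of `x₁(u)`, which is `prepend_twisted` and rests on cocommutativity. -/
lemma chainsAct_flip_prepend (u : H.U) (z : H.Chains) :
    (chainsAct h).flip (BarComplex.prepend u z) =
      conv (BarComplex.prependLin k) (Ψ.flip u) ((chainsAct h).flip z) := by
  induction z using BarComplex.chains_induction with
  | h0 => simp only [map_zero, conv_zero_right]
  | hadd x y hx hy => simp only [map_add, conv_add_right, hx, hy]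
  | hs a x hx => rw [map_smul, chainsAct_flip_smul, chainsAct_flip_smul, hx, prepend_twisted h]
  | hw l => rw [← BarComplex.word_cons, chainsAct_flip_word_cons]

/-- Over the base algebra the action is only twisted linear, but it is honestly linear over `k`, and
a sign comes from `k`. -/
lemma chainsAct_flip_neg_one_pow (n : ℕ) (z : H.Chains) :
    (chainsAct h).flip ((-1 : H.A) ^ n • z) = (-1 : k) ^ n • (chainsAct h).flip z := by
  rw [← map_smul, BarComplex.smul_base ((-1 : k) ^ n), map_pow, map_neg, map_one]

/-- Restriction of scalars to the ground field of an endomorphism of the chains. -/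
abbrev chainsLin (f : H.Chains →ₗ[H.A] H.Chains) : H.Chains →ₗ[k] H.Chains where
  toFun := f
  map_add' := map_add f
  map_smul' c x := by
    rw [BarComplex.smul_base, map_smul, ← BarComplex.smul_base, RingHom.id_apply]

/-- Needed because the sign involution occurs in the shuffle recursion. The action preserves tensor
degree; the induction expresses this through the fact that prepending a letter anticommutes with the
involution. -/
lemma chainsAct_flip_signMap (z : H.Chains) : (chainsAct h).flip (BarComplex.signMap z) =
    chainsLin BarComplex.signMap ∘ₗ (chainsAct h).flip z := by
  induction z using BarComplex.chains_induction with
  | h0 => simp only [map_zero, LinearMap.comp_zero]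
  | hadd x y hx hy => simp only [map_add, LinearMap.comp_add, hx, hy]
  | hs a x hx =>
    rw [map_smul, chainsAct_flip_smul, chainsAct_flip_smul, hx, comp_conv, conv_comp_right]
    -- Both sides convolve the same two functions; their bilinear maps agree because the sign
    -- involution is linear over the base. The same pattern settles scalar multiples in the lemmas
    -- on the boundary.
    congr 1
    ext a z
    exact (map_smul BarComplex.signMap a z).symm
  | hw l =>
  induction l with
  | nil =>
    rw [BarComplex.signMap_nil, BarComplex.word_nil, chainsAct_flip_one]
    ext x
    exact (((chainsLin BarComplex.signMap).map_smul _ _).trans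
      (congrArg _ BarComplex.signMap_one)).symm
  | cons u l ih =>
    rw [BarComplex.word_cons, BarComplex.signMap_prepend, map_neg, chainsAct_flip_prepend, ih,
      chainsAct_flip_prepend, comp_conv, conv_comp_right, ← conv_neg_bilin]
    congr 1
    ext a z
    exact (BarComplex.signMap_prepend a z).symm

/-! ### Compatibility with the Hochschild boundary. -/

omit [IsCocomm k C] in
lemma flip_mul_U (h : IsHopfMeasuring Ψ ψ) (u v : H.U) :
    Ψ.flip (u * v) = conv (LinearMap.mul k H'.U) (Ψ.flip u) (Ψ.flip v) := by
  refine LinearMap.ext fun x => ?_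
  rw [LinearMap.flip_apply, (h x).alg_U.map_mul, mul'_actTwo]

/-- Putting `0` in place of `ε_R` deletes the zeroth face. What remains multiplies the first two
letters or acts on the tail, and this determines the truncated boundary recursively. -/
lemma boundary_zero_prepend_prepend (u v : H.U) (z : H.Chains) :
    BarComplex.boundary 0 H.epsL (BarComplex.prepend u (BarComplex.prepend v z)) =
      -BarComplex.prepend (u * v) z -
        BarComplex.prepend u (BarComplex.boundary 0 H.epsL (BarComplex.prepend v z)) := by
  rw [BarComplex.boundary_prepend_zero, BarComplex.mulFirst_prepend]

/-- The truncation makes the induction close: the faces of the tail reappear as faces of the whole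
word except for the zeroth one, whose place is taken by the product of the first two letters. -/
lemma chainsAct_flip_boundary_zero_word (l : List H.U) :
    (chainsAct h).flip (BarComplex.boundary 0 H.epsL (BarComplex.word H.A l)) =
      chainsLin (BarComplex.boundary 0 H'.epsL) ∘ₗ
        (chainsAct h).flip (BarComplex.word H.A l) := by
  induction l with
  | nil =>
    rw [BarComplex.word_nil, BarComplex.boundary_one, map_zero, chainsAct_flip_one]
    ext x
    exact (((chainsLin (BarComplex.boundary 0 H'.epsL)).map_smul _ _).trans
      ((congrArg _ (BarComplex.boundary_one 0 H'.epsL)).trans (smul_zero _))).symm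
  | cons u l ih =>
  cases l with
  | nil =>
    rw [BarComplex.word_cons, BarComplex.word_nil, BarComplex.boundary_prepend_one, map_sub,
      chainsAct_flip_smul, chainsAct_flip_smul, LinearMap.zero_apply, map_zero, conv_zero_left,
      chainsAct_flip_prepend, chainsAct_flip_one, comp_conv]
    -- On a single letter the truncated boundary is `-ε(u)`, so this case is the compatibility of
    -- the measuring with the counits.
    have e : ψ.flip (H.epsL u) = H'.ε ∘ₗ Ψ.flip u := LinearMap.ext fun x => (h x).map_ε u
    have e' : (counit (R := k) (A := C)).smulRight (1 : H'.Chains) =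
      LinearMap.toSpanSingleton k H'.Chains 1 ∘ₗ counit := rfl
    rw [e, e', conv_comp_right, conv_comp_right, conv_comp_left, conv_counit_right,
      conv_counit_right]
    ext x
    simp only [LinearMap.sub_apply, LinearMap.zero_apply, LinearMap.comp_apply,
      LinearMap.flip_apply, LinearMap.compl₂_apply, LinearMap.toSpanSingleton_apply, one_smul,
      LinearMap.compr₂_apply]
    have := BarComplex.boundary_prepend_one 0 H'.epsL (Ψ x u)
    rw [LinearMap.zero_apply, zero_smul] at this
    exact this.symm
  | cons v l =>
    rw [BarComplex.boundary_word_cons, map_sub, map_sub, chainsAct_flip_prepend, ih,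
      LinearMap.zero_apply, zero_smul, map_zero, chainsAct_flip_word_cons,
      chainsAct_flip_word_cons h u (v :: l), chainsAct_flip_word_cons, flip_mul_U h]
    generalize (chainsAct h).flip (BarComplex.word H.A l) = G
    set P := BarComplex.prependLin (A := H'.A) (U := H'.U) k
    -- All terms become fixed maps after `x ↦ x₁(u) ⊗ (x₂(v) ⊗ G(x₃))`; the fixed maps agree by the
    -- recursion of the truncated boundary in `H'`.
    rw [comp_conv, comp_conv, conv_conv_left, conv_conv_right P, conv_conv_right (P.compr₂ _) P,
      zero_sub, ← LinearMap.neg_comp, ← LinearMap.sub_comp]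
    congr 1
    ext a b z
    exact (boundary_zero_prepend_prepend (H := H') a b z).symm

lemma chainsAct_flip_boundary_zero (z : H.Chains) :
    (chainsAct h).flip (BarComplex.boundary 0 H.epsL z) =
      chainsLin (BarComplex.boundary 0 H'.epsL) ∘ₗ (chainsAct h).flip z := by
  induction z using BarComplex.chains_induction with
  | h0 => simp only [map_zero, LinearMap.comp_zero]
  | hadd x y hx hy => simp only [map_add, LinearMap.comp_add, hx, hy]
  | hs a x hx =>
    rw [map_smul, chainsAct_flip_smul, chainsAct_flip_smul, hx, comp_conv, conv_comp_right]
    congr 1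
    ext a z
    exact (map_smul (BarComplex.boundary 0 H'.epsL) a z).symm
  | hw l => exact chainsAct_flip_boundary_zero_word h l

/-- The action of a measuring coalgebra on Hochschild chains commutes with the boundary. -/
lemma chainsAct_flip_boundary (z : H.Chains) :
    (chainsAct h).flip (BarComplex.boundary H.epsR H.epsL z) =
      chainsLin (BarComplex.boundary H'.epsR H'.epsL) ∘ₗ (chainsAct h).flip z := by
  induction z using BarComplex.word_cases with
  | h0 => simp only [map_zero, LinearMap.comp_zero]
  | hadd x y hx hy => simp only [map_add, LinearMap.comp_add, hx, hy]
  | hs a x hx =>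
    rw [map_smul, chainsAct_flip_smul, chainsAct_flip_smul, hx, comp_conv, conv_comp_right]
    congr 1
    ext a z
    exact (map_smul (BarComplex.boundary H'.epsR H'.epsL) a z).symm
  | h1 =>
    rw [BarComplex.boundary_one, map_zero, chainsAct_flip_one]
    ext x
    exact (((chainsLin (BarComplex.boundary H'.epsR H'.epsL)).map_smul _ _).trans
      ((congrArg _ (BarComplex.boundary_one H'.epsR H'.epsL)).trans (smul_zero _))).symm
  | hprepend u x =>
    -- The zeroth face uses `ε_R = ε ∘ S`, so compatibility with the counits and with the antipodes
    -- are both needed.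
    have e : ψ.flip (H.epsR u) = H'.ε ∘ₗ H'.S.toLinearMap ∘ₗ Ψ.flip u := LinearMap.ext fun x =>
      ((h x).map_ε _).trans (congrArg H'.ε ((h x).map_S u))
    -- The zeroth face and the truncated boundary are both convolutions of `Ψ.flip u` with the
    -- action on the tail, so their sum is a single convolution that can be compared with the
    -- boundary of `H'`.
    rw [BarComplex.boundary_prepend, map_add, chainsAct_flip_boundary_zero, chainsAct_flip_smul,
      chainsAct_flip_prepend, e, conv_comp_left, conv_comp_left, comp_conv, comp_conv,
      ← conv_add_bilin]
    congr 1
    ext a z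
    exact (BarComplex.boundary_prepend H'.epsR H'.epsL a z).symm

/-! ### Compatibility with the shuffle product. -/

/-- Double induction along the shuffle recursion: each of its two terms has one letter fewer inside
the product, removed from the left word or from the right one. -/
lemma chainsAct_flip_mul_word (l m : List H.U) :
    (chainsAct h).flip (BarComplex.word H.A l * BarComplex.word H.A m) =
      conv (LinearMap.mul k H'.Chains) ((chainsAct h).flip (BarComplex.word H.A l))
        ((chainsAct h).flip (BarComplex.word H.A m)) := by
  have e' : (counit (R := k) (A := C)).smulRight (1 : H'.Chains) =
    LinearMap.toSpanSingleton k H'.Chains 1 ∘ₗ counit := rfl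
  induction l generalizing m with
  | nil =>
    rw [BarComplex.word_nil, one_mul, chainsAct_flip_one, e', conv_comp_left, conv_counit_left]
    ext x
    simp [LinearMap.toSpanSingleton_apply]
  | cons u l ihl =>
  induction m with
  | nil =>
    rw [BarComplex.word_nil, mul_one, chainsAct_flip_one, e', conv_comp_right, conv_counit_right]
    ext x
    simp [LinearMap.toSpanSingleton_apply]
  | cons v m ihm =>
    have e1 := ihl (v :: m)
    -- The second term of the recursion contains the sign involution of the left tail. On a word it
    -- is a scalar `±1`, so the inner induction hypothesis still applies.
    have e2 : (chainsAct h).flip (BarComplex.prepend u (BarComplex.signMap (BarComplex.word H.A l)) *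
        BarComplex.word H.A m) = conv (LinearMap.mul k H'.Chains) ((chainsAct h).flip
          (BarComplex.prepend u (BarComplex.signMap (BarComplex.word H.A l))))
          ((chainsAct h).flip (BarComplex.word H.A m)) := by
      rw [BarComplex.signMap_word, map_smul, smul_mul_assoc, chainsAct_flip_neg_one_pow,
        chainsAct_flip_neg_one_pow, ← BarComplex.word_cons, ihm, conv_smul_left]
    simp only [BarComplex.word_cons] at e1 e2 ⊢
    rw [BarComplex.prepend_mul_prepend, map_sub, chainsAct_flip_prepend, chainsAct_flip_prepend, e1,
      e2, chainsAct_flip_prepend, chainsAct_flip_prepend, chainsAct_flip_prepend,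
      chainsAct_flip_signMap]
    generalize (chainsAct h).flip (BarComplex.word H.A l) = F
    generalize (chainsAct h).flip (BarComplex.word H.A m) = G
    set P := BarComplex.prependLin (A := H'.A) (U := H'.U) k
    -- In the second term of the recursion `v` stands before `u` and the left tail; cocommutativity
    -- moves it behind them. All terms are then fixed maps after `x ↦ x₁(u) ⊗ (F(x₂) ⊗ (x₃(v) ⊗
    -- G(x₄)))`.
    rw [conv_left_comm P (LinearMap.mul k H'.Chains) _ (Ψ.flip v) G, conv_comp_right P,
      conv_eq_lift_comp P (Ψ.flip v) G, conv_comp_right _ (TensorProduct.lift P),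
      conv_comp_right _ (TensorProduct.lift P), conv_conv_left _ P,
      conv_conv_left _ (P.compl₂ _), conv_conv_right P, ← LinearMap.comp_assoc,
      ← LinearMap.sub_comp]
    -- The remaining equality of fixed maps on pure tensors is the shuffle recursion in the target.
    refine congrArg (· ∘ₗ _) ?_
    ext a w b z
    exact (BarComplex.prepend_mul_prepend a b w z).symm

/-- The action of a measuring coalgebra on Hochschild chains is multiplicative for the shuffle
product. -/
lemma chainsAct_flip_mul (y z : H.Chains) : (chainsAct h).flip (y * z) =
    conv (LinearMap.mul k H'.Chains) ((chainsAct h).flip y) ((chainsAct h).flip z) := by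
  induction y using BarComplex.chains_induction with
  | h0 => simp only [zero_mul, map_zero, conv_zero_left]
  | hadd x y hx hy => simp only [add_mul, map_add, conv_add_left, hx, hy]
  | hs a x hx =>
    rw [smul_mul_assoc, chainsAct_flip_smul, chainsAct_flip_smul, hx]
    -- A scalar on the left factor already stands in front, so coassociativity is enough.
    exact (conv_assoc _ _ _ _ (fun a y z => smul_mul_assoc a y z) _ _ _).symm
  | hw l =>
  induction z using BarComplex.chains_induction with
  | h0 => simp only [mul_zero, map_zero, conv_zero_right]
  | hadd x y hx hy => simp only [mul_add, map_add, conv_add_right, hx, hy]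
  | hs a x hx =>
    -- A scalar on the right factor has to pass the left factor, which uses cocommutativity.
    rw [mul_smul_comm, chainsAct_flip_smul, chainsAct_flip_smul, hx,
      conv_left_comm (smulLin H'), conv_conv_right (LinearMap.mul k H'.Chains)]
    refine congrArg (· ∘ₗ _) ?_
    ext y a z
    exact (mul_smul_comm a y z).symm
  | hw m => exact chainsAct_flip_mul_word h l m

end ChainAction
-- The measuring induced on Hochschild homology.
section HomologyAction
variable {k : Type u} [Field k] {H H' : CommHopfAlgebroid k}
  {C : Type u} [AddCommGroup C] [Module k C] [Coalgebra k C] [IsCocomm k C]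
  {Ψ : C →ₗ[k] H.U →ₗ[k] H'.U} {ψ : C →ₗ[k] H.A →ₗ[k] H'.A}
  (h : IsHopfMeasuring Ψ ψ)

lemma boundary_chainMap (x : C) (z : H.Chains) :
    BarComplex.boundary H'.epsR H'.epsL (chainMap h x z) =
      chainMap h x (BarComplex.boundary H.epsR H.epsL z) :=
  (LinearMap.congr_fun (chainsAct_flip_boundary h z) x).symm

lemma chainMap_mem_cycles (x : C) {z : H.Chains} (hz : z ∈ H.cycles) :
    chainMap h x z ∈ H'.cycles := by
  rw [BarComplex.mem_cycles] at hz ⊢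
  rw [boundary_chainMap, hz, map_zero]

/-- The action of a measuring coalgebra on Hochschild cycles. -/
def cyclesAct : C →ₗ[k] H.cycles →ₗ[k] H'.cycles :=
  LinearMap.mk₂ k (fun x z => ⟨chainMap h x z, chainMap_mem_cycles h x z.2⟩)
    (fun x y z => Subtype.ext (LinearMap.congr_fun (map_add (chainsAct h) x y) z.1))
    (fun c x z => Subtype.ext (LinearMap.congr_fun (map_smul (chainsAct h) c x) z.1))
    (fun x y z => Subtype.ext (map_add (chainMap h x) y.1 z.1))
    (fun c x z => Subtype.ext (map_smul (chainMap h x) c z.1))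

lemma homology_mk_surjective (H : CommHopfAlgebroid k) :
    Function.Surjective (BarComplex.Homology.mk k H.epsR H.epsL) :=
  Ideal.Quotient.mkₐ_surjective k _

lemma homology_mk_eq_zero {H : CommHopfAlgebroid k} {z : H.cycles} :
    BarComplex.Homology.mk k H.epsR H.epsL z = 0 ↔
      ∃ w, BarComplex.boundary H.epsR H.epsL w = z :=
  Ideal.Quotient.eq_zero_iff_mem (I := BarComplex.boundaries k H.epsR H.epsL)

lemma homology_mk_cyclesAct_eq_zero (x : C) {z : H.cycles}
    (hz : BarComplex.Homology.mk k H.epsR H.epsL z = 0) :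
    BarComplex.Homology.mk k H'.epsR H'.epsL (cyclesAct h x z) = 0 := by
  rw [homology_mk_eq_zero] at hz ⊢
  obtain ⟨w, hw⟩ := hz
  exact ⟨chainMap h x w, (boundary_chainMap h x w).trans (congrArg _ hw)⟩

/-- The linear map on Hochschild homology induced by an element of a measuring coalgebra. -/
def homologyMap (x : C) : H.HH →ₗ[k] H'.HH :=
  -- Homology is identified with cycles modulo the kernel of the class map, and the action on cycles
  -- factors because it sends boundaries to boundaries.
  (LinearMap.ker (BarComplex.Homology.mk k H.epsR H.epsL).toLinearMap).liftQ
      ((BarComplex.Homology.mk k H'.epsR H'.epsL).toLinearMap ∘ₗ cyclesAct h x)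
      (fun _ hz => homology_mk_cyclesAct_eq_zero h x hz) ∘ₗ
    ((BarComplex.Homology.mk k H.epsR H.epsL).toLinearMap.quotKerEquivOfSurjective
      (homology_mk_surjective H)).symm.toLinearMap

lemma homologyMap_mk (x : C) (z : H.cycles) :
    homologyMap h x (BarComplex.Homology.mk k H.epsR H.epsL z) =
      BarComplex.Homology.mk k H'.epsR H'.epsL (cyclesAct h x z) := by
  have e : ((BarComplex.Homology.mk k H.epsR H.epsL).toLinearMap.quotKerEquivOfSurjective
      (homology_mk_surjective H)).symm (BarComplex.Homology.mk k H.epsR H.epsL z) =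
        Submodule.Quotient.mk z := by
    rw [LinearEquiv.symm_apply_eq]; rfl
  rw [homologyMap, LinearMap.comp_apply, LinearEquiv.coe_coe, e]
  rfl

/-- The action of a measuring coalgebra on Hochschild homology. -/
def homologyAct : C →ₗ[k] H.HH →ₗ[k] H'.HH where
  toFun := homologyMap h
  map_add' x y := by
    refine LinearMap.ext fun z => ?_
    obtain ⟨z, rfl⟩ := homology_mk_surjective H z
    simp only [LinearMap.add_apply, homologyMap_mk, map_add]
  map_smul' c x := by
    refine LinearMap.ext fun z => ?_
    obtain ⟨z, rfl⟩ := homology_mk_surjective H z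
    simp only [LinearMap.smul_apply, homologyMap_mk, map_smul, RingHom.id_apply]

lemma homologyAct_mk (x : C) (z : H.cycles) :
    homologyAct h x (BarComplex.Homology.mk k H.epsR H.epsL z) =
      BarComplex.Homology.mk k H'.epsR H'.epsL (cyclesAct h x z) :=
  homologyMap_mk h x z

lemma homologyAct_flip_mk (z : H.cycles) :
    (homologyAct h).flip (BarComplex.Homology.mk k H.epsR H.epsL z) =
      (BarComplex.Homology.mk k H'.epsR H'.epsL).toLinearMap ∘ₗ (cyclesAct h).flip z :=
  LinearMap.ext fun x => homologyAct_mk h x z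

/-- The inclusion of cycles into chains is injective and multiplicative, so the identity can be
checked among chains. -/
lemma cyclesAct_flip_mul (y z : H.cycles) : (cyclesAct h).flip (y * z) =
    conv (LinearMap.mul k H'.cycles) ((cyclesAct h).flip y) ((cyclesAct h).flip z) := by
  refine LinearMap.ext fun x => Subtype.ext ?_
  have h1 : ∀ z : H.cycles, H'.cycles.val.toLinearMap ∘ₗ (cyclesAct h).flip z =
    (chainsAct h).flip z.1 := fun z => rfl
  have h2 := comp_conv H'.cycles.val.toLinearMap (LinearMap.mul k H'.cycles)
    ((cyclesAct h).flip y) ((cyclesAct h).flip z)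
  have h3 : (LinearMap.mul k H'.cycles).compr₂ H'.cycles.val.toLinearMap =
    ((LinearMap.mul k H'.Chains).compl₂ H'.cycles.val.toLinearMap) ∘ₗ
      H'.cycles.val.toLinearMap := rfl
  rw [h3, ← conv_comp_left, ← conv_comp_right, h1, h1, ← chainsAct_flip_mul] at h2
  exact (LinearMap.congr_fun h2 x).symm

/-- The action of a measuring coalgebra on Hochschild homology is a measuring of algebras. -/
lemma homologyAct_isAlgMeasuring : IsAlgMeasuring (homologyAct h) := by
  refine fun x => ⟨fun a b => ?_, ?_⟩
  · obtain ⟨y, rfl⟩ := homology_mk_surjective H a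
    obtain ⟨z, rfl⟩ := homology_mk_surjective H b
    rw [mul'_actTwo, homologyAct_flip_mk, homologyAct_flip_mk, conv_comp_left, conv_comp_right,
      ← map_mul, homologyAct_mk]
    -- Taking classes is an algebra map, so it carries the convolution product of cycles to that of
    -- their classes.
    have e := comp_conv (BarComplex.Homology.mk k H'.epsR H'.epsL).toLinearMap
      (LinearMap.mul k H'.cycles) ((cyclesAct h).flip y) ((cyclesAct h).flip z)
    rw [← cyclesAct_flip_mul] at e
    refine (LinearMap.congr_fun e x).trans ?_
    congr 2
  · rw [← map_one (BarComplex.Homology.mk k H.epsR H.epsL), homologyAct_mk,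
      ← map_one (BarComplex.Homology.mk k H'.epsR H'.epsL), ← map_smul]
    -- The unit class is represented by the unit chain, on which `x` acts by its counit.
    exact congrArg _ (Subtype.ext (LinearMap.congr_fun (chainsAct_flip_one h) x))

end HomologyAction

/-! ### Behaviour of the chain action under coalgebra maps, tensor products and scalars. -/

section Naturality
variable {k : Type u} [Field k] {H H' H'' : CommHopfAlgebroid k}
  {C D : Type u} [AddCommGroup C] [Module k C] [Coalgebra k C] [IsCocomm k C]
  [AddCommGroup D] [Module k D] [Coalgebra k D] [IsCocomm k D]

/-- The chain action is built from the measuring by convolutions and the counit, both of which are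
compatible with coalgebra maps. The pulled-back measuring enters through equations because universal
properties supply it in that form. -/
lemma chainMap_comp_coalgHom {Ψ : C →ₗ[k] H.U →ₗ[k] H'.U} {ψ : C →ₗ[k] H.A →ₗ[k] H'.A}
    (h : IsHopfMeasuring Ψ ψ) {Ψ' : D →ₗ[k] H.U →ₗ[k] H'.U} {ψ' : D →ₗ[k] H.A →ₗ[k] H'.A}
    (h' : IsHopfMeasuring Ψ' ψ') (q : D →ₗc[k] C) (hΨ : Ψ ∘ₗ q.toLinearMap = Ψ')
    (hψ : ψ ∘ₗ q.toLinearMap = ψ') (x : D) : chainMap h' x = chainMap h (q.toLinearMap x) := by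
  subst hΨ hψ
  refine LinearMap.ext fun z => ?_
  suffices H : (chainsAct h').flip z = (chainsAct h).flip z ∘ₗ q.toLinearMap from
    LinearMap.congr_fun H x
  induction z using BarComplex.chains_induction with
  | h0 => simp only [map_zero, LinearMap.zero_comp]
  | hadd x y hx hy => simp only [map_add, LinearMap.add_comp, hx, hy]
  | hs a x hx =>
    rw [chainsAct_flip_smul, chainsAct_flip_smul, hx, ← conv_comp_coalgHom]
    rfl
  | hw l =>
  induction l with
  | nil =>
    rw [BarComplex.word_nil, chainsAct_flip_one, chainsAct_flip_one]
    refine LinearMap.ext fun x => ?_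
    exact congrArg (· • (1 : H'.Chains)) (coalgHom_counit q x).symm
  | cons u l ih =>
    rw [chainsAct_flip_word_cons, chainsAct_flip_word_cons, ih, ← conv_comp_coalgHom]
    rfl

/-- Both recursive rules of the action of `D` say that it distributes over a convolution through its
own comultiplication. This is the hypothesis of `conv_tmul`, used for scalars and for prepended
letters. -/
lemma chainMap_actComp {Ψ : C →ₗ[k] H.U →ₗ[k] H'.U} {ψ : C →ₗ[k] H.A →ₗ[k] H'.A}
    (h : IsHopfMeasuring Ψ ψ) {Ψ' : D →ₗ[k] H'.U →ₗ[k] H''.U} {ψ' : D →ₗ[k] H'.A →ₗ[k] H''.A}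
    (h' : IsHopfMeasuring Ψ' ψ') (h'' : IsHopfMeasuring (actComp Ψ Ψ') (actComp ψ ψ'))
    (x : C) (y : D) : chainMap h'' (x ⊗ₜ[k] y) = chainMap h' y ∘ₗ chainMap h x := by
  refine LinearMap.ext fun z => ?_
  -- The claim is made for all `x` and `y` at once because the induction hypothesis is applied to
  -- their Sweedler components.
  suffices H : ∀ x y, (chainsAct h'').flip z (x ⊗ₜ[k] y) =
    chainsAct h' y ((chainsAct h).flip z x) from H x y
  clear x y
  induction z using BarComplex.chains_induction with
  | h0 => simp
  | hadd v w hv hw => intro x y; simp only [map_add, LinearMap.add_apply, hv, hw]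
  | hs a w hw =>
    intro x y
    rw [chainsAct_flip_smul, chainsAct_flip_smul]
    exact conv_tmul (α := ψ') (β := chainsAct h') (γ := chainsAct h')
      (fun p q => chainsAct_flip_smul h' p q) (fun x y => rfl) hw x y
  | hw l =>
  induction l with
  | nil =>
    intro x y
    rw [BarComplex.word_nil, chainsAct_flip_one, chainsAct_flip_one]
    have e : chainsAct h' y 1 = counit (R := k) y • (1 : H''.Chains) :=
      LinearMap.congr_fun (chainsAct_flip_one h') y
    -- On the unit chain both sides are multiplication by counits, and the counit of `C ⊗ D` is the
    -- product of the two.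
    simp only [LinearMap.smulRight_apply, map_smul, e, smul_smul, TensorProduct.counit_tmul,
      smul_eq_mul, mul_comm]
  | cons u l ih =>
    intro x y
    rw [chainsAct_flip_word_cons, chainsAct_flip_word_cons]
    exact conv_tmul (α := Ψ') (β := chainsAct h') (γ := chainsAct h')
      (fun p q => chainsAct_flip_prepend h' p q) (fun x y => rfl) ih x y

/-- In the coalgebra `k` the element `1` is grouplike, so it acts as the identity on every tensor
factor. Linear maps out of `k` are compared at `1` only. -/
lemma chainMap_toSpanSingleton
    (h : IsHopfMeasuring (LinearMap.toSpanSingleton k (H.U →ₗ[k] H.U) LinearMap.id)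
      (LinearMap.toSpanSingleton k (H.A →ₗ[k] H.A) LinearMap.id)) (c : k) :
    chainMap h c = c • LinearMap.id := by
  refine LinearMap.ext fun z => ?_
  suffices H : (chainsAct h).flip z = LinearMap.toSpanSingleton k H.Chains z from
    LinearMap.congr_fun H c
  induction z using BarComplex.chains_induction with
  | h0 => simp
  | hadd v w hv hw => rw [map_add, hv, hw]; ext; simp
  | hs a w hw =>
    rw [chainsAct_flip_smul, hw]
    ext
    simp [conv, smulLin]
  | hw l =>
  induction l with
  | nil =>
    rw [BarComplex.word_nil, chainsAct_flip_one]
    ext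
    simp
  | cons u l ih =>
    rw [chainsAct_flip_word_cons, ih, BarComplex.word_cons]
    ext
    simp [conv, BarComplex.prependLin]

end Naturality
end MeasuringCoalgebra

/-! ### The enriched functor. -/

open CategoryTheory MeasuringCoalgebra MonoidalCategory
variable {k : Type u} [Field k]

/-- The coalgebra map between universal measuring coalgebras induced by the action on Hochschild
homology. -/
def homologyHom (H H' : CHALG k) :
    (H ⟶[CoCoalg k] H') ⟶ (H.toTilde ⟶[CoCoalg k] H'.toTilde) :=
  ((homologyEnrichment k).universal H.hopf H'.hopf).desc _
    (homologyAct (universal_isHopfMeasuring H H'))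
    ((algCondition_holds _).2 (homologyAct_isAlgMeasuring _))

/-- The equation characterising the map into the final measuring coalgebra; all later statements
about `homologyHom` go through it. -/
lemma universalHH_homologyHom (H H' : CHALG k) (x : (H ⟶[CoCoalg k] H').obj) :
    universalHH H H' (coalgLin (homologyHom H H') x) =
      homologyAct (universal_isHopfMeasuring H H') x :=
  LinearMap.congr_fun (((homologyEnrichment k).universal H.hopf H'.hopf).desc_proj _
    (homologyAct (universal_isHopfMeasuring H H'))
    ((algCondition_holds _).2 (homologyAct_isAlgMeasuring _))) x

/-- Along the unit the universal measuring pulls back to `c ↦ c • id`, so naturality reduces the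
claim to the action of the ground field by scalars. -/
lemma universalChainMap_unit (H : CHALG k) (c : k) :
    universalChainMap H H (coalgLin ((hopfEnrichment k).unit H.hopf) c) = c • LinearMap.id := by
  have e := ((hopfEnrichment k).universal H.hopf H.hopf).desc_proj (𝟙_ (CoCoalg k)) _
    ((hopfEnrichment k).holds_one H.hopf)
  refine (chainMap_comp_coalgHom (universal_isHopfMeasuring H H)
    (fun x => hopfMeasuringAt_id (H := H.hopf) x)
    ((hopfEnrichment k).unit H.hopf).hom.toCoalgHom' ?_ ?_ c).symm.trans
      (chainMap_toSpanSingleton _ c)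
  · exact (congrArg (LinearMap.fst k _ _ ∘ₗ ·) e).trans (LinearMap.ext fun _ => rfl)
  · exact (congrArg (LinearMap.snd k _ _ ∘ₗ ·) e).trans (LinearMap.ext fun _ => rfl)

/-- Along the composition map the universal measuring pulls back to the composite of two universal
measurings, so naturality reduces the claim to the action of a tensor product of coalgebras. -/
lemma universalChainMap_comp (H H' H'' : CHALG k) (x : (H ⟶[CoCoalg k] H').obj)
    (y : (H' ⟶[CoCoalg k] H'').obj) :
    universalChainMap H H'' (coalgLin ((hopfEnrichment k).comp' H.hopf H'.hopf H''.hopf)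
      (x ⊗ₜ[k] y)) = universalChainMap H' H'' y ∘ₗ universalChainMap H H' x := by
  have e := ((hopfEnrichment k).universal H.hopf H''.hopf).desc_proj
    ((H ⟶[CoCoalg k] H') ⊗ (H' ⟶[CoCoalg k] H'')) _
    ((hopfEnrichment k).holds_comp H.hopf H'.hopf H''.hopf _ _
      ((hopfEnrichment k).holds_eval H.hopf H'.hopf)
      ((hopfEnrichment k).holds_eval H'.hopf H''.hopf))
  have h1 : universalU H H'' ∘ₗ coalgLin ((hopfEnrichment k).comp' H.hopf H'.hopf H''.hopf) =
      actComp (universalU H H') (universalU H' H'') :=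
    (congrArg (LinearMap.fst k _ _ ∘ₗ ·) e).trans (TensorProduct.ext' fun _ _ => rfl)
  have h2 : universalA H H'' ∘ₗ coalgLin ((hopfEnrichment k).comp' H.hopf H'.hopf H''.hopf) =
      actComp (universalA H H') (universalA H' H'') :=
    (congrArg (LinearMap.snd k _ _ ∘ₗ ·) e).trans (TensorProduct.ext' fun _ _ => rfl)
  -- By `h1` and `h2` the composite is a pullback of the universal measuring along a coalgebra map,
  -- hence a measuring on all of the tensor product and not only on pure tensors.
  have hc : IsHopfMeasuring (actComp (universalU H H') (universalU H' H''))
      (actComp (universalA H H') (universalA H' H'')) := by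
    rw [← h1, ← h2]
    exact fun z => hopfMeasuringAt_comp_iff.2 (universal_isHopfMeasuring H H'' _)
  exact (chainMap_comp_coalgHom (universal_isHopfMeasuring H H'') hc
    ((hopfEnrichment k).comp' H.hopf H'.hopf H''.hopf).hom.toCoalgHom' h1 h2 (x ⊗ₜ[k] y)).symm.trans
      (chainMap_actComp _ _ hc x y)

/-- The functor enriched in cocommutative coalgebras that is given on hom-objects by the action of
universal measuring coalgebras on Hochschild homology. -/
def homologyFunctor (k : Type u) [Field k] :
    EnrichedFunctor (CoCoalg k) (CHALG k) (CHALGTilde k) where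
  obj := CHALG.toTilde
  map := homologyHom
  map_id H := by
    -- Maps into a final measuring coalgebra agree if they act equally on homology, and every
    -- homology class has a cycle as representative. The identity axiom thereby becomes a statement
    -- about chains.
    refine (homologyEnrichment k).hom_ext _ _ fun c => ?_
    change universalHH H H (coalgLin (homologyHom H H)
      (coalgLin ((hopfEnrichment k).unit H.hopf) c)) =
      (homologyEnrichment k).eval H.hopf H.hopf
        (Universal.linMap ((homologyEnrichment k).unit H.hopf) c)
    rw [universalHH_homologyHom, Enrichment.eval_unit]
    refine LinearMap.ext fun z => ?_
    obtain ⟨z, rfl⟩ := homology_mk_surjective H.hopf z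
    rw [homologyAct_mk]
    have e : cyclesAct (universal_isHopfMeasuring H H)
        (coalgLin ((hopfEnrichment k).unit H.hopf) c) z = c • z :=
      Subtype.ext (LinearMap.congr_fun (universalChainMap_unit H c) z.1)
    exact (congrArg _ e).trans
      (map_smul (BarComplex.Homology.mk k H.hopf.epsR H.hopf.epsL) c z)
  map_comp H H' H'' := by
    -- As for the identity, it suffices to compare actions, here on pure tensors `x ⊗ y` and classes
    -- of cycles, where both sides are represented by the same cycle.
    refine ((homologyEnrichment k).universal H.hopf H''.hopf).hom_ext _ _ ?_
    refine TensorProduct.ext' fun x y => ?_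
    change universalHH H H'' (coalgLin (homologyHom H H'')
      (coalgLin ((hopfEnrichment k).comp' H.hopf H'.hopf H''.hopf) (x ⊗ₜ[k] y))) =
      (homologyEnrichment k).eval H.hopf H''.hopf
        (Universal.linMap ((homologyEnrichment k).comp' H.hopf H'.hopf H''.hopf)
          (coalgLin (homologyHom H H') x ⊗ₜ[k] coalgLin (homologyHom H' H'') y))
    refine Eq.trans ?_ ((homologyEnrichment k).eval_comp H.hopf H'.hopf H''.hopf
      (coalgLin (homologyHom H H') x) (coalgLin (homologyHom H' H'') y)).symm
    rw [universalHH_homologyHom]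
    refine LinearMap.ext fun z => ?_
    change _ = universalHH H' H'' (coalgLin (homologyHom H' H'') y)
      (universalHH H H' (coalgLin (homologyHom H H') x) z)
    rw [universalHH_homologyHom, universalHH_homologyHom]
    obtain ⟨z, rfl⟩ := homology_mk_surjective H.hopf z
    rw [homologyAct_mk, homologyAct_mk, homologyAct_mk]
    have e : cyclesAct (universal_isHopfMeasuring H H'')
        (coalgLin ((hopfEnrichment k).comp' H.hopf H'.hopf H''.hopf) (x ⊗ₜ[k] y)) z =
        cyclesAct (universal_isHopfMeasuring H' H'') y
          (cyclesAct (universal_isHopfMeasuring H H') x z) :=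
      Subtype.ext (LinearMap.congr_fun (universalChainMap_comp H H' H'' x y) z.1)
    exact congrArg _ e

end

/-! ### The theorem. -/

open CategoryTheory
theorem theorem4p3 (k : Type u) [Field k] :
    ∃ (τ : EnrichedFunctor (CoCoalg k) (CHALG k) (CHALGTilde k))
      (hτ : ∀ H : CHALG k, τ.obj H = H.toTilde),
      ∀ (H H' : CHALG k) (x : (H ⟶[CoCoalg k] H').obj),
        (∀ c : H.hopf.Chains, hochschildBoundary H' (universalChainMap H H' x c) =
          universalChainMap H H' x (hochschildBoundary H c)) ∧
        ∀ z : H.hopf.cycles, ∃ hz : universalChainMap H H' x z ∈ H'.hopf.cycles,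
          universalHH H H'
              (coalgLin (τ.map H H' ≫ eqToHom (by rw [hτ H, hτ H'])) x) (homologyClass H z) =
            homologyClass H' ⟨universalChainMap H H' x z, hz⟩ := by
  refine ⟨homologyFunctor k, fun _ => rfl, fun H H' x => ⟨MeasuringCoalgebra.boundary_chainMap _ x, fun z =>
    ⟨MeasuringCoalgebra.chainMap_mem_cycles _ x z.2, ?_⟩⟩⟩
  -- The functor is the identity on objects by definition, so the transport along `hτ` is an
  -- identity morphism.
  change universalHH H H' (coalgLin (homologyHom H H' ≫ 𝟙 _) x) _ = _
  rw [Category.comp_id]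
  exact (LinearMap.congr_fun (universalHH_homologyHom H H' x) _).trans (MeasuringCoalgebra.homologyAct_mk _ x z)
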